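/- **Setting.** Consider edge-to-edge tilings of the unit sphere $S^2$ by finitely many spherical polygons. A spherical polygon is a connected open region whose boundary is a simple closed curve formed by great arcs; convexity is not assumed, so interior angles lie in $(0,2\pi)$. Assume that every tile is regular (all its edges have the same length and all its interior angles are equal), that every tile has at least $3$ edges, and that every vertex of the tiling has degree at least $3$. Tilings are identified when an isometry of the sphere carries the tiles, with their corners, of one to those of the other. For an octahedron or icosahedron inscribed in the sphere, its central projection is a tiling by $8$, respectively $20$, triangles. *Deleting* an independent set of vertices from this tiling means merging, for each deleted vertex $d$, the triangles at $d$ into a single tile whose corners are the neighbours of $d$. The *pyramid* over a vertex $a$ consists of the triangles at $a$ together with one further tile, namely the remaining part of the sphere, whose corners are the neighbours of $a$. Consider the following tilings. - $J_1$ (square pyramid): the pyramid over a vertex of the octahedron. - $J_2$ (pentagonal pyramid): the pyramid over a vertex of the icosahedron; its pentagon is concave. - $J_{11}$: the icosahedron with one vertex deleted. - $J_{62}$: the icosahedron with two vertices at distance $2$ deleted. - Pentagonal antiprism: the icosahedron with two opposite vertices (at distance $3$) deleted. - $J_{63}$: the icosahedron with three vertices, pairwise at distance $2$, deleted. **Proposition.**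 Let $T$ be a tiling as above. 1. If $T$ has a triangle with angles $\tfrac12\pi$, then $T$ is the octahedron or $J_1$. 2. If $T$ has a triangle with angles $\tfrac25\pi$, then $T$ is the icosahedron, the pentagonal antiprism, or one of $J_2$, $J_{11}$, $J_{62}$, $J_{63}$. -/

import Mathlib

open Set Filter Topology

noncomputable section

namespace SphTiling

/-- The unit sphere in Euclidean three-space. -/
abbrev S2 : Type := Metric.sphere (0 : EuclideanSpace ℝ (Fin 3)) 1

/-- The determinant `det (p, q, r)`. It is positive exactly when `r` lies strictly to the left of
the great circle through `p` and `q`, traversed from `p` to `q` (sphere seen from outside). -/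
def det3 (p q r : S2) : ℝ :=
  Matrix.det !![p.1 0, p.1 1, p.1 2; q.1 0, q.1 1, q.1 2; r.1 0, r.1 1, r.1 2]

/-- The great arc (of length less than `π`) joining two points that are not antipodal. -/
def arc (p q : S2) : Set S2 :=
  {x | ∃ a b : ℝ, 0 ≤ a ∧ 0 ≤ b ∧ x.1 = a • p.1 + b • q.1}

/-- The relative interior of `arc p q`. -/
def openArc (p q : S2) : Set S2 :=
  {x | ∃ a b : ℝ, 0 < a ∧ 0 < b ∧ x.1 = a • p.1 + b • q.1}

/-- The angle at `p`, in `[0, 2π)`, by which the direction of the arc from `p` to `q` has to be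
turned counterclockwise (sphere seen from outside) to become the direction of the arc from `p` to
`r`. With `u` and `w` the components of `q` and `r` tangent to the sphere at `p`, the real part
below is `⟪u, w⟫` and the imaginary part is `⟪p, u × w⟫`. -/
def ccwAngle (p q r : S2) : ℝ :=
  toIcoMod Real.two_pi_pos 0
    (Complex.arg ⟨inner ℝ q.1 r.1 - inner ℝ p.1 q.1 * inner ℝ p.1 r.1, det3 p q r⟩)

/-- A spherical polygon with at least three sides: a connected open region of the sphere whose
boundary is a simple closed curve made of great arcs. It need not be convex. The vertices are
listed in the cyclic order that keeps the region on the left. -/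
structure SphericalPolygon where
  /-- the number of vertices, which is the number of edges -/
  n : ℕ
  three_le : 3 ≤ n
  vertex : ZMod n → S2
  vertex_injective : Function.Injective vertex
  not_antipodal : ∀ i, (vertex (i + 1)).1 ≠ -(vertex i).1
  /-- distinct edges meet at most in a common endpoint of consecutive edges -/
  simple : ∀ i j, i ≠ j →
    ∀ x ∈ arc (vertex i) (vertex (i + 1)) ∩ arc (vertex j) (vertex (j + 1)),
      (j = i + 1 ∧ x = vertex j) ∨ (i = j + 1 ∧ x = vertex i)
  /-- the interior of the polygon -/
  region : Set S2
  region_open : IsOpen region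
  region_connected : IsConnected region
  frontier_region : frontier region = ⋃ i, arc (vertex i) (vertex (i + 1))
  /-- near every relatively interior point of an edge, the region is the left side of the edge -/
  region_left : ∀ i, ∀ x ∈ openArc (vertex i) (vertex (i + 1)),
    ∀ᶠ y in 𝓝 x, (y ∈ region ↔ 0 < det3 (vertex i) (vertex (i + 1)) y)

namespace SphericalPolygon

/-- The boundary curve. -/
def boundary (P : SphericalPolygon) : Set S2 :=
  ⋃ i, arc (P.vertex i) (P.vertex (i + 1))

/-- The length of the edge from vertex `i` to vertex `i + 1`. -/
def edgeLength (P : SphericalPolygon) (i : ZMod P.n) : ℝ :=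
  InnerProductGeometry.angle (P.vertex i).1 (P.vertex (i + 1)).1

/-- The interior angle at vertex `i`. -/
def angle (P : SphericalPolygon) (i : ZMod P.n) : ℝ :=
  ccwAngle (P.vertex i) (P.vertex (i + 1)) (P.vertex (i - 1))

/-- A polygon is regular if it is equilateral and all its angles are equal. -/
def IsRegular (P : SphericalPolygon) : Prop :=
  (∀ i j, P.edgeLength i = P.edgeLength j) ∧ ∀ i j, P.angle i = P.angle j

/-- The closed tile, recorded together with its set of corners. -/
def piece (P : SphericalPolygon) : Set S2 × Set S2 :=
  (range P.vertex, closure P.region)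

end SphericalPolygon

/-- An edge-to-edge tiling of the sphere by finitely many spherical polygons. -/
structure SphericalTiling where
  tiles : Set SphericalPolygon
  finite : tiles.Finite
  cover : (⋃ P ∈ tiles, closure P.region) = univ
  disjoint : ∀ P ∈ tiles, ∀ Q ∈ tiles, P ≠ Q → Disjoint P.region Q.region
  /-- no vertex of a tile lies in the relative interior of an edge of a tile -/
  edge_to_edge : ∀ P ∈ tiles, ∀ Q ∈ tiles, ∀ i, P.vertex i ∈ Q.boundary →
    P.vertex i ∈ range Q.vertex

namespace SphericalTiling

/-- All tiles are regular polygons. -/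
def IsRegular (T : SphericalTiling) : Prop :=
  ∀ P ∈ T.tiles, P.IsRegular

/-- The vertices of the tiling. -/
def vertices (T : SphericalTiling) : Set S2 :=
  ⋃ P ∈ T.tiles, range P.vertex

/-- The degree of a vertex: the number of angles, hence of tiles, incident with it. -/
def degree (T : SphericalTiling) (v : S2) : ℕ :=
  {P | P ∈ T.tiles ∧ v ∈ range P.vertex}.ncard

/-- The tiling has a triangle whose angles have the value `α`. -/
def HasTriangleWithAngle (T : SphericalTiling) (α : ℝ) : Prop :=
  ∃ P ∈ T.tiles, P.n = 3 ∧ ∀ i, P.angle i = α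

/-- Up to an isometry of the sphere, the tiles of `T`, each with its set of corners, are those
listed in `M`. -/
def IsCopyOf (T : SphericalTiling) (M : Set (Set S2 × Set S2)) : Prop :=
  ∃ g : S2 ≃ᵢ S2, SphericalPolygon.piece '' T.tiles = (fun p => (g '' p.1, g '' p.2)) '' M

end SphericalTiling

/-! ### The tilings in the classification

Each of them is given as the set of its tiles, a tile being a closed set together with its set
of corners. In what follows `V` is the vertex set of an octahedron or an icosahedron inscribed in
the sphere, and `c` is the inner product of adjacent vertices. -/

/-- The central projection to the sphere of the convex hull of `F`. -/
def centralProjection (F : Set S2) : Set S2 :=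
  {x | ∃ t : ℝ, 0 < t ∧ t • x.1 ∈ convexHull ℝ (Subtype.val '' F)}

/-- The vertices adjacent to `v`. -/
def neighbours (V : Set S2) (c : ℝ) (v : S2) : Set S2 :=
  {w | w ∈ V ∧ inner ℝ v.1 w.1 = c}

/-- The (vertex sets of) triangular faces: the triples of mutually adjacent vertices. -/
def faces (V : Set S2) (c : ℝ) : Set (Set S2) :=
  {F | F ⊆ V ∧ F.ncard = 3 ∧ ∀ v ∈ F, ∀ w ∈ F, v ≠ w → inner ℝ v.1 w.1 = c}

/-- The tiling obtained by deleting an independent set `D` of vertices: for each `d` in `D` the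
triangles at `d` are merged into one tile, whose corners are the neighbours of `d`. For `D = ∅`
this is the tiling by all the triangles. -/
def deleteVertices (V : Set S2) (c : ℝ) (D : Set S2) : Set (Set S2 × Set S2) :=
  {p | ∃ F ∈ faces V c, Disjoint F D ∧ p = (F, centralProjection F)} ∪
  {p | ∃ d ∈ D, p = (neighbours V c d, ⋃ F ∈ {F | F ∈ faces V c ∧ d ∈ F}, centralProjection F)}

/-- The pyramid with apex `a`: the triangles at `a`, and one further tile that is the rest of the
sphere, whose corners are the neighbours of `a`. -/
def pyramid (V : Set S2) (c : ℝ) (a : S2) : Set (Set S2 × Set S2) :=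
  {p | ∃ F ∈ faces V c, a ∈ F ∧ p = (F, centralProjection F)} ∪
  {(neighbours V c a, ⋃ F ∈ {F | F ∈ faces V c ∧ a ∉ F}, centralProjection F)}

/-- The vertices `± eᵢ` of the octahedron. -/
def octVertex (i : Fin 3) (s : ℤˣ) : S2 :=
  ⟨((s : ℤ) : ℝ) • EuclideanSpace.single i (1 : ℝ), by
    rcases Int.units_eq_one_or s with rfl | rfl <;> simp⟩

def octVertices : Set S2 := {x | ∃ i s, x = octVertex i s}

/-- The cyclic permutations of `(0, ±1, ±φ)`, where `φ` is the golden ratio: the `i`-th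
coordinate is `0`, the next one is `s`, and the one after it is `t φ`. -/
def icoVector (i : Fin 3) (s t : ℤˣ) : EuclideanSpace ℝ (Fin 3) :=
  WithLp.toLp 2 fun j =>
    if j = i then 0 else if j = i + 1 then ((s : ℤ) : ℝ) else ((t : ℤ) : ℝ) * Real.goldenRatio

theorem icoVector_ne_zero (i : Fin 3) (s t : ℤˣ) : icoVector i s t ≠ 0 := by
  intro h
  have h1 := congrArg (fun v : EuclideanSpace ℝ (Fin 3) => v (i + 1)) h
  simp [icoVector] at h1

/-- The vertices of the icosahedron, scaled to norm one. -/
def icoVertex (i : Fin 3) (s t : ℤˣ) : S2 :=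
  ⟨‖icoVector i s t‖⁻¹ • icoVector i s t, by
    rw [mem_sphere_zero_iff_norm, norm_smul, norm_inv, norm_norm,
      inv_mul_cancel₀ (norm_ne_zero_iff.mpr (icoVector_ne_zero i s t))]⟩

def icoVertices : Set S2 := {x | ∃ i s t, x = icoVertex i s t}

def octahedron : Set (Set S2 × Set S2) := deleteVertices octVertices 0 ∅

/-- The square pyramid. -/
def J1 : Set (Set S2 × Set S2) := pyramid octVertices 0 (octVertex 0 1)

def icosahedron : Set (Set S2 × Set S2) := deleteVertices icoVertices (1 / √5) ∅

/-- The pentagonal pyramid. -/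
def J2 : Set (Set S2 × Set S2) := pyramid icoVertices (1 / √5) (icoVertex 0 1 1)

/-- The gyroelongated pentagonal pyramid: the icosahedron with one vertex deleted. -/
def J11 : Set (Set S2 × Set S2) := deleteVertices icoVertices (1 / √5) {icoVertex 0 1 1}

/-- The pentagonal antiprism: the icosahedron with two opposite vertices deleted. -/
def pentagonalAntiprism : Set (Set S2 × Set S2) :=
  deleteVertices icoVertices (1 / √5) {icoVertex 0 1 1, icoVertex 0 (-1) (-1)}

/-- The metabidiminished icosahedron: two vertices at graph distance two deleted. -/
def J62 : Set (Set S2 × Set S2) :=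
  deleteVertices icoVertices (1 / √5) {icoVertex 0 1 1, icoVertex 0 1 (-1)}

/-- The tridiminished icosahedron: three vertices, pairwise at graph distance two, deleted. -/
def J63 : Set (Set S2 × Set S2) :=
  deleteVertices icoVertices (1 / √5) {icoVertex 0 1 1, icoVertex 0 1 (-1), icoVertex 2 1 (-1)}

end SphTiling

end

/-! The local constraint is rigid enough to force every tile onto the vertices of one octahedron or
icosahedron, and what remains is finite combinatorics.

Two tiles whose closures share a point that is not a vertex share a whole edge, and the sphere minus
the finitely many vertices is connected. So every property that passes across shared edges holds for
all tiles as soon as it holds for one (`tile_induction`). In particular all edges have the same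
length; its cosine `c` is read off the given triangle: `0` for the angle `π/2`, `1/√5` for `2π/5`.
These are the edges of the octahedron and the icosahedron.

The vertices of a regular polygon with `n` sides, edge length `e` and angle `α` form an orbit of a
rotation (`exists_model`). Since the boundary is simple, the rotation is by `2π/n`
(`rotation_angle_eq`), and the right triangle formed by the centre, a vertex and an edge midpoint
gives `cos (π/n) = cos (e/2) sin (α/2)`. An edge is at most as long as that of a regular `n`-gon on
a great circle, which bounds `n`; so only finitely many angles are possible. The angles at a vertex
sum to `2π` (`angle_sum`) and there are at least three of them. This excludes all tiles except
triangles of angle `π/2` and hemispherical squares in the first case, and triangles of angle `2π/5`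
and pentagons of angle `4π/5` or `6π/5` in the second (`octahedral_tiles`, `icosahedral_tiles`).

Rotate the vertex set `V` of the octahedron or icosahedron so that it contains an edge of one tile.
Continuing an edge of `V` at one of the remaining angles leads to a point of `V` again
(`ContainsTurns`), so by `tile_induction` all corners of all tiles lie in `V` (`exists_copy`). A
regular polygon is star-shaped about its centre, and this identifies the tile as a set: a face, the
cap of faces around a vertex, or the complement of a cap (`IsBlock`).

If the complement of a cap occurs, the angle sum leaves no choice but the faces of that cap, and the
tiling is a pyramid (`pieces_eq_pyramid`). Otherwise it arises by deleting an independent set of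
vertices (`pieces_eq_deleteVertices`). Reflections in bisecting planes move any apex to the standard
one and reduce the independent sets of the icosahedron to five (`ico_independent`). The finite facts
about `V` are decided by exact arithmetic in `ℤ[φ]`. -/

noncomputable section
namespace SphTiling

/-! ### Vectors in three-space -/

/-- Euclidean three-space. -/
abbrev E3 : Type := EuclideanSpace ℝ (Fin 3)

/-- The scalar triple product. -/
def triple (x y z : E3) : ℝ :=
  x 0 * (y 1 * z 2 - y 2 * z 1) - x 1 * (y 0 * z 2 - y 2 * z 0) + x 2 * (y 0 * z 1 - y 1 * z 0)

/-- The cross product. -/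
def cross (x y : E3) : E3 :=
  !₂[x 1 * y 2 - x 2 * y 1, x 2 * y 0 - x 0 * y 2, x 0 * y 1 - x 1 * y 0]

theorem det3_eq_triple (p q r : S2) : det3 p q r = triple p.1 q.1 r.1 := by
  simp only [det3, triple, Matrix.det_fin_three, Matrix.of_apply, Matrix.cons_val', Matrix.cons_val,
    Matrix.cons_val_fin_one]
  ring

theorem inner_eq_coord (x y : E3) : inner ℝ x y = x 0 * y 0 + x 1 * y 1 + x 2 * y 2 := by
  simp [PiLp.inner_apply, Fin.sum_univ_three, mul_comm]

theorem E3.ext' {x y : E3} (h0 : x 0 = y 0) (h1 : x 1 = y 1) (h2 : x 2 = y 2) : x = y := by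
  ext i; fin_cases i <;> assumption

theorem inner_cross (x y z : E3) : inner ℝ (cross x y) z = triple x y z := by
  simp [inner_eq_coord, cross, triple]; ring

theorem triple_add_right (x y z w : E3) : triple x y (z + w) = triple x y z + triple x y w := by
  simp [triple]; ring

theorem triple_smul_right (x y z : E3) (a : ℝ) : triple x y (a • z) = a * triple x y z := by
  simp [triple]; ring

theorem triple_smul_mid (x y z : E3) (a : ℝ) : triple x (a • y) z = a * triple x y z := by
  simp [triple]; ring

theorem triple_smul_left (x y z : E3) (a : ℝ) : triple (a • x) y z = a * triple x y z := by
  simp [triple]; ring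

theorem triple_rotate (x y z : E3) : triple x y z = triple y z x := by
  simp [triple]; ring

theorem triple_swap (x y z : E3) : triple y x z = -triple x y z := by
  simp [triple]; ring

theorem triple_self_right (x y : E3) : triple x y y = 0 := by
  simp [triple]; ring

theorem triple_self_outer (x y : E3) : triple x y x = 0 := by
  simp [triple]; ring

theorem triple_sub_right (x y z w : E3) : triple x y (z - w) = triple x y z - triple x y w := by
  simp [triple]; ring

theorem continuous_triple_right (x y : E3) : Continuous fun z => triple x y z := by
  unfold triple; fun_prop

/-- The Gram determinant. Triple products are therefore known up to sign from inner products, which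
is used throughout to identify points by their distances and a side. -/
theorem triple_sq (p q r : E3) : triple p q r ^ 2 =
    inner ℝ p p * inner ℝ q q * inner ℝ r r + 2 * (inner ℝ p q * inner ℝ q r * inner ℝ p r)
      - inner ℝ p p * inner ℝ q r ^ 2 - inner ℝ q q * inner ℝ p r ^ 2
      - inner ℝ r r * inner ℝ p q ^ 2 := by
  simp only [inner_eq_coord, triple]; ring

theorem inner_self_S2 (p : S2) : inner ℝ p.1 p.1 = (1 : ℝ) := by
  rw [real_inner_self_eq_norm_sq, norm_eq_of_mem_sphere]; norm_num

theorem inner_self_of_norm {x : E3} (h : ‖x‖ = 1) : inner ℝ x x = (1 : ℝ) := by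
  rw [real_inner_self_eq_norm_sq, h]; norm_num

theorem norm_eq_one_of_inner {x : E3} (h : inner ℝ x x = (1 : ℝ)) : ‖x‖ = 1 := by
  rw [real_inner_self_eq_norm_sq] at h
  nlinarith [norm_nonneg x]

theorem triple_sq_unit {p q r : E3} (hp : ‖p‖ = 1) (hq : ‖q‖ = 1) (hr : ‖r‖ = 1) :
    triple p q r ^ 2 = 1 + 2 * (inner ℝ p q * inner ℝ q r * inner ℝ p r)
      - inner ℝ q r ^ 2 - inner ℝ p r ^ 2 - inner ℝ p q ^ 2 := by
  rw [triple_sq, inner_self_of_norm hp, inner_self_of_norm hq, inner_self_of_norm hr]; ring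

/-- A vector is determined by its inner products with two independent unit vectors and its triple
product with them. -/
theorem eq_of_inner_of_triple {p q x y : E3} (hp : ‖p‖ = 1) (hq : ‖q‖ = 1)
    (hc : inner ℝ p q ^ 2 < (1 : ℝ)) (h1 : inner ℝ p x = (inner ℝ p y : ℝ))
    (h2 : inner ℝ q x = (inner ℝ q y : ℝ)) (h3 : triple p q x = triple p q y) : x = y := by
  have e1 : inner ℝ p (x - y) = (0 : ℝ) := by rw [inner_sub_right, h1, sub_self]
  have e2 : inner ℝ q (x - y) = (0 : ℝ) := by rw [inner_sub_right, h2, sub_self]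
  have e3 : triple p q (x - y) = 0 := by rw [triple_sub_right, h3, sub_self]
  -- All mixed terms vanish, and what is left is `|x - y|² (1 - ⟪p, q⟫²) = 0`.
  have := triple_sq p q (x - y)
  rw [e1, e2, e3, inner_self_of_norm hp, inner_self_of_norm hq] at this
  have h0 : inner ℝ (x - y) (x - y) = (0 : ℝ) := by
    have : inner ℝ (x - y) (x - y) * (1 - inner ℝ p q ^ 2) = (0 : ℝ) := by linarith
    rcases mul_eq_zero.1 this with h | h
    · exact h
    · linarith
  exact sub_eq_zero.1 (inner_self_eq_zero.1 h0)

/-! ### Rotations -/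

/-- An orientation preserving linear isometry. -/
def IsRot (L : E3 ≃ₗᵢ[ℝ] E3) : Prop := ∀ x y z, triple (L x) (L y) (L z) = triple x y z

/-- The linear map sending the standard basis to the given vectors. -/
def frameMap (e f g : E3) : E3 →ₗ[ℝ] E3 where
  toFun x := x 0 • e + x 1 • f + x 2 • g
  map_add' x y := by simp [add_smul]; abel
  map_smul' a x := by simp [mul_smul]

theorem frameMap_apply (e f g x : E3) : frameMap e f g x = x 0 • e + x 1 • f + x 2 • g := rfl

theorem triple_frameMap (e f g x y z : E3) :
    triple (frameMap e f g x) (frameMap e f g y) (frameMap e f g z) =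
      triple x y z * triple e f g := by
  simp [frameMap_apply, triple]; ring

theorem exists_rot_frame {p q : E3} (hp : ‖p‖ = 1) (hq : ‖q‖ = 1)
    (hpq : inner ℝ p q = (0 : ℝ)) :
    ∃ L : E3 ≃ₗᵢ[ℝ] E3, IsRot L ∧ (∀ x, L x = x 0 • p + x 1 • q + x 2 • cross p q) := by
  have hpp := inner_self_of_norm hp
  have hqq := inner_self_of_norm hq
  have h1 : inner ℝ p (cross p q) = (0 : ℝ) := by
    rw [real_inner_comm, inner_cross, triple_self_outer]
  have h2 : inner ℝ q (cross p q) = (0 : ℝ) := by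
    rw [real_inner_comm, inner_cross, triple_self_right]
  have h3 : inner ℝ (cross p q) (cross p q) = (1 : ℝ) := by
    have e : inner ℝ (cross p q) (cross p q) =
        inner ℝ p p * inner ℝ q q - (inner ℝ p q : ℝ) ^ 2 := by
      simp only [inner_eq_coord]; simp [cross]; ring
    rw [e, hpp, hqq, hpq]; norm_num
  have hn : ∀ x, ‖frameMap p q (cross p q) x‖ = ‖x‖ := by
    intro x
    have : inner ℝ (frameMap p q (cross p q) x) (frameMap p q (cross p q) x) =
        (inner ℝ x x : ℝ) := by
      simp only [frameMap_apply, inner_add_left, inner_add_right, real_inner_smul_left,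
        real_inner_smul_right, hpp, hqq, hpq, h1, h2, h3, real_inner_comm p q,
        real_inner_comm p (cross p q), real_inner_comm q (cross p q)]
      rw [inner_eq_coord]; ring
    rw [real_inner_self_eq_norm_sq, real_inner_self_eq_norm_sq] at this
    exact (sq_eq_sq₀ (norm_nonneg _) (norm_nonneg _)).1 this
  refine ⟨LinearIsometry.toLinearIsometryEquiv ⟨frameMap p q (cross p q), hn⟩ rfl, ?_, ?_⟩
  · intro x y z
    change triple (frameMap p q (cross p q) x) (frameMap p q (cross p q) y)
      (frameMap p q (cross p q) z) = _
    rw [triple_frameMap, ← inner_cross p q, h3, mul_one]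
  · intro x; rfl

theorem IsRot.symm {L : E3 ≃ₗᵢ[ℝ] E3} (h : IsRot L) : IsRot L.symm := by
  intro x y z
  rw [← h]; simp

theorem IsRot.trans {L M : E3 ≃ₗᵢ[ℝ] E3} (h : IsRot L) (h' : IsRot M) : IsRot (L.trans M) := by
  intro x y z
  simp only [LinearIsometryEquiv.trans_apply]
  rw [h', h]

theorem inner_rot (L : E3 ≃ₗᵢ[ℝ] E3) (x y : E3) : inner ℝ (L x) (L y) = (inner ℝ x y : ℝ) :=
  L.inner_map_map x y

theorem exists_frame_of_pair {p q : E3} (hp : ‖p‖ = 1) (hq : ‖q‖ = 1) {c : ℝ}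
    (hpq : inner ℝ p q = c) (hc : c ^ 2 < 1) :
    ∃ L : E3 ≃ₗᵢ[ℝ] E3, IsRot L ∧ L !₂[1, 0, 0] = p ∧ L !₂[c, √(1 - c ^ 2), 0] = q := by
  set s := √(1 - c ^ 2) with hs
  have hs0 : 0 < s := Real.sqrt_pos.2 (by linarith)
  have hs2 : s * s = 1 - c ^ 2 := Real.mul_self_sqrt (by linarith)
  have hpp := inner_self_of_norm hp
  have hqq := inner_self_of_norm hq
  have hu : ‖s⁻¹ • (q - c • p)‖ = 1 := by
    apply norm_eq_one_of_inner
    simp only [inner_sub_left, inner_sub_right, real_inner_smul_left,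
        real_inner_smul_right, hpp, hqq, hpq, real_inner_comm p q]
    field_simp
    nlinarith
  have h0 : inner ℝ p (s⁻¹ • (q - c • p)) = (0 : ℝ) := by
    simp only [inner_sub_right, real_inner_smul_right, hpp, hpq]; ring
  obtain ⟨L, hL, hLx⟩ := exists_rot_frame hp hu h0
  refine ⟨L, hL, by rw [hLx]; simp, ?_⟩
  rw [hLx]
  simp [smul_smul, mul_inv_cancel₀ hs0.ne']

/-- Both pairs are rotated images of the same standard pair, obtained by Gram–Schmidt. -/
theorem exists_rot {p q p' q' : E3} (hp : ‖p‖ = 1) (hq : ‖q‖ = 1) (hp' : ‖p'‖ = 1)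
    (hq' : ‖q'‖ = 1) (h : inner ℝ p q = (inner ℝ p' q' : ℝ)) (hc : inner ℝ p q ^ 2 < (1 : ℝ)) :
    ∃ L : E3 ≃ₗᵢ[ℝ] E3, IsRot L ∧ L p = p' ∧ L q = q' := by
  obtain ⟨A, hA, hA1, hA2⟩ := exists_frame_of_pair hp hq rfl hc
  obtain ⟨B, hB, hB1, hB2⟩ := exists_frame_of_pair hp' hq' h.symm hc
  refine ⟨A.symm.trans B, hA.symm.trans hB, ?_, ?_⟩
  · rw [← hA1]; simp [hB1]
  · rw [← hA2]; simp [hB2]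

/-- The isometry of the sphere given by a linear isometry. -/
def sphereMap (L : E3 ≃ₗᵢ[ℝ] E3) : S2 ≃ᵢ S2 where
  toFun x := ⟨L x.1, by simp⟩
  invFun x := ⟨L.symm x.1, by simp⟩
  left_inv x := by simp
  right_inv x := by simp
  isometry_toFun := by
    intro x y
    exact L.isometry x.1 y.1

@[simp] theorem sphereMap_val (L : E3 ≃ₗᵢ[ℝ] E3) (x : S2) : (sphereMap L x).1 = L x.1 := rfl

theorem S2.ne_zero (x : S2) : x.1 ≠ 0 := by
  intro h
  have := norm_eq_of_mem_sphere x
  rw [h] at this; simp at this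

/-- The radial projection to the sphere. -/
def normalize (x : E3) (hx : x ≠ 0) : S2 :=
  ⟨‖x‖⁻¹ • x, by
    rw [mem_sphere_zero_iff_norm, norm_smul, norm_inv, norm_norm,
      inv_mul_cancel₀ (norm_ne_zero_iff.mpr hx)]⟩

theorem normalize_val (x : E3) (hx : x ≠ 0) : (normalize x hx).1 = ‖x‖⁻¹ • x := rfl

end SphTiling
end
noncomputable section
namespace SphTiling

/-! ### Regular polygons -/

theorem ccwAngle_mem (p q r : S2) : ccwAngle p q r ∈ Ico 0 (2 * Real.pi) := by
  have := toIcoMod_mem_Ico Real.two_pi_pos 0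
    (Complex.arg ⟨inner ℝ q.1 r.1 - inner ℝ p.1 q.1 * inner ℝ p.1 r.1, det3 p q r⟩)
  rwa [zero_add] at this

/-- By the Gram determinant, the complex number whose argument defines `ccwAngle` has modulus `ρ`,
the product of the sines of the two arc lengths. The real part is then the spherical law of cosines.
Giving `ρ` through its square avoids square roots. -/
theorem ccwAngle_spec (p q r : S2) {ρ : ℝ} (hρ : 0 ≤ ρ)
    (h : ρ ^ 2 = (1 - inner ℝ p.1 q.1 ^ 2) * (1 - inner ℝ p.1 r.1 ^ 2)) :
    inner ℝ q.1 r.1 - inner ℝ p.1 q.1 * inner ℝ p.1 r.1 = ρ * Real.cos (ccwAngle p q r) ∧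
      triple p.1 q.1 r.1 = ρ * Real.sin (ccwAngle p q r) := by
  set z : ℂ := ⟨inner ℝ q.1 r.1 - inner ℝ p.1 q.1 * inner ℝ p.1 r.1, det3 p q r⟩ with hz
  have hn : ‖z‖ = ρ := by
    rw [← sq_eq_sq₀ (norm_nonneg _) hρ, h, ← Complex.normSq_eq_norm_sq, Complex.normSq_apply, hz]
    simp only [det3_eq_triple]
    have := triple_sq_unit (norm_eq_of_mem_sphere p) (norm_eq_of_mem_sphere q)
      (norm_eq_of_mem_sphere r)
    nlinarith
  have hm : ccwAngle p q r = Complex.arg z - toIcoDiv Real.two_pi_pos 0 (Complex.arg z) *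
      (2 * Real.pi) := by
    rw [ccwAngle, ← self_sub_toIcoDiv_zsmul, zsmul_eq_mul]
  rw [hm, Real.cos_sub_int_mul_two_pi, Real.sin_sub_int_mul_two_pi, ← hn,
    Complex.norm_mul_cos_arg, Complex.norm_mul_sin_arg]
  simp [hz, det3_eq_triple]

namespace SphericalPolygon

variable (P : SphericalPolygon)

instance : NeZero P.n := ⟨by have := P.three_le; omega⟩

instance : Fact (1 < P.n) := ⟨by have := P.three_le; omega⟩

theorem norm_vertex (i : ZMod P.n) : ‖(P.vertex i).1‖ = 1 := norm_eq_of_mem_sphere _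

theorem inner_vertex_lt_one (i : ZMod P.n) :
    inner ℝ (P.vertex i).1 (P.vertex (i + 1)).1 < (1 : ℝ) := by
  refine lt_of_le_of_ne ?_ ?_
  · have := real_inner_le_norm (P.vertex i).1 (P.vertex (i + 1)).1
    rwa [norm_vertex, norm_vertex, one_mul] at this
  · intro h
    rw [inner_eq_one_iff_of_norm_eq_one (P.norm_vertex _) (P.norm_vertex _)] at h
    have := P.vertex_injective (Subtype.ext h)
    simp at this

theorem neg_one_lt_inner_vertex (i : ZMod P.n) :
    (-1 : ℝ) < inner ℝ (P.vertex i).1 (P.vertex (i + 1)).1 := by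
  refine lt_of_le_of_ne ?_ ?_
  · have := neg_le_of_abs_le (abs_real_inner_le_norm (P.vertex i).1 (P.vertex (i + 1)).1)
    rwa [norm_vertex, norm_vertex, one_mul] at this
  · intro h
    have h' : inner ℝ (P.vertex (i + 1)).1 (-(P.vertex i).1) = (1 : ℝ) := by
      rw [inner_neg_right, real_inner_comm, ← h, neg_neg]
    rw [inner_eq_one_iff_of_norm_eq_one (P.norm_vertex _) (by rw [norm_neg]; exact P.norm_vertex _)]
      at h'
    exact P.not_antipodal i h'

/-- The data of an equilateral and equiangular polygon: `c` is the cosine of the edge length and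
`α` is the angle. -/
def HasShape (c α : ℝ) : Prop :=
  (∀ i, inner ℝ (P.vertex i).1 (P.vertex (i + 1)).1 = c) ∧ ∀ i, P.angle i = α

variable {P}

theorem IsRegular.hasShape (h : P.IsRegular) :
    P.HasShape (inner ℝ (P.vertex 0).1 (P.vertex (0 + 1)).1) (P.angle 0) := by
  refine ⟨fun i => ?_, fun i => h.2 i 0⟩
  have := h.1 i 0
  unfold edgeLength at this
  have h2 := congrArg Real.cos this
  rwa [InnerProductGeometry.cos_angle, InnerProductGeometry.cos_angle, norm_vertex, norm_vertex,
    norm_vertex, norm_vertex, one_mul, div_one, div_one] at h2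

namespace HasShape

variable {c α : ℝ}

theorem lt_one (h : P.HasShape c α) : c < 1 := h.1 0 ▸ P.inner_vertex_lt_one 0

theorem neg_one_lt (h : P.HasShape c α) : -1 < c := h.1 0 ▸ P.neg_one_lt_inner_vertex 0

theorem angle_mem (h : P.HasShape c α) : α ∈ Ico 0 (2 * Real.pi) := by
  rw [← h.2 0]; exact ccwAngle_mem _ _ _

/-- This is `ccwAngle_spec` at the middle vertex, where `ρ = 1 - c²`. The two numbers determine
vertex `i + 2` from its two predecessors. -/
theorem inner_two (h : P.HasShape c α) (i : ZMod P.n) :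
    inner ℝ (P.vertex i).1 (P.vertex (i + 2)).1 = c ^ 2 + (1 - c ^ 2) * Real.cos α ∧
      triple (P.vertex i).1 (P.vertex (i + 1)).1 (P.vertex (i + 2)).1 =
        (1 - c ^ 2) * Real.sin α := by
  have h1 := h.1 i
  have h2 := h.1 (i + 1)
  have h3 := h.2 (i + 1)
  have e : i + 1 + 1 = i + 2 := by ring
  unfold angle at h3
  rw [e, add_sub_cancel_right] at h3
  rw [e] at h2
  have hc := h.lt_one
  have hc' := h.neg_one_lt
  have := ccwAngle_spec (P.vertex (i + 1)) (P.vertex (i + 2)) (P.vertex i)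
    (ρ := 1 - c ^ 2) (by nlinarith) (by
      rw [h2, real_inner_comm, h1]; ring)
  rw [h3, h2, real_inner_comm (P.vertex i).1 (P.vertex (i + 1)).1, h1,
    real_inner_comm (P.vertex i).1] at this
  refine ⟨by linarith [this.1], ?_⟩
  rw [triple_rotate, this.2]

end HasShape

end SphericalPolygon

/-- The vertices of a regular polygon around the third coordinate axis. -/
def modelVertex (r h ω : ℝ) (x : ℝ) : E3 :=
  !₂[r * Real.cos (x * ω), r * Real.sin (x * ω), h]

theorem inner_modelVertex (r h ω x y : ℝ) :
    inner ℝ (modelVertex r h ω x) (modelVertex r h ω y) =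
      r ^ 2 * Real.cos ((y - x) * ω) + h ^ 2 := by
  rw [sub_mul, Real.cos_sub]
  simp [inner_eq_coord, modelVertex]; ring

theorem triple_modelVertex (r h ω x y z : ℝ) :
    triple (modelVertex r h ω x) (modelVertex r h ω y) (modelVertex r h ω z) =
      h * r ^ 2 * (Real.sin ((y - x) * ω) + Real.sin ((z - y) * ω) - Real.sin ((z - x) * ω)) := by
  rw [sub_mul, sub_mul, sub_mul, Real.sin_sub, Real.sin_sub, Real.sin_sub]
  simp [triple, modelVertex]; ring

set_option maxHeartbeats 1000000 in
/-- The vertices of a regular polygon form an orbit of a rotation. -/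
theorem SphericalPolygon.HasShape.exists_model {P : SphericalPolygon} {c α : ℝ}
    (hs : P.HasShape c α) : ∃ (L : E3 ≃ₗᵢ[ℝ] E3) (r h ω : ℝ), IsRot L ∧ 0 < r ∧ r ^ 2 + h ^ 2 = 1 ∧
      0 < ω ∧ ω ≤ Real.pi ∧ 1 + Real.cos ω = (1 + c) * (1 - Real.cos α) / 2 ∧
      2 * (r * Real.sin (ω / 2)) ^ 2 = 1 - c ∧
      2 * (h * Real.sin (ω / 2)) ^ 2 = (1 + c) * (1 + Real.cos α) / 2 ∧
      (0 < h ↔ 0 < Real.cos (α / 2)) ∧ (h < 0 ↔ Real.cos (α / 2) < 0) ∧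
      ∀ k : ℕ, (P.vertex k).1 = L (modelVertex r h ω k) := by
  have hc1 := hs.lt_one
  have hc2 := hs.neg_one_lt
  obtain ⟨ha0, ha1⟩ := hs.angle_mem
  -- Cosine and sine of half the edge length.
  set C := √((1 + c) / 2) with hC
  set S := √((1 - c) / 2) with hS
  have hC0 : 0 < C := Real.sqrt_pos.2 (by linarith)
  have hS0 : 0 < S := Real.sqrt_pos.2 (by linarith)
  have hC2 : C ^ 2 = (1 + c) / 2 := Real.sq_sqrt (by linarith)
  have hS2 : S ^ 2 = (1 - c) / 2 := Real.sq_sqrt (by linarith)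
  have hg0 : 0 ≤ Real.sin (α / 2) := Real.sin_nonneg_of_nonneg_of_le_pi (by linarith) (by linarith)
  have hg1 : Real.sin (α / 2) ≤ 1 := Real.sin_le_one _
  have hC1 : C < 1 := by nlinarith
  -- Half the rotation angle. In the right triangle with corners centre, edge midpoint and vertex,
  -- the angle at the centre is `ψ`, the opposite leg is half an edge and the angle at the vertex is
  -- `α/2`; hence `cos ψ = cos (e/2) sin (α/2)`.
  set ψ := Real.arccos (C * Real.sin (α / 2)) with hψ
  have hx0 : 0 ≤ C * Real.sin (α / 2) := by positivity
  have hx1 : C * Real.sin (α / 2) < 1 := by nlinarith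
  have hcos : Real.cos ψ = C * Real.sin (α / 2) := Real.cos_arccos (by linarith) hx1.le
  have hψ0 : 0 < ψ := Real.arccos_pos.2 hx1
  have hψ1 : ψ ≤ Real.pi / 2 := Real.arccos_le_pi_div_two.2 hx0
  have hsin : 0 < Real.sin ψ := Real.sin_pos_of_pos_of_lt_pi hψ0 (by linarith [Real.pi_pos])
  have hsc := Real.sin_sq_add_cos_sq ψ
  have hsc' := Real.sin_sq_add_cos_sq (α / 2)
  have hcosα : Real.cos α = 1 - 2 * Real.sin (α / 2) ^ 2 := by
    rw [← Real.cos_sq_add_sin_sq (α / 2)]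
    conv_lhs => rw [show α = 2 * (α / 2) by ring, Real.cos_two_mul]
    nlinarith
  have hsinα : Real.sin α = 2 * Real.sin (α / 2) * Real.cos (α / 2) := by
    conv_lhs => rw [show α = 2 * (α / 2) by ring, Real.sin_two_mul]
  -- Sine and cosine of the circumradius, from the same right triangle. The cosine `h` is negative
  -- when `α` exceeds `π`: the centre is then more than a quarter circle away from the vertices.
  set r := S / Real.sin ψ with hr
  set h := C * Real.cos (α / 2) / Real.sin ψ with hh
  have hrs : r * Real.sin ψ = S := by rw [hr]; field_simp
  have hhs : h * Real.sin ψ = C * Real.cos (α / 2) := by rw [hh]; field_simp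
  have hr0 : 0 < r := by positivity
  have hrh : r ^ 2 + h ^ 2 = 1 := by
    have : (r ^ 2 + h ^ 2) * Real.sin ψ ^ 2 = Real.sin ψ ^ 2 := by
      have e : (r ^ 2 + h ^ 2) * Real.sin ψ ^ 2 = (r * Real.sin ψ) ^ 2 + (h * Real.sin ψ) ^ 2 := by
        ring
      rw [e, hrs, hhs, mul_pow, hS2, hC2, eq_sub_of_add_eq hsc, hcos, mul_pow, hC2,
        eq_sub_of_add_eq' hsc']
      ring
    exact mul_right_cancel₀ (pow_ne_zero 2 hsin.ne') (by rw [this, one_mul])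
  have hω : Real.cos (2 * ψ) = 1 - 2 * Real.sin ψ ^ 2 := by rw [Real.cos_two_mul]; linarith
  have hω2 : Real.sin (2 * ψ) = 2 * Real.sin ψ * Real.cos ψ := Real.sin_two_mul ψ
  -- the invariants of three consecutive vertices of the model
  have i1 : ∀ x : ℝ, inner ℝ (modelVertex r h (2 * ψ) x) (modelVertex r h (2 * ψ) (x + 1)) = c := by
    intro x
    rw [inner_modelVertex, add_sub_cancel_left, one_mul, hω]
    have : r ^ 2 * Real.sin ψ ^ 2 = (1 - c) / 2 := by rw [← mul_pow, hrs, hS2]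
    linarith
  have hn : ∀ x : ℝ, ‖modelVertex r h (2 * ψ) x‖ = 1 := by
    intro x
    apply norm_eq_one_of_inner
    rw [inner_modelVertex, sub_self, zero_mul, Real.cos_zero, mul_one, hrh]
  have i2 : ∀ x : ℝ, inner ℝ (modelVertex r h (2 * ψ) x) (modelVertex r h (2 * ψ) (x + 2)) =
      c ^ 2 + (1 - c ^ 2) * Real.cos α := by
    intro x
    rw [inner_modelVertex, add_sub_cancel_left, Real.cos_two_mul, hω, hcosα]
    have e : r ^ 2 * (2 * (1 - 2 * Real.sin ψ ^ 2) ^ 2 - 1) + h ^ 2 =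
      (r ^ 2 + h ^ 2) - 8 * (r * Real.sin ψ) ^ 2 * (1 - Real.sin ψ ^ 2) := by ring
    rw [e, hrs, hrh, show 1 - Real.sin ψ ^ 2 = Real.cos ψ ^ 2 by linarith, hcos, mul_pow, hC2, hS2]
    ring
  have i3 : ∀ x : ℝ, triple (modelVertex r h (2 * ψ) x) (modelVertex r h (2 * ψ) (x + 1))
      (modelVertex r h (2 * ψ) (x + 2)) = (1 - c ^ 2) * Real.sin α := by
    intro x
    rw [triple_modelVertex, add_sub_cancel_left, add_sub_cancel_left,
      show x + 2 - (x + 1) = 1 by ring, one_mul, Real.sin_two_mul (2 * ψ), hω, hω2, hsinα]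
    have e : h * r ^ 2 * (2 * Real.sin ψ * Real.cos ψ + 2 * Real.sin ψ * Real.cos ψ -
        2 * (2 * Real.sin ψ * Real.cos ψ) * (1 - 2 * Real.sin ψ ^ 2)) =
        8 * (h * Real.sin ψ) * (r * Real.sin ψ) ^ 2 * Real.cos ψ := by ring
    rw [e, hrs, hhs, hS2, hcos]
    have : 8 * (C * Real.cos (α / 2)) * ((1 - c) / 2) * (C * Real.sin (α / 2)) =
      4 * (1 - c) * C ^ 2 * Real.cos (α / 2) * Real.sin (α / 2) := by ring
    rw [this, hC2]; ring
  have hcc : c ^ 2 < 1 := by nlinarith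
  have v01 : inner ℝ (P.vertex 0).1 (P.vertex 1).1 = c := by
    have := hs.1 0; rwa [zero_add] at this
  obtain ⟨L, hL, hL0, hL1⟩ := exists_rot (hn 0) (hn 1) (P.norm_vertex 0) (P.norm_vertex 1)
    (by rw [v01, ← i1 0, zero_add]) (by
      have := i1 0; rw [zero_add] at this; rw [this]; exact hcc)
  refine ⟨L, r, h, 2 * ψ, hL, hr0, hrh, by linarith, by linarith, ?_, ?_, ?_, ?_, ?_, ?_⟩
  · rw [hω, hcosα, eq_sub_of_add_eq hsc, hcos, mul_pow, hC2]; ring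
  · rw [mul_div_cancel_left₀ _ two_ne_zero, hrs, hS2]; ring
  · rw [mul_div_cancel_left₀ _ two_ne_zero, hhs, hcosα, mul_pow, hC2]
    rw [eq_sub_of_add_eq hsc']; ring
  · rw [hh, div_pos_iff_of_pos_right hsin, mul_pos_iff_of_pos_left hC0]
  · rw [hh, div_lt_iff₀ hsin, zero_mul]
    constructor
    · intro h1
      by_contra h2
      push Not at h2
      exact absurd (mul_nonneg hC0.le h2) (not_le.2 h1)
    · exact fun h1 => mul_neg_of_pos_of_neg hC0 h1
  -- The polygon and the model agree at two consecutive vertices and have the same inner and triple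
  -- products of three consecutive ones, so `eq_of_inner_of_triple` carries the agreement on.
  · have key : ∀ k : ℕ, (P.vertex k).1 = L (modelVertex r h (2 * ψ) k) ∧
        (P.vertex (k + 1 : ℕ)).1 = L (modelVertex r h (2 * ψ) (k + 1 : ℕ)) := by
      intro k
      induction k with
      | zero => simp [hL0, hL1]
      | succ k ih =>
        refine ⟨ih.2, ?_⟩
        have hm := hs.inner_two k
        have hm' := hs.1 (k + 1)
        have e1 : (k : ZMod P.n) + 1 + 1 = k + 2 := by ring
        have e2 : ((k + 1 + 1 : ℕ) : ZMod P.n) = k + 2 := by push_cast; ring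
        have e3 : ((k + 1 : ℕ) : ZMod P.n) = k + 1 := by push_cast; ring
        have e4 : ((k + 1 + 1 : ℕ) : ℝ) = k + 2 := by push_cast; ring
        have e5 : ((k + 1 : ℕ) : ℝ) = k + 1 := by push_cast; ring
        rw [e3, e5] at ih
        rw [e1] at hm'
        rw [e2, e4]
        refine eq_of_inner_of_triple (P.norm_vertex k) (P.norm_vertex (k + 1))
          (by rw [hs.1]; exact hcc) ?_ ?_ ?_
        · rw [hm.1, ih.1, inner_rot, i2]
        · rw [hm', ih.2, inner_rot, ← i1 (k + 1)]; congr 2; ring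
        · rw [hm.2, ih.1, ih.2, hL, i3]
    exact fun k => (key k).1

end SphTiling
end
-- Regular polygons wind around their centre once
noncomputable section
namespace SphTiling

theorem modelVertex_eq_of_cos_sin {r h ω x y : ℝ} (hc : Real.cos (x * ω) = Real.cos (y * ω))
    (hs : Real.sin (x * ω) = Real.sin (y * ω)) : modelVertex r h ω x = modelVertex r h ω y := by
  simp [modelVertex, hc, hs]

/-- Two edges of a regular star polygon cross. -/
theorem modelVertex_crossing (r h ω μ x : ℝ) (hμ : x * ω + ω = 2 * μ) :
    Real.sin (ω - μ) • modelVertex r h ω 0 + Real.sin μ • modelVertex r h ω 1 =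
      Real.sin μ • modelVertex r h ω x + Real.sin (ω - μ) • modelVertex r h ω (x + 1) := by
  -- The reflection in the meridian of longitude `μ` exchanges the parameters `0` and `x + 1`, and
  -- `1` and `x`. The coefficients are chosen so that the left side lies on this meridian.
  have e1 : x * ω = 2 * μ - ω := by linarith
  have e2 : (x + 1) * ω = 2 * μ := by linarith
  have hμ1 := Real.sin_sq_add_cos_sq μ
  apply E3.ext'
  · simp only [modelVertex, e1, e2, Real.sin_sub, Real.cos_sub, Real.cos_two_mul, Real.sin_two_mul]
    simp
    linear_combination -(2 * r * Real.sin ω * Real.cos μ) * hμ1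
  · simp only [modelVertex, e1, e2, Real.sin_sub, Real.cos_sub, Real.cos_two_mul, Real.sin_two_mul]
    simp
    ring
  · simp [modelVertex]; ring

namespace SphericalPolygon.HasShape

variable {P : SphericalPolygon} {c α : ℝ}

/-- The rotation carrying each vertex of a regular polygon to the next is by the angle `2π / n`. -/
theorem rotation_angle_eq (hs : P.HasShape c α) {L : E3 ≃ₗᵢ[ℝ] E3} {r h ω : ℝ} (hr : 0 < r)
    (hω0 : 0 < ω) (hω1 : ω ≤ Real.pi)
    (hL : ∀ k : ℕ, (P.vertex k).1 = L (modelVertex r h ω k)) : ω = 2 * Real.pi / P.n := by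
  have hn3 := P.three_le
  have hn0 : (0 : ℝ) < P.n := by exact_mod_cast (by omega : 0 < P.n)
  have hpi := Real.pi_pos
  have heq : ∀ i j : ℕ, modelVertex r h ω i = modelVertex r h ω j → (i : ZMod P.n) = j := by
    intro i j hij
    apply P.vertex_injective
    apply Subtype.ext
    rw [hL, hL, hij]
  -- The polygon closes up after `n` steps, so `n ω` is a whole number of turns; the claim is that
  -- it is one turn.
  obtain ⟨k', hk'⟩ : ∃ k : ℤ, (k : ℝ) * (2 * Real.pi) = P.n * ω := by
    rw [← Real.cos_eq_one_iff]
    have h1 : modelVertex r h ω P.n = modelVertex r h ω (0 : ℕ) := by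
      apply L.injective
      rw [← hL, ← hL]; simp
    have h2 := congrArg (fun v : E3 => v 0) h1
    simp [modelVertex] at h2
    exact mul_left_cancel₀ hr.ne' (by rw [mul_one]; linarith)
  have hk0 : 0 < k' := by
    have : (0 : ℝ) < k' * (2 * Real.pi) := by rw [hk']; positivity
    exact_mod_cast (pos_of_mul_pos_left this (by positivity))
  obtain ⟨k, rfl⟩ := Int.eq_ofNat_of_zero_le hk0.le
  simp only [Int.cast_natCast] at hk'
  have hωk : ω = k * (2 * Real.pi) / P.n := by rw [hk']; field_simp
  have hk0' : 0 < k := by exact_mod_cast hk0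
  have hωπ : ω ≠ Real.pi := by
    intro h1
    have : ((2 : ℕ) : ZMod P.n) = (0 : ℕ) := by
      apply heq
      apply modelVertex_eq_of_cos_sin <;> simp [h1]
    rw [ZMod.natCast_eq_natCast_iff, Nat.modEq_zero_iff_dvd] at this
    exact absurd (Nat.le_of_dvd two_pos this) (by omega)
  have h2k : 2 * k < P.n := by
    have h1 : ω < Real.pi := lt_of_le_of_ne hω1 hωπ
    rw [hωk, div_lt_iff₀ hn0] at h1
    have h2 : Real.pi * (2 * k) < Real.pi * P.n := by linarith
    exact_mod_cast lt_of_mul_lt_mul_left h2 hpi.le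
  -- With a common divisor `g` the orbit would already return to its start after `n / g` steps,
  -- against injectivity.
  have hcop : Nat.Coprime k P.n := by
    obtain ⟨a, ha⟩ := Nat.gcd_dvd_left k P.n
    obtain ⟨b, hb⟩ := Nat.gcd_dvd_right k P.n
    set g := Nat.gcd k P.n with hg
    have hg0 : 0 < g := Nat.gcd_pos_of_pos_left _ hk0'
    have hbω : (b : ℝ) * ω = a * (2 * Real.pi) := by
      have e1 : (k : ℝ) = g * a := by exact_mod_cast ha
      have e2 : (P.n : ℝ) = g * b := by exact_mod_cast hb
      have hb0 : (b : ℝ) ≠ 0 := by rintro h0; rw [e2, h0] at hn0; simp at hn0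
      have hg0' : (g : ℝ) ≠ 0 := by exact_mod_cast hg0.ne'
      rw [hωk, e1, e2]; field_simp
    have : ((b : ℕ) : ZMod P.n) = (0 : ℕ) := by
      apply heq
      apply modelVertex_eq_of_cos_sin
      · rw [hbω]; simp
      · rw [hbω]; simpa using Real.sin_nat_mul_two_pi_sub 0 a
    rw [ZMod.natCast_eq_natCast_iff, Nat.modEq_zero_iff_dvd] at this
    have hb0 : 0 < b := by
      rcases Nat.eq_zero_or_pos b with h0 | h0
      · rw [h0] at hb; omega
      · exact h0
    have h3 := Nat.le_of_dvd hb0 this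
    have : g * b ≤ 1 * b := by omega
    have : g ≤ 1 := Nat.le_of_mul_le_mul_right this hb0
    change g = 1
    omega
  have hk1 : k = 1 := by
    by_contra hk1
    -- For `k > 1` this is a star polygon. The vertex `j` has longitude `2π/n`, just beyond vertex
    -- `0`, so the edge at `j` starts within the span of the edge at `0` and crosses it.
    set j : ZMod P.n := (k : ZMod P.n)⁻¹ with hj
    have hkj : (k : ZMod P.n) * j = 1 := ZMod.coe_mul_inv_eq_one k hcop
    obtain ⟨m, hm⟩ : ∃ m : ℤ, (k : ℤ) * j.val = 1 + P.n * m := by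
      have : ((k * j.val : ℤ) : ZMod P.n) = (1 : ℤ) := by
        push_cast; rw [ZMod.natCast_zmod_val]; exact hkj
      rw [ZMod.intCast_eq_intCast_iff, Int.modEq_comm, Int.modEq_iff_add_fac] at this
      exact this
    set δ := Real.pi / P.n with hδ
    have hδ0 : 0 < δ := by positivity
    have hωδ : ω = k * (2 * δ) := by rw [hωk, hδ]; ring
    have hnδ : P.n * δ = Real.pi := by rw [hδ]; field_simp
    have hjω : (j.val : ℝ) * ω = 2 * δ + m * (2 * Real.pi) := by
      have h1 : (k : ℝ) * j.val = 1 + P.n * m := by exact_mod_cast hm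
      calc (j.val : ℝ) * ω = (k * j.val) * (2 * δ) := by rw [hωδ]; ring
        _ = 2 * δ + m * (2 * (P.n * δ)) := by rw [h1]; ring
        _ = _ := by rw [hnδ]
    -- the vertex `j` has longitude `2δ`
    set x : ℝ := 2 * δ / ω with hx
    have hxω : x * ω = 2 * δ := by rw [hx]; field_simp
    have hvj : (P.vertex j).1 = L (modelVertex r h ω x) := by
      have h1 := hL j.val
      rw [ZMod.natCast_zmod_val] at h1
      rw [h1]
      congr 1
      apply modelVertex_eq_of_cos_sin <;> rw [hjω, hxω]
      · rw [Real.cos_add_int_mul_two_pi]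
      · rw [Real.sin_add_int_mul_two_pi]
    have hvj1 : (P.vertex (j + 1)).1 = L (modelVertex r h ω (x + 1)) := by
      have h1 := hL (j.val + 1)
      rw [Nat.cast_add, ZMod.natCast_zmod_val, Nat.cast_one] at h1
      rw [h1]
      congr 1
      have e : ((j.val + 1 : ℕ) : ℝ) * ω = (x + 1) * ω + m * (2 * Real.pi) := by
        push_cast; rw [add_mul, hjω, add_mul, hxω]; ring
      apply modelVertex_eq_of_cos_sin <;> rw [e]
      · rw [Real.cos_add_int_mul_two_pi]
      · rw [Real.sin_add_int_mul_two_pi]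
    have hv0 : (P.vertex 0).1 = L (modelVertex r h ω 0) := by simpa using hL 0
    have hv1 : (P.vertex (0 + 1)).1 = L (modelVertex r h ω 1) := by simpa using hL 1
    -- Half of the longitude `2δ + ω` of vertex `j + 1`. The two coefficients of the crossing point
    -- are positive because `ω - μ = (k - 1) δ` and `μ = (k + 1) δ`, with `1 < k` and `k + 1 < n`.
    set μ := δ + ω / 2 with hμ
    have hk2 : (2 : ℝ) ≤ k := by exact_mod_cast (by omega : 2 ≤ k)
    have hkn : (k : ℝ) + 1 < P.n := by exact_mod_cast (by omega : k + 1 < P.n)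
    have ha : 0 < Real.sin (ω - μ) := by
      apply Real.sin_pos_of_pos_of_lt_pi
      · rw [hμ, hωδ]; nlinarith
      · rw [hμ]; linarith
    have hb : 0 < Real.sin μ := by
      apply Real.sin_pos_of_pos_of_lt_pi
      · rw [hμ]; linarith
      · rw [hμ, hωδ, ← hnδ]; nlinarith
    have hcross := congrArg L (modelVertex_crossing r h ω μ x (by rw [hxω, hμ]; ring))
    simp only [map_add, map_smul, ← hv0, ← hv1, ← hvj, ← hvj1] at hcross
    set y := Real.sin (ω - μ) • (P.vertex 0).1 + Real.sin μ • (P.vertex (0 + 1)).1 with hy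
    have hy0 : y ≠ 0 := by
      intro h0
      have h1 : inner ℝ y y = (0 : ℝ) := by rw [h0, inner_zero_left]
      rw [hy] at h1
      simp only [inner_add_left, inner_add_right, real_inner_smul_left, real_inner_smul_right,
        inner_self_S2, real_inner_comm (P.vertex 0).1 (P.vertex (0 + 1)).1, hs.1] at h1
      have := hs.neg_one_lt
      nlinarith [mul_pos ha hb, sq_nonneg (Real.sin (ω - μ) - Real.sin μ),
        mul_pos (mul_pos ha hb) (by linarith : 0 < 1 + c)]
    have hyn : 0 < ‖y‖⁻¹ := inv_pos.2 (norm_pos_iff.2 hy0)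
    have hmem1 : normalize y hy0 ∈ arc (P.vertex 0) (P.vertex (0 + 1)) :=
      ⟨‖y‖⁻¹ * Real.sin (ω - μ), ‖y‖⁻¹ * Real.sin μ, by positivity, by positivity, by
        rw [normalize_val, mul_smul, mul_smul, ← smul_add]⟩
    have hmem2 : normalize y hy0 ∈ arc (P.vertex j) (P.vertex (j + 1)) :=
      ⟨‖y‖⁻¹ * Real.sin μ, ‖y‖⁻¹ * Real.sin (ω - μ), by positivity, by positivity, by
        rw [normalize_val, mul_smul, mul_smul, ← smul_add, hcross]⟩
    have hj0 : (0 : ZMod P.n) ≠ j := by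
      rintro h0; rw [← h0, mul_zero] at hkj; exact zero_ne_one hkj
    -- Only consecutive edges may meet. `j = 1` would give `k = 1`, and `j = -1` would make `n`
    -- divide `k + 1`.
    rcases P.simple 0 j hj0 _ ⟨hmem1, hmem2⟩ with ⟨h1, -⟩ | ⟨h1, -⟩
    · rw [h1, zero_add, mul_one] at hkj
      have : (k : ZMod P.n) = (1 : ℕ) := by rw [hkj]; simp
      rw [ZMod.natCast_eq_natCast_iff] at this
      exact hk1 (Nat.ModEq.eq_of_lt_of_lt this (by omega) (by omega))
    · have h2 : j = -1 := by linear_combination -h1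
      rw [h2] at hkj
      have : ((k + 1 : ℕ) : ZMod P.n) = 0 := by push_cast; linear_combination -hkj
      rw [ZMod.natCast_eq_zero_iff] at this
      exact absurd (Nat.le_of_dvd (by omega) this) (by omega)
  rw [hωk, hk1]; simp

end SphericalPolygon.HasShape

/-- A regular polygon in standard position with respect to a rotated frame. -/
structure SphericalPolygon.Model (P : SphericalPolygon) (c α r h : ℝ) (L : E3 ≃ₗᵢ[ℝ] E3) : Prop where
  rot : IsRot L
  r_pos : 0 < r
  sq_add_sq : r ^ 2 + h ^ 2 = 1
  angle_eq : 1 + Real.cos (2 * Real.pi / P.n) = (1 + c) * (1 - Real.cos α) / 2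
  r_eq : 2 * (r * Real.sin (Real.pi / P.n)) ^ 2 = 1 - c
  h_eq : 2 * (h * Real.sin (Real.pi / P.n)) ^ 2 = (1 + c) * (1 + Real.cos α) / 2
  h_pos : 0 < h ↔ 0 < Real.cos (α / 2)
  h_neg : h < 0 ↔ Real.cos (α / 2) < 0
  vertex_eq : ∀ k : ℕ, (P.vertex k).1 = L (modelVertex r h (2 * Real.pi / P.n) k)

theorem SphericalPolygon.HasShape.model {P : SphericalPolygon} {c α : ℝ} (hs : P.HasShape c α) :
    ∃ r h L, P.Model c α r h L := by
  obtain ⟨L, r, h, ω, h1, h2, h3, h4, h5, h6, h7, h8, h9, h10, h11⟩ := hs.exists_model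
  have hω := hs.rotation_angle_eq h2 h4 h5 h11
  have e : ω / 2 = Real.pi / P.n := by rw [hω]; ring
  rw [e] at h7 h8
  rw [hω] at h6 h11
  exact ⟨r, h, L, h1, h2, h3, h6, h7, h8, h9, h10, h11⟩

end SphTiling
end
-- The region of a regular polygon is star-shaped about its centre
noncomputable section
namespace SphTiling

/-- An odd multiple of `π/n` is never closer than `π/n` to a multiple of `2π`. Changing `k` by `n`
adds a full turn, so `0 ≤ k < n` may be assumed. -/
theorem cos_odd_mul_le {n : ℕ} (hn : 0 < n) (k : ℤ) :
    Real.cos ((2 * k + 1) * (Real.pi / n)) ≤ Real.cos (Real.pi / n) := by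
  have hn' : (0 : ℝ) < n := by exact_mod_cast hn
  set δ := Real.pi / n with hδ
  have hδ0 : 0 < δ := by have := Real.pi_pos; positivity
  have hnδ : n * δ = Real.pi := by rw [hδ]; field_simp
  have hq0 : 0 ≤ k % n := Int.emod_nonneg _ (by omega)
  have hq1 : k % n + 1 ≤ n := Int.emod_lt_of_pos k (by omega)
  have hk : (k : ℝ) = (k % n : ℤ) + n * (k / n : ℤ) := by
    exact_mod_cast (Int.emod_add_mul_ediv k n).symm
  set q := k % n
  have hq0' : (0 : ℝ) ≤ q := by exact_mod_cast hq0
  have hq1' : (q : ℝ) + 1 ≤ n := by exact_mod_cast hq1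
  have e : (2 * k + 1) * δ = (2 * q + 1) * δ + (k / n : ℤ) * (2 * Real.pi) := by
    rw [hk, ← hnδ]; ring
  rw [e, Real.cos_add_int_mul_two_pi]
  have h1 : δ ≤ (2 * q + 1) * δ := by nlinarith
  have h2 : (2 * q + 1) * δ ≤ 2 * Real.pi - δ := by rw [← hnδ]; nlinarith
  rcases le_total ((2 * q + 1) * δ) Real.pi with h | h
  · exact Real.cos_le_cos_of_nonneg_of_le_pi hδ0.le h h1
  · rw [← Real.cos_two_pi_sub]
    exact Real.cos_le_cos_of_nonneg_of_le_pi hδ0.le (by linarith) (by linarith)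

/-- Every point of the plane lies in one of `n` equal sectors. -/
theorem exists_sector {n : ℕ} (hn : 3 ≤ n) {r : ℝ} (hr : 0 < r) (x y : ℝ) :
    ∃ i < n, ∃ b c : ℝ, 0 ≤ b ∧ 0 ≤ c ∧
      x = b * (r * Real.cos (i * (2 * Real.pi / n))) +
        c * (r * Real.cos ((i + 1 : ℕ) * (2 * Real.pi / n))) ∧
      y = b * (r * Real.sin (i * (2 * Real.pi / n))) +
        c * (r * Real.sin ((i + 1 : ℕ) * (2 * Real.pi / n))) := by
  have hpi := Real.pi_pos
  have hn' : (3 : ℝ) ≤ n := by exact_mod_cast hn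
  set ω := 2 * Real.pi / n with hω
  have hω0 : 0 < ω := by positivity
  have hnω : n * ω = 2 * Real.pi := by rw [hω]; field_simp
  have hωπ : ω < Real.pi := by nlinarith
  obtain ⟨s, θ, hs, hθ0, hθ1, hx, hy⟩ : ∃ s θ : ℝ, 0 ≤ s ∧ 0 ≤ θ ∧ θ < 2 * Real.pi ∧
      x = s * Real.cos θ ∧ y = s * Real.sin θ := by
    set z : ℂ := ⟨x, y⟩
    have hm := toIcoMod_mem_Ico Real.two_pi_pos 0 z.arg
    rw [zero_add] at hm
    refine ⟨‖z‖, toIcoMod Real.two_pi_pos 0 z.arg, norm_nonneg _, hm.1, hm.2, ?_, ?_⟩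
    · rw [← self_sub_toIcoDiv_zsmul, zsmul_eq_mul, Real.cos_sub_int_mul_two_pi,
        Complex.norm_mul_cos_arg]
    · rw [← self_sub_toIcoDiv_zsmul, zsmul_eq_mul, Real.sin_sub_int_mul_two_pi,
        Complex.norm_mul_sin_arg]
  have hi1 := Nat.floor_le (div_nonneg hθ0 hω0.le)
  have hi2 := Nat.lt_floor_add_one (θ / ω)
  set i := ⌊θ / ω⌋₊
  rw [le_div_iff₀ hω0] at hi1
  rw [div_lt_iff₀ hω0] at hi2
  have hin : i < n := by
    have : (i : ℝ) * ω < n * ω := by linarith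
    exact_mod_cast lt_of_mul_lt_mul_right this hω0.le
  have hsω : 0 < Real.sin ω := Real.sin_pos_of_pos_of_lt_pi hω0 hωπ
  -- Cramer's rule in the basis of the two rays bounding the sector.
  refine ⟨i, hin, s * Real.sin ((i + 1 : ℕ) * ω - θ) / (r * Real.sin ω),
    s * Real.sin (θ - i * ω) / (r * Real.sin ω), ?_, ?_, ?_, ?_⟩
  · have : 0 ≤ Real.sin ((i + 1 : ℕ) * ω - θ) := by
      push_cast
      apply Real.sin_nonneg_of_nonneg_of_le_pi <;> linarith
    positivity
  · have : 0 ≤ Real.sin (θ - i * ω) := by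
      apply Real.sin_nonneg_of_nonneg_of_le_pi <;> linarith
    positivity
  · rw [hx]
    push_cast
    field_simp
    rw [add_mul, one_mul]
    simp only [Real.sin_sub, Real.cos_add, Real.sin_add]
    have := Real.sin_sq_add_cos_sq (i * ω)
    linear_combination (-s * Real.cos θ * Real.sin ω) * this
  · rw [hy]
    push_cast
    field_simp
    rw [add_mul, one_mul]
    simp only [Real.sin_sub, Real.cos_add, Real.sin_add]
    have := Real.sin_sq_add_cos_sq (i * ω)
    linear_combination (-s * Real.sin θ * Real.sin ω) * this

/-- The linear functional that is one on the vertices `i` and `i + 1` of a planar regular polygon. -/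
def edgeFunctional (n : ℕ) (r : ℝ) (i : ℕ) (x : E3) : ℝ :=
  (x 0 * Real.cos ((2 * i + 1) * (Real.pi / n)) + x 1 * Real.sin ((2 * i + 1) * (Real.pi / n))) /
    (r * Real.cos (Real.pi / n))

theorem edgeFunctional_vertex {n : ℕ} {r : ℝ} (hr : 0 < r) (h : ℝ)
    (i m : ℕ) : edgeFunctional n r i (modelVertex r h (2 * Real.pi / n) m) =
      Real.cos ((2 * (i - m : ℤ) + 1) * (Real.pi / n)) / Real.cos (Real.pi / n) := by
  have e : ((2 * (i - m : ℤ) + 1) * (Real.pi / n) : ℝ) =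
    (2 * i + 1) * (Real.pi / n) - m * (2 * Real.pi / n) := by push_cast; ring
  push_cast at e ⊢
  rw [e, Real.cos_sub]
  simp only [edgeFunctional, modelVertex]
  simp
  field_simp

/-- The height of a point above the boundary of the cone over a regular polygon. -/
theorem exists_height {n : ℕ} (hn : 3 ≤ n) {r : ℝ} (hr : 0 < r) (h : ℝ) :
    ∃ H : E3 → ℝ, Continuous H ∧
      (∀ x, ∃ i < n, ∃ b c : ℝ, 0 ≤ b ∧ 0 ≤ c ∧ x = H x • !₂[0, 0, 1] +
        b • modelVertex r h (2 * Real.pi / n) i +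
        c • modelVertex r h (2 * Real.pi / n) (i + 1 : ℕ)) ∧
      ∀ i < n, ∀ a b c : ℝ, 0 ≤ b → 0 ≤ c → H (a • !₂[0, 0, 1] +
        b • modelVertex r h (2 * Real.pi / n) i +
        c • modelVertex r h (2 * Real.pi / n) (i + 1 : ℕ)) = a := by
  have hne : (Finset.range n).Nonempty := ⟨0, by simp; omega⟩
  have hpi := Real.pi_pos
  have hn' : (3 : ℝ) ≤ n := by exact_mod_cast hn
  have hcos : 0 < Real.cos (Real.pi / n) := by
    apply Real.cos_pos_of_mem_Ioo
    constructor
    · have : 0 < Real.pi / n := by positivity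
      linarith
    · rw [div_lt_div_iff_of_pos_left hpi (by linarith) (by norm_num)]; linarith
  -- The gauge of the planar regular `n`-gon, written as a maximum so that it is visibly continuous.
  -- By `cos_odd_mul_le` every edge functional is at most one at each vertex, so on a sector the
  -- maximum is attained by the functional of its own edge, with value `b + c`. The height is then
  -- `x 2 - h * g x`.
  let g : E3 → ℝ := fun x => (Finset.range n).sup' hne fun i => edgeFunctional n r i x
  have hg : ∀ i < n, ∀ b c : ℝ, 0 ≤ b → 0 ≤ c → ∀ x : E3,
      x 0 = b * (r * Real.cos (i * (2 * Real.pi / n))) +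
        c * (r * Real.cos ((i + 1 : ℕ) * (2 * Real.pi / n))) →
      x 1 = b * (r * Real.sin (i * (2 * Real.pi / n))) +
        c * (r * Real.sin ((i + 1 : ℕ) * (2 * Real.pi / n))) → g x = b + c := by
    intro i hi b c hb hc x hx0 hx1
    have hE : ∀ j : ℕ, edgeFunctional n r j x =
        b * edgeFunctional n r j (modelVertex r h (2 * Real.pi / n) i) +
        c * edgeFunctional n r j (modelVertex r h (2 * Real.pi / n) (i + 1 : ℕ)) := by
      intro j
      simp only [edgeFunctional, modelVertex, hx0, hx1]
      simp
      ring
    apply le_antisymm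
    · apply Finset.sup'_le
      intro j _
      rw [hE, edgeFunctional_vertex hr, edgeFunctional_vertex hr]
      have h1 := cos_odd_mul_le (n := n) (by omega) (j - i : ℤ)
      have h2 := cos_odd_mul_le (n := n) (by omega) (j - (i + 1 : ℕ) : ℤ)
      exact add_le_add (mul_le_of_le_one_right hb ((div_le_one hcos).2 (by exact_mod_cast h1)))
        (mul_le_of_le_one_right hc ((div_le_one hcos).2 (by exact_mod_cast h2)))
    · refine le_trans (le_of_eq ?_) (Finset.le_sup' _ (Finset.mem_range.2 hi))
      rw [hE, edgeFunctional_vertex hr, edgeFunctional_vertex hr]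
      have e1 : ((2 * (i - i : ℤ) + 1) * (Real.pi / n) : ℝ) = Real.pi / n := by simp
      have e2 : ((2 * (i - (i + 1 : ℕ) : ℤ) + 1) * (Real.pi / n) : ℝ) = -(Real.pi / n) := by
        push_cast; ring
      push_cast at e1 e2 ⊢
      rw [e1, e2, Real.cos_neg, div_self hcos.ne']
      ring
  refine ⟨fun x => x 2 - h * g x, ?_, ?_, ?_⟩
  · have : Continuous g := by
      apply Continuous.finset_sup'_apply
      intro i _
      unfold edgeFunctional
      fun_prop
    fun_prop
  · intro x
    obtain ⟨i, hi, b, c, hb, hc, h0, h1⟩ := exists_sector hn hr (x 0) (x 1)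
    refine ⟨i, hi, b, c, hb, hc, ?_⟩
    simp only [hg i hi b c hb hc x h0 h1]
    apply E3.ext'
    · rw [h0]; simp [modelVertex]
    · rw [h1]; simp [modelVertex]
    · simp [modelVertex]; ring
  · intro i hi a b c hb hc
    simp only
    rw [hg i hi b c hb hc _ (by simp [modelVertex]) (by simp [modelVertex])]
    simp [modelVertex]; ring

/-- A polygon that is star-shaped around `o`: `H` measures the height above the cone over its
boundary in the direction of `o`. -/
structure SphericalPolygon.StarShaped (P : SphericalPolygon) (o : S2) (H : E3 → ℝ) : Prop where
  cont : Continuous H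
  decomp : ∀ x, ∃ i, ∃ b c : ℝ, 0 ≤ b ∧ 0 ≤ c ∧
    x = H x • o.1 + b • (P.vertex i).1 + c • (P.vertex (i + 1)).1
  comp : ∀ i, ∀ a b c : ℝ, 0 ≤ b → 0 ≤ c →
    H (a • o.1 + b • (P.vertex i).1 + c • (P.vertex (i + 1)).1) = a
  triple_pos : ∀ i, 0 < triple (P.vertex i).1 (P.vertex (i + 1)).1 o.1

/-- The centre of a regular polygon in standard position. -/
def modelCenter (L : E3 ≃ₗᵢ[ℝ] E3) : S2 := sphereMap L ⟨!₂[0, 0, 1], by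
  rw [mem_sphere_zero_iff_norm]
  apply norm_eq_one_of_inner
  rw [inner_eq_coord]
  simp⟩

theorem modelCenter_val (L : E3 ≃ₗᵢ[ℝ] E3) : (modelCenter L).1 = L !₂[0, 0, 1] := rfl

namespace SphericalPolygon

variable {P : SphericalPolygon}

theorem Model.vertex_val {c α r h : ℝ} {L : E3 ≃ₗᵢ[ℝ] E3} (hM : P.Model c α r h L)
    (i : ZMod P.n) : (P.vertex i).1 = L (modelVertex r h (2 * Real.pi / P.n) i.val) := by
  rw [← hM.vertex_eq, ZMod.natCast_zmod_val]

theorem Model.vertex_succ_val {c α r h : ℝ} {L : E3 ≃ₗᵢ[ℝ] E3} (hM : P.Model c α r h L)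
    (i : ZMod P.n) :
    (P.vertex (i + 1)).1 = L (modelVertex r h (2 * Real.pi / P.n) (i.val + 1 : ℕ)) := by
  rw [← hM.vertex_eq]; simp

theorem Model.exists_starShaped {c α r h : ℝ} {L : E3 ≃ₗᵢ[ℝ] E3} (hM : P.Model c α r h L) :
    ∃ H, P.StarShaped (modelCenter L) H := by
  obtain ⟨H, h1, h2, h3⟩ := exists_height P.three_le hM.r_pos h
  refine ⟨fun x => H (L.symm x), h1.comp L.symm.continuous, ?_, ?_, ?_⟩
  · intro x
    obtain ⟨i, hi, b, c, hb, hc, hx⟩ := h2 (L.symm x)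
    refine ⟨i, b, c, hb, hc, ?_⟩
    have := congrArg L hx
    rw [L.apply_symm_apply, map_add, map_add, map_smul, map_smul, map_smul, ← hM.vertex_eq,
      ← hM.vertex_eq (i + 1), Nat.cast_succ] at this
    exact this
  · intro i a b c hb hc
    rw [hM.vertex_val, hM.vertex_succ_val, modelCenter_val]
    simp only [map_add, map_smul, L.symm_apply_apply]
    exact h3 _ (ZMod.val_lt i) a b c hb hc
  · intro i
    rw [hM.vertex_val, hM.vertex_succ_val, modelCenter_val, hM.rot]
    have hn : (3 : ℝ) ≤ P.n := by exact_mod_cast P.three_le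
    have hpi := Real.pi_pos
    have hs : 0 < Real.sin (2 * Real.pi / P.n) := by
      apply Real.sin_pos_of_pos_of_lt_pi
      · positivity
      · rw [div_lt_iff₀ (by linarith)]; nlinarith
    have e : triple (modelVertex r h (2 * Real.pi / P.n) i.val)
        (modelVertex r h (2 * Real.pi / P.n) (i.val + 1 : ℕ)) !₂[0, 0, 1] =
        r ^ 2 * Real.sin (2 * Real.pi / P.n) := by
      have : (2 * Real.pi / P.n) = (i.val + 1 : ℕ) * (2 * Real.pi / P.n) -
        i.val * (2 * Real.pi / P.n) := by push_cast; ring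
      conv_rhs => rw [this, Real.sin_sub]
      simp [triple, modelVertex]; ring
    rw [e]
    have := hM.r_pos
    positivity

/-- Neither scaling by `t ≥ 0` nor moving along `o` changes the sector, and within a sector the
height is a coordinate. -/
theorem StarShaped.smul_add {o : S2} {H : E3 → ℝ} (hH : P.StarShaped o H) (x : E3) {t : ℝ}
    (ht : 0 ≤ t) (s : ℝ) : H (t • x + s • o.1) = t * H x + s := by
  obtain ⟨i, b, c, hb, hc, hx⟩ := hH.decomp x
  have e : t • x + s • o.1 = (t * H x + s) • o.1 + (t * b) • (P.vertex i).1 +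
      (t * c) • (P.vertex (i + 1)).1 := by
    conv_lhs => rw [hx]
    module
  rw [e, hH.comp _ _ _ _ (by positivity) (by positivity)]

theorem StarShaped.smul {o : S2} {H : E3 → ℝ} (hH : P.StarShaped o H) (x : E3) {t : ℝ}
    (ht : 0 ≤ t) : H (t • x) = t * H x := by
  simpa using hH.smul_add x ht 0

theorem StarShaped.boundary_eq {o : S2} {H : E3 → ℝ} (hH : P.StarShaped o H) :
    P.boundary = {x | H x.1 = 0} := by
  ext x
  simp only [boundary, mem_iUnion, mem_ofPred_eq, arc]
  constructor
  · rintro ⟨i, a, b, ha, hb, hx⟩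
    have := hH.comp i 0 a b ha hb
    rwa [zero_smul, zero_add, ← hx] at this
  · intro h0
    obtain ⟨i, b, c, hb, hc, hx⟩ := hH.decomp x.1
    rw [h0, zero_smul, zero_add] at hx
    exact ⟨i, b, c, hb, hc, hx⟩

/-- On the segment from `x` to `o` the height is `(1 - t) H x + t`, hence positive; projected to the
sphere, the segment joins `x` to `o` inside the set. -/
theorem isPreconnected_starShaped {o : S2} {H : E3 → ℝ} (hH : P.StarShaped o H) :
    IsPreconnected {x : S2 | 0 < H x.1} := by
  have hzero : H 0 = 0 := by simpa using hH.smul 0 (le_refl 0)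
  have ho : H o.1 = 1 := by
    have := hH.smul_add 0 zero_le_one 1
    simpa [hzero] using this
  apply isPreconnected_of_forall o
  intro x hx
  have hpath : ∀ t : unitInterval, 0 < H ((1 - t.1) • x.1 + t.1 • o.1) := by
    intro t
    rw [hH.smul_add _ (by linarith [t.2.2])]
    rcases eq_or_lt_of_le t.2.1 with h | h
    · rw [← h]; simpa using hx
    · have := mul_nonneg (by linarith [t.2.2] : 0 ≤ 1 - t.1) (le_of_lt hx)
      linarith
  have hne : ∀ t : unitInterval, (1 - t.1) • x.1 + t.1 • o.1 ≠ 0 := by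
    intro t h0
    have := hpath t
    rw [h0, hzero] at this
    exact lt_irrefl _ this
  refine ⟨range fun t : unitInterval => normalize _ (hne t), ?_, ⟨1, ?_⟩, ⟨0, ?_⟩, ?_⟩
  · rintro _ ⟨t, rfl⟩
    simp only [mem_ofPred_eq, normalize_val]
    rw [hH.smul _ (by positivity)]
    exact mul_pos (inv_pos.2 (norm_pos_iff.2 (hne t))) (hpath t)
  · apply Subtype.ext; simp [normalize_val]
  · apply Subtype.ext; simp [normalize_val]
  · apply isPreconnected_range
    unfold normalize
    refine Continuous.subtype_mk ?_ _
    refine Continuous.smul (Continuous.inv₀ (by fun_prop) fun t => norm_ne_zero_iff.2 (hne t)) ?_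
    fun_prop

theorem edge_sum_ne_zero (P : SphericalPolygon) (i : ZMod P.n) :
    (P.vertex i).1 + (P.vertex (i + 1)).1 ≠ 0 := fun h =>
  P.not_antipodal i (eq_neg_of_add_eq_zero_right h)

/-- The midpoint of an edge. -/
def edgeMidpoint (P : SphericalPolygon) (i : ZMod P.n) : S2 :=
  normalize _ (P.edge_sum_ne_zero i)

theorem edgeMidpoint_mem (P : SphericalPolygon) (i : ZMod P.n) :
    P.edgeMidpoint i ∈ openArc (P.vertex i) (P.vertex (i + 1)) := by
  have := inv_pos.2 (norm_pos_iff.2 (P.edge_sum_ne_zero i))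
  exact ⟨_, _, this, this, by rw [edgeMidpoint, normalize_val, smul_add]⟩

theorem openArc_subset_arc (p q : S2) : openArc p q ⊆ arc p q := by
  rintro x ⟨a, b, ha, hb, hx⟩
  exact ⟨a, b, ha.le, hb.le, hx⟩

/-- A continuous curve starting in the open edge `i` meets the region at those small times at which
it is to the left of the edge. -/
theorem eventually_mem_region_iff (P : SphericalPolygon) {i : ZMod P.n} {x : S2}
    (hx : x ∈ openArc (P.vertex i) (P.vertex (i + 1))) {γ : ℝ → S2} (hγ : ContinuousAt γ 0)
    (h0 : γ 0 = x) : ∀ᶠ t in 𝓝[>] (0 : ℝ),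
      (γ t ∈ P.region ↔ 0 < triple (P.vertex i).1 (P.vertex (i + 1)).1 (γ t).1) := by
  have h1 := P.region_left i x hx
  rw [← h0] at h1
  have h2 := hγ.eventually h1
  filter_upwards [h2.filter_mono nhdsWithin_le_nhds] with t ht
  rw [ht, det3_eq_triple]

theorem frontier_region' (P : SphericalPolygon) : frontier P.region = P.boundary :=
  P.frontier_region

/-- Off the frontier, `t` and the complement of its closure form an open partition. -/
theorem _root_.IsPreconnected.subset_of_disjoint_frontier {X : Type*} [TopologicalSpace X]
    {s t : Set X} (hs : IsPreconnected s) (ht : IsOpen t) (hd : Disjoint s (frontier t))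
    (hne : (s ∩ t).Nonempty) : s ⊆ t := by
  refine hs.subset_left_of_subset_union ht (isClosed_closure (s := t)).isOpen_compl ?_ ?_ hne
  · exact disjoint_compl_right.mono_left subset_closure
  · intro x hx
    by_cases h : x ∈ closure t
    · rw [closure_eq_self_union_frontier] at h
      exact h.elim Or.inl fun h => absurd h (Set.disjoint_left.1 hd hx)
    · exact Or.inr h

/-- The boundary is the zero set of the height, so the connected region has heights of one sign.
Near an edge midpoint the region lies on the left, where the centre is (`triple_pos`), so the sign
is positive. Since the points of positive height form a connected set that misses the frontier, they
all belong to the region. -/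
theorem StarShaped.region_eq {o : S2} {H : E3 → ℝ} (hH : P.StarShaped o H) :
    P.region = {x | 0 < H x.1} := by
  have hfr := P.frontier_region'
  rw [hH.boundary_eq] at hfr
  have hdisj : Disjoint P.region (frontier P.region) := 
    (disjoint_frontier_iff_isOpen.2 P.region_open).symm
  have hHc : Continuous fun x : S2 => H x.1 := hH.cont.comp continuous_subtype_val
  -- the region contains a point of positive height
  obtain ⟨y, hy1, hy2⟩ : ∃ y ∈ P.region, 0 < H y.1 := by
    have hn : ∀ t : ℝ, 0 < ‖(P.edgeMidpoint 0).1 + t • o.1‖ ∨ t ≤ 0 := by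
      intro t
      by_contra! h
      have h0 : (P.edgeMidpoint 0).1 + t • o.1 = 0 := norm_le_zero_iff.1 h.1
      obtain ⟨a, b, ha, hb, hx⟩ := openArc_subset_arc _ _ (P.edgeMidpoint_mem 0)
      have := hH.comp 0 t a b ha hb
      rw [add_assoc, ← hx, add_comm, h0] at this
      have h00 : H 0 = 0 := by simpa using hH.smul 0 (le_refl 0)
      linarith [h.2]
    -- The maximum with `0` makes the curve towards `o` defined for every real parameter; only small
    -- positive ones are used.
    have hne : ∀ t : ℝ, (P.edgeMidpoint 0).1 + (max t 0) • o.1 ≠ 0 := by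
      intro t h0
      rcases hn (max t 0) with h | h
      · rw [h0, norm_zero] at h; exact lt_irrefl _ h
      · have : max t 0 = 0 := le_antisymm h (le_max_right _ _)
        rw [this, zero_smul, add_zero] at h0
        exact S2.ne_zero _ h0
    set γ : ℝ → S2 := fun t => normalize _ (hne t) with hγ
    have hc : Continuous γ := by
      refine Continuous.subtype_mk ?_ _
      refine Continuous.smul (Continuous.inv₀ (by fun_prop) fun t => norm_ne_zero_iff.2 (hne t)) ?_
      fun_prop
    have h0 : γ 0 = P.edgeMidpoint 0 := by
      apply Subtype.ext; simp [hγ, normalize_val]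
    have hev := P.eventually_mem_region_iff (P.edgeMidpoint_mem 0) hc.continuousAt h0
    obtain ⟨t, ht, ht0⟩ := (hev.and self_mem_nhdsWithin).exists
    have ht0 : 0 < t := ht0
    obtain ⟨a, b, ha, hb, hx⟩ := openArc_subset_arc _ _ (P.edgeMidpoint_mem 0)
    have hnp := inv_pos.2 (norm_pos_iff.2 (hne t))
    refine ⟨γ t, ht.2 ?_, ?_⟩
    · simp only [hγ, normalize_val]
      rw [triple_smul_right]
      apply mul_pos hnp
      rw [triple_add_right, hx, triple_add_right, triple_smul_right,
        triple_smul_right, triple_self_outer, triple_self_right, triple_smul_right, max_eq_left ht0.le]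
      simpa using mul_pos ht0 (hH.triple_pos 0)
    · simp only [hγ, normalize_val]
      rw [hH.smul _ hnp.le]
      apply mul_pos hnp
      rw [max_eq_left ht0.le, add_comm, hx, ← add_assoc, hH.comp _ _ _ _ ha hb]
      exact ht0
  apply Subset.antisymm
  · have hop1 : IsOpen {x : S2 | 0 < H x.1} := isOpen_lt continuous_const hHc
    have hop2 : IsOpen {x : S2 | H x.1 < 0} := isOpen_lt hHc continuous_const
    refine P.region_connected.isPreconnected.subset_left_of_subset_union hop1 hop2 ?_ ?_ ⟨y, hy1, hy2⟩
    · rw [Set.disjoint_left]; exact fun x (h1 : 0 < H x.1) (h2 : H x.1 < 0) => lt_asymm h1 h2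
    · intro x hx
      rcases lt_trichotomy (H x.1) 0 with h | h | h
      · exact Or.inr h
      · exact absurd (hfr ▸ h : x ∈ frontier P.region) (Set.disjoint_left.1 hdisj hx)
      · exact Or.inl h
  · refine (isPreconnected_starShaped hH).subset_of_disjoint_frontier P.region_open ?_ ⟨y, hy2, hy1⟩
    rw [hfr, Set.disjoint_left]
    exact fun x (h1 : 0 < H x.1) (h2 : H x.1 = 0) => h1.ne' h2

theorem closure_region_eq_union (P : SphericalPolygon) :
    closure P.region = P.region ∪ P.boundary := by
  rw [← P.frontier_region', closure_eq_self_union_frontier]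

theorem StarShaped.closure_eq {o : S2} {H : E3 → ℝ} (hH : P.StarShaped o H) :
    closure P.region = {x | 0 ≤ H x.1} := by
  rw [closure_region_eq_union, hH.region_eq, hH.boundary_eq]
  ext x
  simp only [mem_union, mem_ofPred_eq, le_iff_lt_or_eq, eq_comm]

end SphericalPolygon
end SphTiling
end
noncomputable section
namespace SphTiling

/-! ### Arcs -/

theorem inner_sq_lt_one {p q : S2} (h1 : q ≠ p) (h2 : q.1 ≠ -p.1) :
    inner ℝ p.1 q.1 ^ 2 < (1 : ℝ) := by
  have hp := norm_eq_of_mem_sphere p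
  have hq := norm_eq_of_mem_sphere q
  rw [sq_lt_one_iff_abs_lt_one]
  refine lt_of_le_of_ne ?_ ?_
  · have := abs_real_inner_le_norm p.1 q.1
    rwa [hp, hq, one_mul] at this
  · intro h
    rcases eq_or_eq_neg_of_abs_eq h with h | h
    · rw [inner_eq_one_iff_of_norm_eq_one hp hq] at h
      exact h1 (Subtype.ext h.symm)
    · have h' : inner ℝ q.1 (-p.1) = (1 : ℝ) := by
        rw [inner_neg_right, real_inner_comm, h, neg_neg]
      rw [inner_eq_one_iff_of_norm_eq_one hq (by rw [norm_neg]; exact hp)] at h'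
      exact h2 h'

/-- The coefficients solve the Gram system of `p` and `q`. Their signs turn membership in an arc
into closed or open conditions on inner products. -/
theorem combination_unique {p q x : S2} (hc : inner ℝ p.1 q.1 ^ 2 < (1 : ℝ))
    (h0 : triple p.1 q.1 x.1 = 0) :
    x.1 = ((inner ℝ p.1 x.1 - inner ℝ p.1 q.1 * inner ℝ q.1 x.1) / (1 - inner ℝ p.1 q.1 ^ 2)) • p.1
      + ((inner ℝ q.1 x.1 - inner ℝ p.1 q.1 * inner ℝ p.1 x.1) / (1 - inner ℝ p.1 q.1 ^ 2)) •
        q.1 := by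
  have hne : (1 - inner ℝ p.1 q.1 ^ 2 : ℝ) ≠ 0 := by linarith
  refine eq_of_inner_of_triple (norm_eq_of_mem_sphere p) (norm_eq_of_mem_sphere q) hc ?_ ?_ ?_
  · simp only [inner_add_right, real_inner_smul_right, inner_self_S2]
    field_simp; ring
  · simp only [inner_add_right, real_inner_smul_right, inner_self_S2, real_inner_comm p.1 q.1]
    field_simp; ring
  · rw [h0, triple_add_right, triple_smul_right, triple_smul_right, triple_self_outer,
      triple_self_right]; ring

theorem mem_arc_iff {p q x : S2} (hc : inner ℝ p.1 q.1 ^ 2 < (1 : ℝ)) :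
    x ∈ arc p q ↔ triple p.1 q.1 x.1 = 0 ∧ inner ℝ p.1 q.1 * inner ℝ q.1 x.1 ≤ inner ℝ p.1 x.1 ∧
      inner ℝ p.1 q.1 * inner ℝ p.1 x.1 ≤ (inner ℝ q.1 x.1 : ℝ) := by
  constructor
  · rintro ⟨a, b, ha, hb, hx⟩
    rw [hx]
    simp only [inner_add_right, real_inner_smul_right, inner_self_S2, real_inner_comm p.1 q.1,
      triple_add_right, triple_smul_right, triple_self_outer, triple_self_right]
    refine ⟨by ring, by nlinarith, by nlinarith⟩
  · rintro ⟨h0, h1, h2⟩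
    exact ⟨_, _, div_nonneg (by linarith) (by linarith), div_nonneg (by linarith) (by linarith),
      combination_unique hc h0⟩

theorem mem_openArc_iff {p q x : S2} (hc : inner ℝ p.1 q.1 ^ 2 < (1 : ℝ)) :
    x ∈ openArc p q ↔ triple p.1 q.1 x.1 = 0 ∧
      inner ℝ p.1 q.1 * inner ℝ q.1 x.1 < inner ℝ p.1 x.1 ∧
      inner ℝ p.1 q.1 * inner ℝ p.1 x.1 < (inner ℝ q.1 x.1 : ℝ) := by
  constructor
  · rintro ⟨a, b, ha, hb, hx⟩
    rw [hx]
    simp only [inner_add_right, real_inner_smul_right, inner_self_S2, real_inner_comm p.1 q.1,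
      triple_add_right, triple_smul_right, triple_self_outer, triple_self_right]
    refine ⟨by ring, by nlinarith, by nlinarith⟩
  · rintro ⟨h0, h1, h2⟩
    exact ⟨_, _, div_pos (by linarith) (by linarith), div_pos (by linarith) (by linarith),
      combination_unique hc h0⟩

theorem isClosed_arc {p q : S2} (hc : inner ℝ p.1 q.1 ^ 2 < (1 : ℝ)) : IsClosed (arc p q) := by
  have : arc p q = {x : S2 | triple p.1 q.1 x.1 = 0} ∩
      ({x : S2 | inner ℝ p.1 q.1 * inner ℝ q.1 x.1 ≤ inner ℝ p.1 x.1} ∩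
      {x : S2 | inner ℝ p.1 q.1 * inner ℝ p.1 x.1 ≤ (inner ℝ q.1 x.1 : ℝ)}) := by
    ext x; exact mem_arc_iff hc
  rw [this]
  refine IsClosed.inter (isClosed_eq ?_ continuous_const)
    ((isClosed_le ?_ ?_).inter (isClosed_le ?_ ?_))
  · exact (continuous_triple_right _ _).comp continuous_subtype_val
  all_goals fun_prop

theorem left_mem_arc (p q : S2) : p ∈ arc p q := ⟨1, 0, by norm_num, le_rfl, by simp⟩

theorem mem_openArc_of_mem_arc {p q x : S2} (hx : x ∈ arc p q) (h1 : x ≠ p) (h2 : x ≠ q) :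
    x ∈ openArc p q := by
  obtain ⟨a, b, ha, hb, hx⟩ := hx
  have hn : ∀ {y : S2} {t : ℝ}, 0 ≤ t → x.1 = t • y.1 → x = y := by
    intro y t ht h
    have h3 := congrArg norm h
    rw [norm_smul, norm_eq_of_mem_sphere, norm_eq_of_mem_sphere, mul_one, Real.norm_of_nonneg ht]
      at h3
    rw [← h3, one_smul] at h
    exact Subtype.ext h
  refine ⟨a, b, lt_of_le_of_ne ha ?_, lt_of_le_of_ne hb ?_, hx⟩
  · rintro rfl
    exact h2 (hn hb (by simpa using hx))
  · rintro rfl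
    exact h1 (hn ha (by simpa using hx))

/-! ### Polar coordinates at a point -/

theorem exists_rot_to (v : S2) : ∃ L : E3 ≃ₗᵢ[ℝ] E3, IsRot L ∧ L !₂[1, 0, 0] = v.1 := by
  have h := inner_self_S2 v
  rw [inner_eq_coord] at h
  obtain ⟨w, hw, hc⟩ : ∃ w : E3, ‖w‖ = 1 ∧ inner ℝ v.1 w ^ 2 < (1 : ℝ) := by
    by_cases h0 : v.1 0 ^ 2 < 1
    · refine ⟨!₂[1, 0, 0], norm_eq_one_of_inner ?_, ?_⟩
      · rw [inner_eq_coord]; simp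
      · rw [inner_eq_coord]; simpa using h0
    · refine ⟨!₂[0, 1, 0], norm_eq_one_of_inner ?_, ?_⟩
      · rw [inner_eq_coord]; simp
      · rw [inner_eq_coord]
        simp only [Matrix.cons_val]
        nlinarith [sq_nonneg (v.1 2), sq_nonneg (v.1 1)]
  obtain ⟨L, hL, hv, -⟩ := exists_frame_of_pair (norm_eq_of_mem_sphere v) hw rfl hc
  exact ⟨L, hL, hv⟩

/-- Polar coordinates around the first basis vector. -/
def polarVector (t s : ℝ) : E3 := !₂[Real.cos s, Real.sin s * Real.cos t, Real.sin s * Real.sin t]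

/-- The point at distance `s` from `L e₀` in direction `t`. -/
def polarPoint (L : E3 ≃ₗᵢ[ℝ] E3) (t s : ℝ) : S2 := sphereMap L ⟨polarVector t s, by
  rw [mem_sphere_zero_iff_norm]
  apply norm_eq_one_of_inner
  rw [inner_eq_coord]
  simp only [polarVector, PiLp.toLp_apply, Matrix.cons_val]
  have := Real.sin_sq_add_cos_sq s
  have := Real.sin_sq_add_cos_sq t
  linear_combination Real.sin_sq_add_cos_sq s + Real.sin s ^ 2 * Real.sin_sq_add_cos_sq t⟩

theorem polarPoint_val (L : E3 ≃ₗᵢ[ℝ] E3) (t s : ℝ) :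
    (polarPoint L t s).1 = L (polarVector t s) := rfl

theorem continuous_polarPoint (L : E3 ≃ₗᵢ[ℝ] E3) :
    Continuous fun x : ℝ × ℝ => polarPoint L x.1 x.2 := by
  unfold polarPoint
  refine (sphereMap L).continuous.comp (Continuous.subtype_mk ?_ _)
  unfold polarVector
  refine (PiLp.continuous_toLp 2 _).comp ?_
  refine continuous_pi fun i => ?_
  fin_cases i <;> simp <;> fun_prop

attribute [irreducible] polarPoint

theorem polarPoint_add_two_pi_mul (L : E3 ≃ₗᵢ[ℝ] E3) (t s : ℝ) (k : ℤ) :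
    polarPoint L (t + k * (2 * Real.pi)) s = polarPoint L t s := by
  apply Subtype.ext
  simp only [polarPoint_val, polarVector, Real.cos_add_int_mul_two_pi, Real.sin_add_int_mul_two_pi]

theorem exists_polar {L : E3 ≃ₗᵢ[ℝ] E3} {v q : S2} (hv : L !₂[1, 0, 0] = v.1)
    (hc : inner ℝ v.1 q.1 ^ 2 < (1 : ℝ)) :
    ∃ t s : ℝ, 0 < s ∧ s < Real.pi ∧ q = polarPoint L t s := by
  set y := L.symm q.1 with hy
  have hyq : q.1 = L y := by rw [hy]; simp
  have hy1 : inner ℝ y y = (1 : ℝ) := by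
    rw [← inner_rot L, ← hyq, inner_self_S2]
  have hy0 : inner ℝ v.1 q.1 = y 0 := by
    rw [hyq, ← hv, inner_rot, inner_eq_coord]; simp
  rw [hy0] at hc
  rw [inner_eq_coord] at hy1
  set s := Real.arccos (y 0) with hs
  obtain ⟨h1, h2⟩ := (sq_lt_one_iff_abs_lt_one _).1 hc |> abs_lt.1
  have hs0 : 0 < s := Real.arccos_pos.2 h2
  have hsπ : s < Real.pi := lt_of_le_of_ne (Real.arccos_le_pi _) (by
    rw [hs, Ne, Real.arccos_eq_pi]; linarith)
  have hcs : Real.cos s = y 0 := Real.cos_arccos h1.le h2.le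
  have hss : 0 < Real.sin s := Real.sin_pos_of_pos_of_lt_pi hs0 hsπ
  set z : ℂ := ⟨y 1, y 2⟩ with hz
  have hzn : ‖z‖ = Real.sin s := by
    rw [← sq_eq_sq₀ (norm_nonneg _) hss.le, ← Complex.normSq_eq_norm_sq, Complex.normSq_apply,
      Real.sin_sq, hcs, hz]
    simp only
    linarith
  refine ⟨z.arg, s, hs0, hsπ, ?_⟩
  apply Subtype.ext
  rw [polarPoint_val, hyq]
  congr 1
  apply E3.ext'
  · simp [polarVector, hcs]
  · simp [polarVector, ← hzn, Complex.norm_mul_cos_arg, hz]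
  · simp [polarVector, ← hzn, Complex.norm_mul_sin_arg, hz]

theorem inner_polarPoint {L : E3 ≃ₗᵢ[ℝ] E3} {v : S2} (hv : L !₂[1, 0, 0] = v.1) (t s : ℝ) :
    inner ℝ v.1 (polarPoint L t s).1 = Real.cos s := by
  rw [← hv, polarPoint_val, inner_rot, inner_eq_coord]; simp [polarVector]

theorem inner_polarPoint_polarPoint (L : E3 ≃ₗᵢ[ℝ] E3) (t s t' s' : ℝ) :
    inner ℝ (polarPoint L t s).1 (polarPoint L t' s').1 =
      Real.cos s * Real.cos s' + Real.sin s * Real.sin s' * Real.cos (t' - t) := by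
  rw [polarPoint_val, polarPoint_val, inner_rot, inner_eq_coord, Real.cos_sub]
  simp [polarVector]; ring

theorem triple_polarPoint {L : E3 ≃ₗᵢ[ℝ] E3} (hL : IsRot L) {v : S2} (hv : L !₂[1, 0, 0] = v.1)
    (t s t' s' : ℝ) : triple v.1 (polarPoint L t s).1 (polarPoint L t' s').1 =
      Real.sin s * Real.sin s' * Real.sin (t' - t) := by
  rw [← hv, polarPoint_val, polarPoint_val, hL, Real.sin_sub]
  simp [polarVector, triple]; ring

/-- In an oriented frame at `v`, `ccwAngle` is the difference of the longitudes modulo `2π`: it has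
the same cosine and sine. -/
theorem exists_polar_ccwAngle {L : E3 ≃ₗᵢ[ℝ] E3} (hL : IsRot L) {v : S2}
    (hv : L !₂[1, 0, 0] = v.1) {t s t' s' : ℝ} (h0 : 0 < s) (h1 : s < Real.pi) (h0' : 0 < s')
    (h1' : s' < Real.pi) : polarPoint L t' s' = polarPoint L
      (t + ccwAngle v (polarPoint L t s) (polarPoint L t' s')) s' := by
  set α := ccwAngle v (polarPoint L t s) (polarPoint L t' s') with hα
  have hs := Real.sin_pos_of_pos_of_lt_pi h0 h1
  have hs' := Real.sin_pos_of_pos_of_lt_pi h0' h1'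
  obtain ⟨e1, e2⟩ := ccwAngle_spec v (polarPoint L t s) (polarPoint L t' s')
    (ρ := Real.sin s * Real.sin s') (by positivity) (by
      rw [inner_polarPoint hv, inner_polarPoint hv, mul_pow, Real.sin_sq, Real.sin_sq])
  rw [inner_polarPoint hv, inner_polarPoint hv, inner_polarPoint_polarPoint, add_sub_cancel_left,
    ← hα] at e1
  rw [triple_polarPoint hL hv, ← hα] at e2
  have hss : Real.sin s * Real.sin s' ≠ 0 := by positivity
  have e1 := mul_left_cancel₀ hss e1
  have e2 := mul_left_cancel₀ hss e2
  have : Real.cos (t' - t - α) = 1 := by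
    rw [Real.cos_sub, e1, e2]
    linarith [Real.sin_sq_add_cos_sq α]
  obtain ⟨k, hk⟩ := (Real.cos_eq_one_iff _).1 this
  rw [← polarPoint_add_two_pi_mul L (t + α) s' k]
  congr 1
  linarith

/-- Points of an arc that starts at `v` lie in the direction of the arc. -/
theorem polar_mem_arc {L : E3 ≃ₗᵢ[ℝ] E3} (hL : IsRot L) {v : S2} (hv : L !₂[1, 0, 0] = v.1)
    {t s t' s' : ℝ} (h0 : 0 < s) (h1 : s < Real.pi) (h0' : 0 < s') (h1' : s' < Real.pi)
    (h : polarPoint L t' s' ∈ arc v (polarPoint L t s)) : ∃ k : ℤ, t' = t + k * (2 * Real.pi) := by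
  have hs := Real.sin_pos_of_pos_of_lt_pi h0 h1
  have hs' := Real.sin_pos_of_pos_of_lt_pi h0' h1'
  obtain ⟨a, b, ha, hb, hx⟩ := h
  have e1 : Real.sin s * Real.sin s' * Real.sin (t' - t) = 0 := by
    rw [← triple_polarPoint hL hv, hx, triple_add_right, triple_smul_right, triple_smul_right,
      triple_self_outer, triple_self_right]; ring
  have e1 : Real.sin (t' - t) = 0 := by
    rcases mul_eq_zero.1 e1 with h | h
    · exact absurd h (by positivity)
    · exact h
  -- The vanishing triple product leaves two opposite directions; the sign of the cosine selects the
  -- direction of the arc.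
  have e2 : 0 ≤ Real.cos (t' - t) := by
    have h2 := inner_polarPoint_polarPoint L t s t' s'
    have h3 := inner_polarPoint hv t' s'
    rw [hx, inner_add_right, real_inner_smul_right, real_inner_smul_right, inner_self_S2] at h2 h3
    rw [inner_polarPoint hv] at h3
    rw [real_inner_comm, inner_polarPoint hv] at h2
    have h4 : Real.sin s * Real.sin s' * Real.cos (t' - t) = b * Real.sin s ^ 2 := by
      rw [Real.sin_sq]
      linear_combination -h2 + Real.cos s * h3
    have h5 : 0 ≤ Real.sin s * Real.sin s' * Real.cos (t' - t) := by rw [h4]; positivity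
    exact nonneg_of_mul_nonneg_right h5 (by positivity)
  have : Real.cos (t' - t) = 1 := by
    have := Real.sin_sq_add_cos_sq (t' - t)
    rw [e1] at this
    nlinarith
  obtain ⟨k, hk⟩ := (Real.cos_eq_one_iff _).1 this
  exact ⟨k, by linarith⟩

theorem arc_comm (p q : S2) : arc p q = arc q p := by
  ext x
  constructor <;> rintro ⟨a, b, ha, hb, hx⟩ <;> exact ⟨b, a, hb, ha, by rw [hx, add_comm]⟩

theorem dist_polarPoint_le {L : E3 ≃ₗᵢ[ℝ] E3} {v : S2} (hv : L !₂[1, 0, 0] = v.1) (t : ℝ) {s : ℝ}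
    (hs : 0 ≤ s) : dist (polarPoint L t s) v ≤ s := by
  rw [Subtype.dist_eq, dist_eq_norm, ← sq_le_sq₀ (norm_nonneg _) hs, norm_sub_sq_real,
    norm_eq_of_mem_sphere, norm_eq_of_mem_sphere, real_inner_comm, inner_polarPoint hv]
  linarith [Real.one_sub_sq_div_two_le_cos (x := s)]

namespace SphericalPolygon

variable (P : SphericalPolygon)

theorem inner_vertex_sq_lt_one (i : ZMod P.n) :
    inner ℝ (P.vertex i).1 (P.vertex (i + 1)).1 ^ 2 < (1 : ℝ) :=
  inner_sq_lt_one (fun h => by simpa using P.vertex_injective h) (P.not_antipodal i)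

theorem isClosed_edge (i : ZMod P.n) : IsClosed (arc (P.vertex i) (P.vertex (i + 1))) :=
  isClosed_arc (P.inner_vertex_sq_lt_one i)

/-- An edge that contains a vertex ends there. -/
theorem eq_of_vertex_mem_edge {i j : ZMod P.n}
    (h : P.vertex i ∈ arc (P.vertex j) (P.vertex (j + 1))) : j = i ∨ j = i - 1 := by
  by_contra! hne
  rcases P.simple i j hne.1.symm (P.vertex i) ⟨left_mem_arc _ _, h⟩ with ⟨-, h2⟩ | ⟨h1, -⟩
  · exact hne.1 (P.vertex_injective h2).symm
  · exact hne.2 (by rw [h1]; ring)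

theorem not_between_multiples (m k : ℤ) (h0 : m * (2 * Real.pi) < k * (2 * Real.pi))
    (h1 : k * (2 * Real.pi) < (m + 1 : ℤ) * (2 * Real.pi)) : False := by
  have h0 : (m : ℝ) < k := lt_of_mul_lt_mul_right h0 Real.two_pi_pos.le
  have h1 : (k : ℝ) < (m + 1 : ℤ) := lt_of_mul_lt_mul_right h1 Real.two_pi_pos.le
  have h0 : m < k := by exact_mod_cast h0
  have h1 : k < m + 1 := by exact_mod_cast h1
  omega

/-- The sector at `L e₀` of radius `ε` between the directions `t₀` and `t₁`. -/
def polarSector (L : E3 ≃ₗᵢ[ℝ] E3) (t₀ t₁ ε : ℝ) : Set S2 :=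
  (fun x : ℝ × ℝ => polarPoint L x.1 x.2) '' (Ioo t₀ t₁ ×ˢ Ioo 0 ε)

theorem isPreconnected_polarSector (L : E3 ≃ₗᵢ[ℝ] E3) (t₀ t₁ ε : ℝ) :
    IsPreconnected (polarSector L t₀ t₁ ε) :=
  (isPreconnected_Ioo.prod isPreconnected_Ioo).image _ (continuous_polarPoint L).continuousOn

theorem polarPoint_mem_polarSector (L : E3 ≃ₗᵢ[ℝ] E3) {t₀ t₁ ε t s : ℝ} (h1 : t₀ < t) (h2 : t < t₁)
    (h3 : 0 < s) (h4 : s < ε) : polarPoint L t s ∈ polarSector L t₀ t₁ ε := by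
  have h : (t, s) ∈ Ioo t₀ t₁ ×ˢ Ioo 0 ε := Set.mk_mem_prod ⟨h1, h2⟩ ⟨h3, h4⟩
  exact Set.mem_image_of_mem (fun x : ℝ × ℝ => polarPoint L x.1 x.2) h

theorem exists_of_mem_polarSector {L : E3 ≃ₗᵢ[ℝ] E3} {t₀ t₁ ε : ℝ} {x : S2}
    (hx : x ∈ polarSector L t₀ t₁ ε) :
    ∃ t s, t₀ < t ∧ t < t₁ ∧ 0 < s ∧ s < ε ∧ x = polarPoint L t s := by
  obtain ⟨⟨t, s⟩, h, rfl⟩ := hx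
  obtain ⟨⟨h1, h2⟩, h3, h4⟩ := Set.mem_prod.1 h
  exact ⟨t, s, h1, h2, h3, h4, rfl⟩

set_option maxHeartbeats 400000 in
/-- Near a vertex the polygon is a sector. -/
theorem exists_sector_at (i : ZMod P.n) {L : E3 ≃ₗᵢ[ℝ] E3} (hL : IsRot L)
    (hv : L !₂[1, 0, 0] = (P.vertex i).1) : ∃ θ ε : ℝ, 0 < ε ∧
      (∀ t s, θ < t → t < θ + P.angle i → 0 < s → s < ε → polarPoint L t s ∈ P.region) ∧
      ∀ t s, θ + P.angle i < t → t < θ + 2 * Real.pi → 0 < s → s < ε →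
        polarPoint L t s ∉ closure P.region := by
  have hpi := Real.pi_pos
  obtain ⟨θ, a, ha0, ha1, hq⟩ := exists_polar hv (P.inner_vertex_sq_lt_one i)
  have hc' : inner ℝ (P.vertex i).1 (P.vertex (i - 1)).1 ^ 2 < (1 : ℝ) := by
    have := P.inner_vertex_sq_lt_one (i - 1)
    rwa [sub_add_cancel, real_inner_comm] at this
  obtain ⟨θ', a', ha0', ha1', hr⟩ := exists_polar hv hc'
  have hα : ccwAngle (P.vertex i) (polarPoint L θ a) (polarPoint L θ' a') = P.angle i := by
    rw [angle, hq, hr]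
  have hr2 := exists_polar_ccwAngle hL hv (t := θ) (t' := θ') ha0 ha1 ha0' ha1'
  rw [hα, ← hr] at hr2
  obtain ⟨hα0, hα1⟩ : P.angle i ∈ Ico 0 (2 * Real.pi) := ccwAngle_mem _ _ _
  set α := P.angle i
  clear_value α
  -- the other edges stay away from the vertex
  have hB : IsClosed (⋃ j ∈ {j : ZMod P.n | j ≠ i ∧ j ≠ i - 1},
      arc (P.vertex j) (P.vertex (j + 1))) :=
    (Set.toFinite _).isClosed_biUnion fun j _ => P.isClosed_edge j
  have hvB : P.vertex i ∉ ⋃ j ∈ {j : ZMod P.n | j ≠ i ∧ j ≠ i - 1},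
      arc (P.vertex j) (P.vertex (j + 1)) := by
    simp only [mem_iUnion, not_exists]
    intro j hj hmem
    rcases P.eq_of_vertex_mem_edge hmem with h | h
    · exact hj.1 h
    · exact hj.2 h
  obtain ⟨ε₀, hε₀, hball⟩ := Metric.mem_nhds_iff.1 (hB.isOpen_compl.mem_nhds hvB)
  set ε := min ε₀ a with hε
  have hε0 : 0 < ε := lt_min hε₀ ha0
  have hεπ : ε < Real.pi := (min_le_right _ _).trans_lt ha1
  -- Within the radius `ε` the boundary consists of the two edges at the vertex, in the directions
  -- `θ` and `θ + α`.
  have hbd : ∀ t s, 0 < s → s < ε → polarPoint L t s ∈ P.boundary →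
      ∃ k : ℤ, t = θ + k * (2 * Real.pi) ∨ t = θ + α + k * (2 * Real.pi) := by
    intro t s hs0 hs1 hb
    simp only [boundary, mem_iUnion] at hb
    obtain ⟨j, hj⟩ := hb
    by_cases hj1 : j = i
    · rw [hj1, hq] at hj
      obtain ⟨k, hk⟩ := polar_mem_arc hL hv ha0 ha1 hs0 (hs1.trans hεπ) hj
      exact ⟨k, Or.inl hk⟩
    by_cases hj2 : j = i - 1
    · rw [hj2, sub_add_cancel, arc_comm, hr2] at hj
      obtain ⟨k, hk⟩ := polar_mem_arc hL hv ha0' ha1' hs0 (hs1.trans hεπ) hj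
      exact ⟨k, Or.inr hk⟩
    have hd := dist_polarPoint_le hv t hs0.le
    have := hball (Metric.mem_ball.2 ((hd.trans_lt hs1).trans_le (min_le_left _ _)))
    exact absurd (mem_biUnion (show j ∈ {j | j ≠ i ∧ j ≠ i - 1} from ⟨hj1, hj2⟩) hj) this
  -- the two open sectors
  have hd1 : ∀ t, θ < t → t < θ + α → ∀ s, 0 < s → s < ε → polarPoint L t s ∉ P.boundary := by
    intro t h1 h2 s hs0 hs1 hb
    obtain ⟨k, hk | hk⟩ := hbd t s hs0 hs1 hb
    · exact not_between_multiples 0 k (by push_cast; linarith) (by push_cast; linarith)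
    · exact not_between_multiples (-1) k (by push_cast; linarith) (by push_cast; linarith)
  have hd2 : ∀ t, θ + α < t → t < θ + 2 * Real.pi → ∀ s, 0 < s → s < ε →
      polarPoint L t s ∉ P.boundary := by
    intro t h1 h2 s hs0 hs1 hb
    obtain ⟨k, hk | hk⟩ := hbd t s hs0 hs1 hb
    · exact not_between_multiples 0 k (by push_cast; linarith) (by push_cast; linarith)
    · exact not_between_multiples 0 k (by push_cast; linarith) (by push_cast; linarith)
  -- points on both sides of the edge `i`
  have hs0 : 0 < ε / 2 := by linarith
  have hsa : ε / 2 < a := by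
    have : ε ≤ a := min_le_right _ _
    linarith
  have hsa0 : 0 < Real.sin a := Real.sin_pos_of_pos_of_lt_pi ha0 ha1
  have hsε0 : 0 < Real.sin (ε / 2) := Real.sin_pos_of_pos_of_lt_pi hs0 (by linarith)
  have hmid : polarPoint L θ (ε / 2) ∈ openArc (P.vertex i) (P.vertex (i + 1)) := by
    refine ⟨Real.sin (a - ε / 2) / Real.sin a, Real.sin (ε / 2) / Real.sin a, ?_, ?_, ?_⟩
    · have := Real.sin_pos_of_pos_of_lt_pi (sub_pos.2 hsa) (by linarith)
      positivity
    · positivity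
    · rw [hq, polarPoint_val, polarPoint_val, ← hv, ← map_smul, ← map_smul, ← map_add]
      congr 1
      apply E3.ext' <;> simp [polarVector, Real.sin_sub] <;> field_simp
      ring
  -- Just to the left of edge `i` (`σ = 1`) the points belong to the region, just to the right (`σ =
  -- -1`) they do not. Each open sector misses the boundary, so one point decides for the whole of
  -- it.
  have hside : ∀ σ : ℝ, ∀ᶠ u in 𝓝[>] (0 : ℝ), (polarPoint L (θ + σ * u) (ε / 2) ∈ P.region ↔
      0 < Real.sin (σ * u)) := by
    intro σ
    have hc : Continuous fun u : ℝ => polarPoint L (θ + σ * u) (ε / 2) :=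
      (continuous_polarPoint L).comp (by fun_prop : Continuous fun u : ℝ => (θ + σ * u, ε / 2))
    filter_upwards [P.eventually_mem_region_iff hmid hc.continuousAt (by simp)] with u hu
    rw [hu, hq, triple_polarPoint hL hv, add_sub_cancel_left]
    exact mul_pos_iff_of_pos_left (by positivity)
  have hfr := P.frontier_region'
  refine ⟨θ, ε, hε0, ?_, ?_⟩
  · intro t s ht1 ht2 hs1 hs2
    have hα0' : 0 < α := by linarith
    have hsub := (isPreconnected_polarSector L θ (θ + α) ε).subset_of_disjoint_frontier P.region_open (by
      rw [hfr, Set.disjoint_left]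
      intro x hx
      obtain ⟨t, s, h1, h2, h3, h4, rfl⟩ := exists_of_mem_polarSector hx
      exact hd1 t h1 h2 s h3 h4) (by
      obtain ⟨w, ⟨⟨hw1, hw0⟩, hwα⟩, hwπ⟩ := ((((hside 1).and self_mem_nhdsWithin).and
        (mem_nhdsWithin_of_mem_nhds (Iio_mem_nhds hα0'))).and
        (mem_nhdsWithin_of_mem_nhds (Iio_mem_nhds hpi))).exists
      have hw0 : 0 < w := hw0
      have hwα : w < α := hwα
      rw [one_mul] at hw1
      exact ⟨_, polarPoint_mem_polarSector L (t := θ + w) (by linarith) (by linarith) hs0 (by linarith),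
        hw1.2 (Real.sin_pos_of_pos_of_lt_pi hw0 hwπ)⟩)
    exact hsub (polarPoint_mem_polarSector L ht1 ht2 hs1 hs2)
  · intro t s ht1 ht2 hs1 hs2 hmem
    rw [closure_region_eq_union] at hmem
    rcases hmem with hmem | hmem
    swap
    · exact hd2 t ht1 ht2 s hs1 hs2 hmem
    -- If the outer sector met the region, it would be contained in it, including the directions
    -- just before `θ + 2π`, that is, just to the right of edge `i`.
    have hsub := (isPreconnected_polarSector L (θ + α) (θ + 2 * Real.pi) ε).subset_of_disjoint_frontier P.region_open (by
      rw [hfr, Set.disjoint_left]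
      intro x hx
      obtain ⟨t, s, h1, h2, h3, h4, rfl⟩ := exists_of_mem_polarSector hx
      exact hd2 t h1 h2 s h3 h4) ⟨_, polarPoint_mem_polarSector L ht1 ht2 hs1 hs2, hmem⟩
    obtain ⟨w, ⟨⟨hw1, hw0⟩, hwα⟩, hwπ⟩ := ((((hside (-1)).and self_mem_nhdsWithin).and
      (mem_nhdsWithin_of_mem_nhds (Iio_mem_nhds (sub_pos.2 hα1)))).and
      (mem_nhdsWithin_of_mem_nhds (Iio_mem_nhds hpi))).exists
    have hw0 : 0 < w := hw0
    have hwα : w < 2 * Real.pi - α := hwα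
    have hin := hsub (polarPoint_mem_polarSector L (t := θ + 2 * Real.pi - w) (by linarith) (by linarith) hs0
      (by linarith))
    have e : θ + 2 * Real.pi - w = θ + -1 * w + (1 : ℤ) * (2 * Real.pi) := by push_cast; ring
    rw [e, polarPoint_add_two_pi_mul] at hin
    have := hw1.1 hin
    rw [neg_one_mul, Real.sin_neg] at this
    linarith [Real.sin_pos_of_pos_of_lt_pi hw0 hwπ]

end SphericalPolygon

end SphTiling
end
noncomputable section
namespace SphTiling

/-! ### The angles at a vertex -/

open MeasureTheory in
-- The integrand is the indicator of an arc of length `α` on the circle of directions. Being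
-- periodic, it may be integrated from `θ` to `θ + 2π` instead.
theorem integral_sector (θ : ℝ) {α : ℝ} (h0 : 0 ≤ α) (h1 : α ≤ 2 * Real.pi) :
    (∫ t in (0 : ℝ)..2 * Real.pi,
      if toIocMod Real.two_pi_pos θ t ≤ θ + α then (1 : ℝ) else 0) = α ∧
    IntervalIntegrable (fun t => if toIocMod Real.two_pi_pos θ t ≤ θ + α then (1 : ℝ) else 0)
      volume 0 (2 * Real.pi) := by
  set f : ℝ → ℝ := fun t => if toIocMod Real.two_pi_pos θ t ≤ θ + α then (1 : ℝ) else 0 with hf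
  have hper : Function.Periodic f (2 * Real.pi) := by
    intro t
    simp only [hf, toIocMod_add_right]
  have e1 : EqOn (fun _ => (1 : ℝ)) f (uIoc θ (θ + α)) := by
    intro t ht
    rw [uIoc_of_le (by linarith)] at ht
    have : toIocMod Real.two_pi_pos θ t = t :=
      (toIocMod_eq_self _).2 ⟨ht.1, by linarith [ht.2]⟩
    simp only [hf, this, if_pos ht.2]
  have e2 : EqOn (fun _ => (0 : ℝ)) f (uIoc (θ + α) (θ + 2 * Real.pi)) := by
    intro t ht
    rw [uIoc_of_le (by linarith)] at ht
    have : toIocMod Real.two_pi_pos θ t = t :=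
      (toIocMod_eq_self _).2 ⟨by linarith [ht.1], ht.2⟩
    simp only [hf, this, if_neg (not_le.2 ht.1)]
  have i1 : IntervalIntegrable f volume θ (θ + α) :=
    (intervalIntegrable_congr e1).1 intervalIntegrable_const
  have i2 : IntervalIntegrable f volume (θ + α) (θ + 2 * Real.pi) :=
    (intervalIntegrable_congr e2).1 intervalIntegrable_const
  constructor
  · have := hper.intervalIntegral_add_eq 0 θ
    rw [zero_add] at this
    rw [this, ← intervalIntegral.integral_add_adjacent_intervals i1 i2,
      ← intervalIntegral.integral_congr_ae (ae_of_all _ fun t ht => e1 ht),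
      ← intervalIntegral.integral_congr_ae (ae_of_all _ fun t ht => e2 ht)]
    simp
  · have := (hper.intervalIntegrable_iff (t₁ := θ) (t₂ := 0)).1 (i1.trans i2)
    rwa [zero_add] at this

namespace SphericalTiling

variable (T : SphericalTiling)

/-- The region of `P` accumulates at `v`, so `v` cannot lie inside another tile; edge-to-edge keeps
it off the other boundaries. -/
theorem notMem_closure_of_notMem_range {P Q : SphericalPolygon} (hP : P ∈ T.tiles)
    (hQ : Q ∈ T.tiles) {v : S2} (hv : v ∈ range P.vertex) (hv' : v ∉ range Q.vertex) :
    v ∉ closure Q.region := by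
  intro h
  rw [SphericalPolygon.closure_region_eq_union] at h
  obtain ⟨i, rfl⟩ := hv
  rcases h with h | h
  · have hcl : P.vertex i ∈ closure P.region := by
      rw [SphericalPolygon.closure_region_eq_union]
      exact Or.inr (mem_iUnion.2 ⟨i, left_mem_arc _ _⟩)
    obtain ⟨x, hx1, hx2⟩ := mem_closure_iff.1 hcl _ Q.region_open h
    by_cases hPQ : P = Q
    · exact hv' (hPQ ▸ mem_range_self _)
    · exact Set.disjoint_left.1 (T.disjoint P hP Q hQ hPQ) hx2 hx1
  · exact hv' (T.edge_to_edge P hP Q hQ i h)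

open MeasureTheory in
/-- The angles at a vertex of the tiling sum to `2π`. -/
theorem angle_sum {v : S2} (A : Finset SphericalPolygon)
    (hA : ∀ P, P ∈ A ↔ P ∈ T.tiles ∧ v ∈ range P.vertex) (hv : v ∈ T.vertices)
    (idx : ∀ P : SphericalPolygon, ZMod P.n) (hidx : ∀ P ∈ A, P.vertex (idx P) = v) :
    ∑ P ∈ A, P.angle (idx P) = 2 * Real.pi := by
  classical
  have hpi := Real.pi_pos
  obtain ⟨L, hL, hLv⟩ := exists_rot_to v
  have hsec : ∀ P : SphericalPolygon, ∃ θ ε : ℝ, P ∈ A → 0 < ε ∧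
      (∀ t s, θ < t → t < θ + P.angle (idx P) → 0 < s → s < ε → polarPoint L t s ∈ P.region) ∧
      ∀ t s, θ + P.angle (idx P) < t → t < θ + 2 * Real.pi → 0 < s → s < ε →
        polarPoint L t s ∉ closure P.region := by
    intro P
    by_cases hP : P ∈ A
    · obtain ⟨θ, ε, h⟩ := P.exists_sector_at (idx P) hL (by rw [hLv, hidx P hP])
      exact ⟨θ, ε, fun _ => h⟩
    · exact ⟨0, 0, fun h => absurd h hP⟩
  choose θ ε hθ using hsec
  obtain ⟨P₀, hP₀, hvP₀⟩ : ∃ P ∈ T.tiles, v ∈ range P.vertex := by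
    simpa [vertices] using hv
  -- the other tiles stay away from `v`
  have hB : IsClosed (⋃ Q ∈ {Q | Q ∈ T.tiles ∧ v ∉ range Q.vertex}, closure Q.region) :=
    (T.finite.subset fun Q hQ => hQ.1).isClosed_biUnion fun Q _ => isClosed_closure
  have hvB : v ∉ ⋃ Q ∈ {Q | Q ∈ T.tiles ∧ v ∉ range Q.vertex}, closure Q.region := by
    simp only [mem_iUnion, not_exists]
    intro Q hQ hmem
    exact T.notMem_closure_of_notMem_range hP₀ hQ.1 hvP₀ hQ.2 hmem
  obtain ⟨ε₀, hε₀, hball⟩ := Metric.mem_nhds_iff.1 (hB.isOpen_compl.mem_nhds hvB)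
  have hα : ∀ P : SphericalPolygon, P.angle (idx P) ∈ Ico 0 (2 * Real.pi) :=
    fun P => ccwAngle_mem _ _ _
  let f : SphericalPolygon → ℝ → ℝ := fun P t =>
    if toIocMod Real.two_pi_pos (θ P) t ≤ θ P + P.angle (idx P) then (1 : ℝ) else 0
  -- the exceptional directions
  let N : Set ℝ := ⋃ P ∈ A, (range fun k : ℤ => θ P + 2 * Real.pi + k * (2 * Real.pi)) ∪
    range fun k : ℤ => θ P + P.angle (idx P) + k * (2 * Real.pi)
  have hN : N.Countable :=
    A.finite_toSet.countable.biUnion fun P _ => (countable_range _).union (countable_range _)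
  -- Outside countably many directions, a point close to `v` lies on no boundary of a tile at `v`.
  -- It is covered by some tile, that tile has `v` as a corner, and by disjointness it is the only
  -- one.
  have hsum : ∀ t ∉ N, ∑ P ∈ A, f P t = 1 := by
    intro t ht
    obtain ⟨s, hs0, hs1, hsA⟩ : ∃ s, 0 < s ∧ s < ε₀ ∧ ∀ P ∈ A, s < ε P := by
      have h1 : ∀ᶠ s in 𝓝[>] (0 : ℝ), ∀ P ∈ A, s < ε P := by
        rw [Filter.eventually_all_finset]
        exact fun P hP => mem_nhdsWithin_of_mem_nhds (Iio_mem_nhds (hθ P hP).1)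
      obtain ⟨s, ⟨h1, h2⟩, h3⟩ := ((h1.and self_mem_nhdsWithin).and
        (mem_nhdsWithin_of_mem_nhds (Iio_mem_nhds hε₀))).exists
      exact ⟨s, h2, h3, h1⟩
    have hkey : ∀ P ∈ A, (f P t = 1 ∧ polarPoint L t s ∈ P.region) ∨
        (f P t = 0 ∧ polarPoint L t s ∉ closure P.region) := by
      intro P hP
      have hP' := hθ P hP
      have hm := toIocMod_mem_Ioc Real.two_pi_pos (θ P) t
      have hk := self_sub_toIocDiv_zsmul Real.two_pi_pos (θ P) t
      set u := toIocMod Real.two_pi_pos (θ P) t with hu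
      have htu : t = u + toIocDiv Real.two_pi_pos (θ P) t * (2 * Real.pi) := by
        rw [← hk, zsmul_eq_mul]; ring
      have hpt : polarPoint L t s = polarPoint L u s := by
        conv_lhs => rw [htu]
        rw [polarPoint_add_two_pi_mul]
      have hN' : ¬ ((∃ k : ℤ, θ P + 2 * Real.pi + k * (2 * Real.pi) = t) ∨
          ∃ k : ℤ, θ P + P.angle (idx P) + k * (2 * Real.pi) = t) := by
        intro h
        exact ht (mem_biUnion (x := P) hP h)
      push Not at hN'
      have hu1 : u ≠ θ P + 2 * Real.pi := fun h => hN'.1 _ (by rw [← h]; exact htu.symm)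
      have hu2 : u ≠ θ P + P.angle (idx P) := fun h => hN'.2 _ (by rw [← h]; exact htu.symm)
      rcases lt_or_gt_of_ne hu2 with h | h
      · left
        refine ⟨if_pos h.le, ?_⟩
        rw [hpt]
        exact hP'.2.1 u s hm.1 h hs0 (hsA P hP)
      · right
        refine ⟨if_neg (not_le.2 h), ?_⟩
        rw [hpt]
        exact hP'.2.2 u s h (lt_of_le_of_ne hm.2 hu1) hs0 (hsA P hP)
    obtain ⟨Q, hQ, hQm⟩ : ∃ Q ∈ T.tiles, polarPoint L t s ∈ closure Q.region := by
      have : polarPoint L t s ∈ ⋃ P ∈ T.tiles, closure P.region := by rw [T.cover]; trivial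
      simpa only [mem_iUnion, exists_prop] using this
    have hQv : v ∈ range Q.vertex := by
      by_contra hQv
      have hd := dist_polarPoint_le hLv t hs0.le
      exact hball (Metric.mem_ball.2 (hd.trans_lt hs1))
        (mem_biUnion (x := Q) (show Q ∈ {Q | Q ∈ T.tiles ∧ v ∉ range Q.vertex} from ⟨hQ, hQv⟩) hQm)
    have hQA : Q ∈ A := (hA Q).2 ⟨hQ, hQv⟩
    obtain ⟨hQ1, hQ2⟩ : f Q t = 1 ∧ polarPoint L t s ∈ Q.region := by
      rcases hkey Q hQA with h | h
      · exact h
      · exact absurd hQm h.2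
    rw [Finset.sum_eq_single_of_mem Q hQA, hQ1]
    intro P hP hPQ
    rcases hkey P hP with h | h
    · exact absurd hQ2 (Set.disjoint_left.1 (T.disjoint P ((hA P).1 hP).1 Q hQ hPQ) h.2)
    · exact h.1
  -- Integrating over all directions turns each indicator into an angle.
  have h1 : ∫ t in (0 : ℝ)..2 * Real.pi, ∑ P ∈ A, f P t = ∫ t in (0 : ℝ)..2 * Real.pi, (1 : ℝ) := by
    apply intervalIntegral.integral_congr_ae
    filter_upwards [hN.ae_notMem volume] with t ht _
    exact hsum t ht
  rw [intervalIntegral.integral_finsetSum fun P _ =>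
    (integral_sector (θ P) (hα P).1 (hα P).2.le).2] at h1
  rw [Finset.sum_congr rfl fun P _ => (integral_sector (θ P) (hα P).1 (hα P).2.le).1] at h1
  simpa using h1

/-- The angles at a vertex of a regular tiling. -/
theorem angle_sum_of_isRegular (hreg : T.IsRegular) {v : S2} (A : Finset SphericalPolygon)
    (hA : ∀ P, P ∈ A ↔ P ∈ T.tiles ∧ v ∈ range P.vertex) (hv : v ∈ T.vertices) :
    ∑ P ∈ A, P.angle 0 = 2 * Real.pi := by
  classical
  have hidx : ∀ P : SphericalPolygon, ∃ i : ZMod P.n, P ∈ A → P.vertex i = v := by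
    intro P
    by_cases hP : P ∈ A
    · obtain ⟨i, hi⟩ := ((hA P).1 hP).2
      exact ⟨i, fun _ => hi⟩
    · exact ⟨0, fun h => absurd h hP⟩
  choose idx hidx using hidx
  rw [← T.angle_sum A hA hv idx hidx]
  exact Finset.sum_congr rfl fun P hP => (hreg P ((hA P).1 hP).1).2 _ _

/-- The tiles at a point, as a finite set. -/
def tilesAt (v : S2) : Finset SphericalPolygon :=
  (T.finite.subset fun _ h => h.1 : {P | P ∈ T.tiles ∧ v ∈ range P.vertex}.Finite).toFinset

theorem mem_tilesAt {v : S2} {P : SphericalPolygon} :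
    P ∈ T.tilesAt v ↔ P ∈ T.tiles ∧ v ∈ range P.vertex := by
  simp [tilesAt]

theorem card_tilesAt (v : S2) : (T.tilesAt v).card = T.degree v := by
  unfold degree tilesAt
  exact (Set.ncard_eq_toFinset_card _ _).symm

end SphericalTiling

end SphTiling
end
noncomputable section
namespace SphTiling

/-! ### Adjacent tiles -/

/-- Stereographic projection from a removed point gives the plane minus a countable set. -/
theorem isPreconnected_compl_of_finite {F : Set S2} (hF : F.Finite) : IsPreconnected Fᶜ := by
  have hcon : IsPreconnected (univ : Set S2) := by
    have h : IsConnected (Metric.sphere (0 : E3) 1) := isConnected_sphere (by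
      rw [← Module.finrank_eq_rank]; simp) 0 zero_le_one
    have := isPreconnected_iff_preconnectedSpace.1 h.isPreconnected
    exact isPreconnected_univ
  rcases F.eq_empty_or_nonempty with rfl | ⟨v, hv⟩
  · rwa [compl_empty]
  have : Fact (Module.finrank ℝ E3 = 2 + 1) := ⟨by simp⟩
  set φ := stereographic' 2 v
  have hG : ((φ '' (F \ {v})) : Set (EuclideanSpace ℝ (Fin 2))).Countable :=
    ((hF.subset sdiff_subset).image _).countable
  have h1 := (hG.isConnected_compl_of_one_lt_rank (by
    rw [← Module.finrank_eq_rank]; simp)).isPreconnected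
  have h2 := h1.image φ.symm (φ.continuousOn_symm.mono (by
    rw [stereographic'_target]; exact subset_univ _))
  convert! h2 using 1
  ext x
  constructor
  · intro hx
    have hxv : x ∈ φ.source := by
      rw [stereographic'_source]; rintro rfl; exact hx hv
    refine ⟨φ x, ?_, φ.left_inv hxv⟩
    rintro ⟨y, ⟨hy1, hy2⟩, hy3⟩
    have hy : y ∈ φ.source := by rw [stereographic'_source]; exact hy2
    exact hx (φ.injOn hy hxv hy3 ▸ hy1)
  · rintro ⟨y, hy, rfl⟩ hF'
    have hyt : y ∈ φ.target := by rw [stereographic'_target]; trivial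
    have hs := φ.map_target hyt
    rw [stereographic'_source] at hs
    exact hy ⟨φ.symm y, ⟨hF', hs⟩, φ.right_inv hyt⟩

theorem eq_of_eq_smul {p q : S2} {t : ℝ} (ht : 0 < t) (h : p.1 = t • q.1) : p = q := by
  have h3 := congrArg norm h
  rw [norm_smul, norm_eq_of_mem_sphere, norm_eq_of_mem_sphere, mul_one, Real.norm_of_nonneg ht.le]
    at h3
  rw [← h3, one_smul] at h
  exact Subtype.ext h

theorem left_notMem_openArc {p q : S2} (hc : inner ℝ p.1 q.1 ^ 2 < (1 : ℝ)) : p ∉ openArc p q := by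
  intro h
  rw [mem_openArc_iff hc, inner_self_S2, real_inner_comm p.1 q.1] at h
  linarith [h.2.2]

theorem right_notMem_openArc {p q : S2} (hc : inner ℝ p.1 q.1 ^ 2 < (1 : ℝ)) :
    q ∉ openArc p q := by
  intro h
  rw [mem_openArc_iff hc, inner_self_S2] at h
  linarith [h.2.1]

/-- The vector `w` bisects the angle between `M` and `N` and has positive inner product with both
unless they point in opposite directions. It serves for the left normals of two overlapping edges.
-/
theorem cross_eq_neg_smul {M N : E3} (hM : M ≠ 0) (hN : N ≠ 0)
    (h : ∀ w : E3, w = ‖N‖ • M + ‖M‖ • N → ¬ (0 < (inner ℝ M w : ℝ) ∧ 0 < (inner ℝ N w : ℝ))) :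
    ∃ t : ℝ, 0 < t ∧ N = -(t • M) := by
  have hM0 := norm_pos_iff.2 hM
  have hN0 := norm_pos_iff.2 hN
  have key : inner ℝ M N = -(‖M‖ * ‖N‖) := by
    by_contra hne
    have hlt : 0 < ‖M‖ * ‖N‖ + inner ℝ M N := by
      have := neg_le_of_abs_le (abs_real_inner_le_norm M N)
      rcases eq_or_lt_of_le this with h' | h'
      · exact absurd h'.symm hne
      · linarith
    refine h _ rfl ⟨?_, ?_⟩
    · rw [inner_add_right, real_inner_smul_right, real_inner_smul_right, real_inner_self_eq_norm_sq]
      have := mul_pos hM0 hlt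
      linarith
    · rw [inner_add_right, real_inner_smul_right, real_inner_smul_right, real_inner_self_eq_norm_sq,
        real_inner_comm M N]
      have := mul_pos hN0 hlt
      linarith
  refine ⟨‖N‖ / ‖M‖, by positivity, ?_⟩
  have h2 : inner ℝ (-M) N = ‖-M‖ * ‖N‖ := by rw [inner_neg_left, key, norm_neg, neg_neg]
  rw [inner_eq_norm_mul_iff_real, norm_neg] at h2
  have h3 : N = (‖M‖⁻¹ * ‖M‖) • N := by rw [inv_mul_cancel₀ hM0.ne', one_smul]
  conv_lhs => rw [h3]
  rw [mul_smul, ← h2, smul_neg, smul_neg, smul_smul, div_eq_inv_mul]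

/-- Two arcs that are traversed in opposite directions along a great circle and overlap coincide if
neither contains an endpoint of the other in its relative interior. -/
theorem eq_of_openArc_overlap {p p' q q' x : S2} (hp : inner ℝ p.1 p'.1 ^ 2 < (1 : ℝ))
    (hx : x ∈ openArc p p') (hx' : x ∈ openArc q q') {t : ℝ} (ht : 0 < t)
    (hN : cross q.1 q'.1 = -(t • cross p.1 p'.1)) (h1 : q ∉ openArc p p') (h2 : q' ∉ openArc p p')
    (h3 : p ∉ openArc q q') (h4 : p' ∉ openArc q q') : p = q' ∧ p' = q := by
  have hplane : ∀ y : S2, inner ℝ (cross q.1 q'.1) y.1 = (0 : ℝ) → ∃ a b : ℝ,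
      y.1 = a • p.1 + b • p'.1 := by
    intro y hy
    rw [hN, inner_neg_left, real_inner_smul_left, inner_cross] at hy
    have hy : triple p.1 p'.1 y.1 = 0 := by
      rcases mul_eq_zero.1 (neg_eq_zero.1 hy) with h | h
      · exact absurd h ht.ne'
      · exact h
    exact ⟨_, _, combination_unique hp hy⟩
  -- Everything takes place in the plane of `p` and `p'`. With coordinates `(α, β)` of `q` and `(α',
  -- β')` of `q'`, the orientation says `α β' - β α' = -t < 0`. Inverting this gives `p` and `p'` in
  -- terms of `q` and `q'`, so that the four excluded memberships become conditions on signs.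
  obtain ⟨α, β, hq⟩ := hplane q (by rw [inner_cross, triple_self_outer])
  obtain ⟨α', β', hq'⟩ := hplane q' (by rw [inner_cross, triple_self_right])
  obtain ⟨a, b, ha, hb, hxp⟩ := hx
  obtain ⟨d, e, hd, he, hxq⟩ := hx'
  -- coordinates with respect to `p` and `p'` are unique
  have hindep : ∀ a b a' b' : ℝ, a • p.1 + b • p'.1 = a' • p.1 + b' • p'.1 → a = a' ∧ b = b' := by
    intro a b a' b' h
    have i1 := congrArg (fun z => (inner ℝ p.1 z : ℝ)) h
    have i2 := congrArg (fun z => (inner ℝ p'.1 z : ℝ)) h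
    simp only [inner_add_right, real_inner_smul_right, inner_self_S2, real_inner_comm p.1 p'.1]
      at i1 i2
    have hne : (1 - inner ℝ p.1 p'.1 ^ 2 : ℝ) ≠ 0 := by linarith
    constructor
    · exact mul_right_cancel₀ hne (by linear_combination i1 - inner ℝ p.1 p'.1 * i2)
    · exact mul_right_cancel₀ hne (by linear_combination i2 - inner ℝ p.1 p'.1 * i1)
  have hab := hindep a b (d * α + e * α') (d * β + e * β') (by
    rw [← hxp, hxq, hq, hq']; module)
  have hD : α * β' - β * α' = -t := by
    have e1 : cross q.1 q'.1 = (α * β' - β * α') • cross p.1 p'.1 := by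
      rw [hq, hq']
      apply E3.ext' <;> simp [cross] <;> ring
    rw [hN, ← neg_smul] at e1
    have hc : cross p.1 p'.1 ≠ 0 := by
      intro h0
      have h5 : inner ℝ (cross p.1 p'.1) (cross p.1 p'.1) =
          inner ℝ p.1 p.1 * inner ℝ p'.1 p'.1 - (inner ℝ p.1 p'.1 : ℝ) ^ 2 := by
        simp only [inner_eq_coord]; simp [cross]; ring
      rw [h0, inner_zero_left, inner_self_S2, inner_self_S2] at h5
      linarith
    exact (smul_left_injective ℝ hc e1).symm
  have hdiv : ∀ {y : E3} {u v : ℝ}, (-t) • y = u • q.1 + v • q'.1 →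
      y = (u / -t) • q.1 + (v / -t) • q'.1 := by
    intro y u v h
    have h5 : y = (-t)⁻¹ • ((-t) • y) := by
      rw [smul_smul, inv_mul_cancel₀ (by linarith), one_smul]
    rw [h5, h, smul_add, smul_smul, smul_smul, div_eq_inv_mul, div_eq_inv_mul]
  have hpq : p.1 = (β' / -t) • q.1 + (-β / -t) • q'.1 :=
    hdiv (by rw [hq, hq', ← hD]; module)
  have hpq' : p'.1 = (-α' / -t) • q.1 + (α / -t) • q'.1 :=
    hdiv (by rw [hq, hq', ← hD]; module)
  have k1 : ¬ (0 < α ∧ 0 < β) := fun h => h1 ⟨α, β, h.1, h.2, hq⟩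
  have k2 : ¬ (0 < α' ∧ 0 < β') := fun h => h2 ⟨α', β', h.1, h.2, hq'⟩
  have k3 : ¬ (β' < 0 ∧ 0 < β) := fun h => h3 ⟨_, _, div_pos_of_neg_of_neg h.1 (by linarith),
    div_pos_of_neg_of_neg (by linarith [h.2]) (by linarith), hpq⟩
  have k4 : ¬ (0 < α' ∧ α < 0) := fun h => h4 ⟨_, _, div_pos_of_neg_of_neg (by linarith [h.1])
    (by linarith), div_pos_of_neg_of_neg h.2 (by linarith), hpq'⟩
  -- For `α > 0` the sign conditions give `β ≤ 0`, `β' > 0`, `α' ≤ 0`; as both coordinates of `x`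
  -- are positive, multiplying the two inequalities makes `α β' - β α'` positive.
  have hα : α ≤ 0 := by
    by_contra hα
    push Not at hα
    have hβ : β ≤ 0 := not_lt.1 fun h => k1 ⟨hα, h⟩
    have hβ' : 0 < β' := by
      by_contra h; push Not at h
      nlinarith [mul_nonneg hd.le (neg_nonneg.2 hβ), mul_nonneg he.le (neg_nonneg.2 h)]
    have hα' : α' ≤ 0 := not_lt.1 fun h => k2 ⟨h, hβ'⟩
    have j1 : e * -α' < d * α := by linarith [hab.1]
    have j2 : d * -β < e * β' := by linarith [hab.2]
    have j3 : (e * -α') * (d * -β) < (d * α) * (e * β') :=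
      mul_lt_mul'' j1 j2 (mul_nonneg he.le (neg_nonneg.2 hα')) (mul_nonneg hd.le (neg_nonneg.2 hβ))
    have j4 : 0 < (d * e) * (α * β' - β * α') := by linarith
    have j5 := pos_of_mul_pos_right j4 (by positivity)
    linarith
  have hα' : 0 < α' := by
    by_contra h; push Not at h
    nlinarith [mul_nonneg hd.le (neg_nonneg.2 hα), mul_nonneg he.le (neg_nonneg.2 h)]
  have hα0 : α = 0 := le_antisymm hα (not_lt.1 fun h => k4 ⟨hα', h⟩)
  have hβ' : β' ≤ 0 := not_lt.1 fun h => k2 ⟨hα', h⟩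
  have hβ : 0 < β := by
    by_contra h; push Not at h
    nlinarith [mul_nonneg hd.le (neg_nonneg.2 h), mul_nonneg he.le (neg_nonneg.2 hβ')]
  have hβ0 : β' = 0 := le_antisymm hβ' (not_lt.1 fun h => k3 ⟨h, hβ⟩)
  rw [hα0, zero_smul, zero_add] at hq
  rw [hβ0, zero_smul, add_zero] at hq'
  exact ⟨(eq_of_eq_smul hα' hq').symm, (eq_of_eq_smul hβ hq).symm⟩

theorem SphericalPolygon.vertex_notMem_openArc (P : SphericalPolygon) (i j : ZMod P.n) :
    P.vertex i ∉ openArc (P.vertex j) (P.vertex (j + 1)) := by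
  intro h
  have hc := P.inner_vertex_sq_lt_one j
  rcases P.eq_of_vertex_mem_edge (openArc_subset_arc _ _ h) with h1 | h1
  · rw [← h1] at h; exact left_notMem_openArc hc h
  · have : i = j + 1 := by rw [h1]; ring
    rw [this] at h; exact right_notMem_openArc hc h

open SphericalPolygon in
-- If the left normals were not opposite, moving from `x` along their bisector would enter both
-- regions.
theorem SphericalPolygon.cross_eq_of_disjoint {P Q : SphericalPolygon}
    (hd : Disjoint P.region Q.region) {i : ZMod P.n} {j : ZMod Q.n} {x : S2}
    (hx : x ∈ openArc (P.vertex i) (P.vertex (i + 1)))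
    (hx' : x ∈ openArc (Q.vertex j) (Q.vertex (j + 1))) :
    ∃ t : ℝ, 0 < t ∧ cross (Q.vertex j).1 (Q.vertex (j + 1)).1 =
      -(t • cross (P.vertex i).1 (P.vertex (i + 1)).1) := by
  have hcne : ∀ (R : SphericalPolygon) (k : ZMod R.n),
      cross (R.vertex k).1 (R.vertex (k + 1)).1 ≠ 0 := by
    intro R k h0
    have h5 : inner ℝ (cross (R.vertex k).1 (R.vertex (k + 1)).1)
        (cross (R.vertex k).1 (R.vertex (k + 1)).1) =
        inner ℝ (R.vertex k).1 (R.vertex k).1 * inner ℝ (R.vertex (k + 1)).1 (R.vertex (k + 1)).1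
          - (inner ℝ (R.vertex k).1 (R.vertex (k + 1)).1 : ℝ) ^ 2 := by
      simp only [inner_eq_coord]; simp [cross]; ring
    rw [h0, inner_zero_left, inner_self_S2, inner_self_S2] at h5
    linarith [R.inner_vertex_sq_lt_one k]
  refine cross_eq_neg_smul (hcne P i) (hcne Q j) ?_
  rintro w hw ⟨h1, h2⟩
  have p1 := ((mem_openArc_iff (P.inner_vertex_sq_lt_one i)).1 hx).1
  have p2 := ((mem_openArc_iff (Q.inner_vertex_sq_lt_one j)).1 hx').1
  have hxw : inner ℝ x.1 w = (0 : ℝ) := by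
    rw [hw, inner_add_right, real_inner_smul_right, real_inner_smul_right, real_inner_comm,
      real_inner_comm (cross (Q.vertex j).1 _), inner_cross, inner_cross, p1, p2]
    ring
  have hne : ∀ t : ℝ, x.1 + t • w ≠ 0 := by
    intro t h0
    have := congrArg (fun z => (inner ℝ x.1 z : ℝ)) h0
    simp only [inner_add_right, real_inner_smul_right, hxw, inner_self_S2, inner_zero_right] at this
    norm_num at this
  set γ : ℝ → S2 := fun t => normalize _ (hne t) with hγ
  have hc : Continuous γ := by
    refine Continuous.subtype_mk ?_ _
    refine Continuous.smul (Continuous.inv₀ (by fun_prop) fun t => norm_ne_zero_iff.2 (hne t)) ?_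
    fun_prop
  have h0 : γ 0 = x := by
    apply Subtype.ext; simp [hγ, normalize_val]
  obtain ⟨t, ⟨ht1, ht2⟩, ht0⟩ := (((P.eventually_mem_region_iff hx hc.continuousAt h0).and
    (Q.eventually_mem_region_iff hx' hc.continuousAt h0)).and self_mem_nhdsWithin).exists
  have ht0 : 0 < t := ht0
  have hnp := inv_pos.2 (norm_pos_iff.2 (hne t))
  rw [inner_cross] at h1 h2
  refine Set.disjoint_left.1 hd (ht1.2 ?_) (ht2.2 ?_)
  · simp only [hγ, normalize_val]
    rw [triple_smul_right]
    apply mul_pos hnp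
    rw [triple_add_right, p1, triple_smul_right, zero_add]
    exact mul_pos ht0 h1
  · simp only [hγ, normalize_val]
    rw [triple_smul_right]
    apply mul_pos hnp
    rw [triple_add_right, p2, triple_smul_right, zero_add]
    exact mul_pos ht0 h2

namespace SphericalTiling

variable (T : SphericalTiling)

theorem mem_boundary_of_mem_closure {P Q : SphericalPolygon} (hP : P ∈ T.tiles) (hQ : Q ∈ T.tiles)
    (hPQ : P ≠ Q) {x : S2} (h1 : x ∈ closure P.region) (h2 : x ∈ closure Q.region) :
    x ∈ P.boundary := by
  rw [P.closure_region_eq_union] at h1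
  rcases h1 with h1 | h1
  · obtain ⟨y, hy1, hy2⟩ := mem_closure_iff.1 h2 _ P.region_open h1
    exact absurd hy2 (Set.disjoint_left.1 (T.disjoint P hP Q hQ hPQ) hy1)
  · exact h1

theorem exists_openArc {P : SphericalPolygon} (hP : P ∈ T.tiles) {x : S2} (hx : x ∈ P.boundary)
    (hv : x ∉ T.vertices) : ∃ i, x ∈ openArc (P.vertex i) (P.vertex (i + 1)) := by
  obtain ⟨i, hi⟩ := mem_iUnion.1 hx
  refine ⟨i, mem_openArc_of_mem_arc hi ?_ ?_⟩ <;> rintro rfl <;>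
    exact hv (mem_biUnion hP (mem_range_self _))

/-- Two tiles whose closures share a point that is not a vertex share an edge. -/
theorem exists_shared_edge {P Q : SphericalPolygon} (hP : P ∈ T.tiles) (hQ : Q ∈ T.tiles)
    (hPQ : P ≠ Q) {x : S2} (h1 : x ∈ closure P.region) (h2 : x ∈ closure Q.region)
    (hv : x ∉ T.vertices) :
    ∃ i j, P.vertex i = Q.vertex (j + 1) ∧ P.vertex (i + 1) = Q.vertex j := by
  obtain ⟨i, hi⟩ := T.exists_openArc hP (T.mem_boundary_of_mem_closure hP hQ hPQ h1 h2) hv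
  obtain ⟨j, hj⟩ := T.exists_openArc hQ (T.mem_boundary_of_mem_closure hQ hP hPQ.symm h2 h1) hv
  obtain ⟨t, ht, hN⟩ := SphericalPolygon.cross_eq_of_disjoint (T.disjoint P hP Q hQ hPQ) hi hj
  have key : ∀ {R S : SphericalPolygon} (_ : R ∈ T.tiles) (_ : S ∈ T.tiles) (k : ZMod R.n)
      (l : ZMod S.n), R.vertex k ∉ openArc (S.vertex l) (S.vertex (l + 1)) := by
    intro R S hR hS k l h
    obtain ⟨m, hm⟩ := T.edge_to_edge R hR S hS k (mem_iUnion.2 ⟨l, SphericalPolygon.openArc_subset_arc _ _ h⟩)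
    rw [← hm] at h
    exact S.vertex_notMem_openArc m l h
  exact ⟨i, j, eq_of_openArc_overlap (P.inner_vertex_sq_lt_one i) hi hj ht hN (key hQ hP _ _)
    (key hQ hP _ _) (key hP hQ _ _) (key hP hQ _ _)⟩

theorem finite_vertices : T.vertices.Finite :=
  T.finite.biUnion fun _ _ => finite_range _

/-- A property of tiles that passes across shared edges holds for all tiles if it holds for one. -/
theorem tile_induction {good : SphericalPolygon → Prop}
    (step : ∀ P ∈ T.tiles, ∀ Q ∈ T.tiles, good P →
      (∃ i j, P.vertex i = Q.vertex (j + 1) ∧ P.vertex (i + 1) = Q.vertex j) → good Q)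
    {P₀ : SphericalPolygon} (hP₀ : P₀ ∈ T.tiles) (h₀ : good P₀) : ∀ Q ∈ T.tiles, good Q := by
  intro Q₀ hQ₀
  by_contra hbad
  have hcl : ∀ S : Set SphericalPolygon, IsClosed (⋃ P ∈ {P | P ∈ T.tiles ∧ P ∈ S},
      closure P.region) := fun S =>
    (T.finite.subset fun P hP => hP.1).isClosed_biUnion fun P _ => isClosed_closure
  -- A region made of vertices only would be finite, hence closed, and would contain its frontier.
  have hmeet : ∀ P : SphericalPolygon, (T.verticesᶜ ∩ P.region).Nonempty := by
    intro P
    by_contra hne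
    rw [Set.not_nonempty_iff_eq_empty] at hne
    have hsub : P.region ⊆ T.vertices := by
      intro x hx
      by_contra hx'
      exact (hne ▸ (⟨hx', hx⟩ : x ∈ T.verticesᶜ ∩ P.region) : x ∈ (∅ : Set S2))
    have hfin := T.finite_vertices.subset hsub
    have h1 : closure P.region = P.region := hfin.isClosed.closure_eq
    have h2 : P.vertex 0 ∈ P.region := by
      rw [← h1, P.closure_region_eq_union]
      exact Or.inr (mem_iUnion.2 ⟨0, left_mem_arc _ _⟩)
    have h3 : P.vertex 0 ∈ frontier P.region := by
      rw [P.frontier_region']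
      exact mem_iUnion.2 ⟨0, left_mem_arc _ _⟩
    exact Set.disjoint_left.1 (disjoint_frontier_iff_isOpen.2 P.region_open) h3 h2
  -- The good tiles and the bad tiles form two closed sets covering the connected complement of the
  -- vertices. They meet there, in a point on an edge shared by a good and a bad tile.
  have hpre := isPreconnected_closed_iff.1 (isPreconnected_compl_of_finite T.finite_vertices)
    _ _ (hcl {P | good P}) (hcl {P | ¬ good P}) (by
      intro x _
      have hx : x ∈ ⋃ P ∈ T.tiles, closure P.region := by rw [T.cover]; trivial
      simp only [mem_iUnion, exists_prop] at hx
      obtain ⟨P, hP, hxP⟩ := hx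
      by_cases hg : good P
      · exact Or.inl (mem_biUnion (x := P) ⟨hP, hg⟩ hxP)
      · exact Or.inr (mem_biUnion (x := P) ⟨hP, hg⟩ hxP))
    (by
      obtain ⟨x, hx1, hx2⟩ := hmeet P₀
      exact ⟨x, hx1, mem_biUnion (x := P₀) ⟨hP₀, h₀⟩ (subset_closure hx2)⟩)
    (by
      obtain ⟨x, hx1, hx2⟩ := hmeet Q₀
      exact ⟨x, hx1, mem_biUnion (x := Q₀) ⟨hQ₀, hbad⟩ (subset_closure hx2)⟩)
  obtain ⟨x, hxv, hx1, hx2⟩ := hpre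
  simp only [mem_iUnion, exists_prop] at hx1 hx2
  obtain ⟨P, ⟨hP, hPg⟩, hxP⟩ := hx1
  obtain ⟨Q, ⟨hQ, hQg⟩, hxQ⟩ := hx2
  have hPQ : P ≠ Q := by rintro rfl; exact hQg hPg
  exact hQg (step P hP Q hQ hPg (T.exists_shared_edge hP hQ hPQ hxP hxQ hxv))

end SphericalTiling

end SphTiling
end
noncomputable section
namespace SphTiling

/-! ### Edge lengths and angles -/

theorem cos_two_pi_div_three : Real.cos (2 * Real.pi / 3) = -(1 / 2) := by
  rw [show 2 * Real.pi / 3 = Real.pi - Real.pi / 3 by ring, Real.cos_pi_sub, Real.cos_pi_div_three]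

theorem cos_two_pi_div_five : Real.cos (2 * Real.pi / 5) = (√5 - 1) / 4 := by
  rw [show 2 * Real.pi / 5 = 2 * (Real.pi / 5) by ring, Real.cos_two_mul, Real.cos_pi_div_five]
  have : √5 ^ 2 = 5 := Real.sq_sqrt (by norm_num)
  linear_combination this / 8

theorem cos_four_pi_div_five : Real.cos (4 * Real.pi / 5) = -(1 + √5) / 4 := by
  rw [show 4 * Real.pi / 5 = Real.pi - Real.pi / 5 by ring, Real.cos_pi_sub, Real.cos_pi_div_five]
  ring

theorem sqrt_five_bounds : 2.236 < √5 ∧ √5 < 2.2361 := by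
  constructor
  · exact Real.lt_sqrt_of_sq_lt (by norm_num)
  · exact (Real.sqrt_lt' (by norm_num)).2 (by norm_num)

theorem eq_or_eq_of_cos_eq {α β : ℝ} (hα : α ∈ Ico 0 (2 * Real.pi)) (h0 : 0 ≤ β)
    (h1 : β ≤ Real.pi) (h : Real.cos α = Real.cos β) : α = β ∨ α = 2 * Real.pi - β := by
  rcases le_total α Real.pi with h2 | h2
  · exact Or.inl (Real.injOn_cos ⟨hα.1, h2⟩ ⟨h0, h1⟩ h)
  · right
    rw [← Real.cos_two_pi_sub] at h
    have := Real.injOn_cos ⟨by linarith [hα.2], by linarith⟩ ⟨h0, h1⟩ h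
    linarith

theorem le_of_cos_le {α β : ℝ} (hα : α ∈ Ico 0 (2 * Real.pi)) (h1 : β ≤ Real.pi)
    (h : Real.cos α ≤ Real.cos β) : β ≤ α := by
  by_contra! hlt
  exact absurd (Real.cos_lt_cos_of_nonneg_of_le_pi hα.1 h1 hlt) (not_lt.2 h)

namespace SphericalPolygon

variable {P : SphericalPolygon}

/-- The circumcircle has Euclidean radius `r ≤ 1`, so an edge is at most as long as that of the
regular `n`-gon on a great circle. -/
theorem Model.cos_le {c α r h : ℝ} {L : E3 ≃ₗᵢ[ℝ] E3} (hM : P.Model c α r h L) :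
    Real.cos (2 * Real.pi / P.n) ≤ c := by
  have h1 := hM.r_eq
  have h2 : r ^ 2 ≤ 1 := by nlinarith [hM.sq_add_sq, sq_nonneg h]
  have h3 : Real.cos (2 * Real.pi / P.n) = 1 - 2 * Real.sin (Real.pi / P.n) ^ 2 := by
    rw [show 2 * Real.pi / P.n = 2 * (Real.pi / P.n) by ring, Real.cos_two_mul, Real.sin_sq]; ring
  rw [h3]
  rw [mul_pow] at h1
  nlinarith [mul_le_of_le_one_left (sq_nonneg (Real.sin (Real.pi / P.n))) h2]

theorem HasShape.cos_le {c α : ℝ} (hs : P.HasShape c α) : Real.cos (2 * Real.pi / P.n) ≤ c := by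
  obtain ⟨r, h, L, hM⟩ := hs.model
  exact hM.cos_le

theorem HasShape.angle_eq {c α : ℝ} (hs : P.HasShape c α) :
    1 + Real.cos (2 * Real.pi / P.n) = (1 + c) * (1 - Real.cos α) / 2 := by
  obtain ⟨r, h, L, hM⟩ := hs.model
  exact hM.angle_eq

theorem HasShape.n_le {c α : ℝ} (hs : P.HasShape c α) {m : ℕ} (hm : 0 < m)
    (hc : c < Real.cos (2 * Real.pi / m)) (h2 : 2 ≤ m) : P.n < m := by
  by_contra! hle
  have hm' : (0 : ℝ) < m := by exact_mod_cast hm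
  have h2' : (2 : ℝ) ≤ m := by exact_mod_cast h2
  have hle' : (m : ℝ) ≤ P.n := by exact_mod_cast hle
  have hpi := Real.pi_pos
  have h1 : 2 * Real.pi / P.n ≤ 2 * Real.pi / m := by gcongr
  have h3 := Real.cos_le_cos_of_nonneg_of_le_pi (by positivity)
    (by rw [div_le_iff₀ hm']; nlinarith) h1
  linarith [hs.cos_le]

/-- Edges are quarter circles, so there are at most four of them. `angle_eq` fixes only `cos α`,
hence the alternative `α ↔ 2π - α`; it is void for `α = π`. -/
theorem HasShape.octahedral {α : ℝ} (hs : P.HasShape 0 α) :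
    (P.n = 3 ∧ (α = Real.pi / 2 ∨ α = 3 * Real.pi / 2)) ∨ (P.n = 4 ∧ α = Real.pi) := by
  have hpi := Real.pi_pos
  have h3 := P.three_le
  have h5 : P.n < 5 := hs.n_le (by norm_num) (by
    push_cast; rw [cos_two_pi_div_five]; linarith [sqrt_five_bounds.1]) (by norm_num)
  have he := hs.angle_eq
  have : P.n = 3 ∨ P.n = 4 := by omega
  rcases this with h | h
  · left
    refine ⟨h, ?_⟩
    rw [h] at he
    push_cast at he
    rw [cos_two_pi_div_three] at he
    rcases eq_or_eq_of_cos_eq hs.angle_mem (by linarith : 0 ≤ Real.pi / 2) (by linarith)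
      (by rw [Real.cos_pi_div_two]; linarith) with h | h
    · exact Or.inl h
    · right; linarith
  · right
    refine ⟨h, ?_⟩
    rw [h] at he
    push_cast at he
    rw [show 2 * Real.pi / 4 = Real.pi / 2 by ring, Real.cos_pi_div_two] at he
    rcases eq_or_eq_of_cos_eq hs.angle_mem hpi.le le_rfl (by rw [Real.cos_pi]; linarith) with h | h
    · exact h
    · linarith

theorem inv_sqrt_five : 1 / √5 = √5 / 5 := by
  rw [div_eq_div_iff (by positivity) (by norm_num), one_mul, Real.mul_self_sqrt (by norm_num)]

/-- As `1/√5 < cos (π/3)`, there are at most five edges, and `angle_eq` gives `cos α` for each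
number. Squares survive here and have to be excluded by the angle sum. -/
theorem HasShape.icosahedral {α : ℝ} (hs : P.HasShape (1 / √5) α) :
    (P.n = 3 ∧ (α = 2 * Real.pi / 5 ∨ α = 8 * Real.pi / 5)) ∨
    (P.n = 5 ∧ (α = 4 * Real.pi / 5 ∨ α = 6 * Real.pi / 5)) ∨
    (P.n = 4 ∧ Real.cos α = (√5 - 3) / 2) := by
  have hpi := Real.pi_pos
  have h3 := P.three_le
  obtain ⟨hl, hu⟩ := sqrt_five_bounds
  have hsq : √5 ^ 2 = 5 := Real.sq_sqrt (by norm_num)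
  rw [inv_sqrt_five] at hs
  have h6 : P.n < 6 := hs.n_le (by norm_num) (by
    push_cast
    rw [show 2 * Real.pi / 6 = Real.pi / 3 by ring, Real.cos_pi_div_three]; linarith) (by norm_num)
  have he := hs.angle_eq
  have hpos : (1 + √5 / 5) ≠ 0 := by positivity
  have : P.n = 3 ∨ P.n = 4 ∨ P.n = 5 := by omega
  rcases this with h | h | h
  · left
    refine ⟨h, ?_⟩
    rw [h] at he
    push_cast at he
    rw [cos_two_pi_div_three] at he
    rcases eq_or_eq_of_cos_eq hs.angle_mem (by linarith : 0 ≤ 2 * Real.pi / 5) (by linarith)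
      (by
        rw [cos_two_pi_div_five]
        apply mul_left_cancel₀ hpos
        linear_combination 2 * he - hsq / 20) with h | h
    · exact Or.inl h
    · right; linarith
  · right; right
    refine ⟨h, ?_⟩
    rw [h] at he
    push_cast at he
    rw [show 2 * Real.pi / 4 = Real.pi / 2 by ring, Real.cos_pi_div_two] at he
    apply mul_left_cancel₀ hpos
    linear_combination 2 * he - hsq / 10
  · right; left
    refine ⟨h, ?_⟩
    rw [h] at he
    push_cast at he
    rw [cos_two_pi_div_five] at he
    rcases eq_or_eq_of_cos_eq hs.angle_mem (by linarith : 0 ≤ 4 * Real.pi / 5) (by linarith)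
      (by
        rw [cos_four_pi_div_five]
        apply mul_left_cancel₀ hpos
        linear_combination 2 * he + hsq / 20) with h | h
    · exact Or.inl h
    · right; linarith

end SphericalPolygon

namespace SphericalTiling

variable {T : SphericalTiling}

/-- All edges of a regular tiling have the same length. -/
theorem IsRegular.hasShape (hreg : T.IsRegular) {c α : ℝ} {P₀ : SphericalPolygon}
    (hP₀ : P₀ ∈ T.tiles) (hs : P₀.HasShape c α) : ∀ P ∈ T.tiles, P.HasShape c (P.angle 0) := by
  refine T.tile_induction ?_ hP₀ ?_
  · rintro P hP Q hQ hPs ⟨i, j, h1, h2⟩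
    have hQs := (hreg Q hQ).hasShape
    have h3 := hQs.1 j
    rw [← h1, ← h2, real_inner_comm, hPs.1] at h3
    rwa [← h3] at hQs
  · exact ⟨hs.1, fun i => (hreg P₀ hP₀).2 i 0⟩

theorem angle_nonneg (P : SphericalPolygon) (i : ZMod P.n) : 0 ≤ P.angle i := (ccwAngle_mem _ _ _).1

/-- At a vertex, any two angles leave room for a third one. -/
theorem angle_add_angle_add_le (hreg : T.IsRegular) (hdeg : ∀ v ∈ T.vertices, 3 ≤ T.degree v)
    {m : ℝ} (hm : ∀ P ∈ T.tiles, m ≤ P.angle 0) {v : S2} {P Q : SphericalPolygon}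
    (hP : P ∈ T.tiles) (hQ : Q ∈ T.tiles) (hPQ : P ≠ Q) (hPv : v ∈ range P.vertex)
    (hQv : v ∈ range Q.vertex) : P.angle 0 + Q.angle 0 + m ≤ 2 * Real.pi := by
  classical
  have hv : v ∈ T.vertices := mem_biUnion hP hPv
  have hsum := T.angle_sum_of_isRegular hreg (T.tilesAt v) (fun _ => T.mem_tilesAt) hv
  obtain ⟨R, hR, hRn⟩ : ∃ R ∈ T.tilesAt v, R ∉ ({P, Q} : Finset SphericalPolygon) := by
    apply Finset.exists_mem_notMem_of_card_lt_card
    rw [card_tilesAt]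
    exact (Finset.card_le_two).trans_lt (hdeg v hv)
  simp only [Finset.mem_insert, Finset.mem_singleton, not_or] at hRn
  have hsub : ({P, Q, R} : Finset SphericalPolygon) ⊆ T.tilesAt v := by
    intro S hS
    simp only [Finset.mem_insert, Finset.mem_singleton] at hS
    rcases hS with rfl | rfl | rfl
    · exact T.mem_tilesAt.2 ⟨hP, hPv⟩
    · exact T.mem_tilesAt.2 ⟨hQ, hQv⟩
    · exact hR
  have := Finset.sum_le_sum_of_subset_of_nonneg (f := fun P => P.angle 0) hsub
    fun S _ _ => angle_nonneg S 0
  rw [hsum, Finset.sum_insert (by simp [hPQ, Ne.symm hRn.1]),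
    Finset.sum_pair (Ne.symm hRn.2)] at this
  linarith [hm R (T.mem_tilesAt.1 hR).1]

theorem angle_add_le (hreg : T.IsRegular) (hdeg : ∀ v ∈ T.vertices, 3 ≤ T.degree v)
    {m : ℝ} (hm : ∀ P ∈ T.tiles, m ≤ P.angle 0) {P : SphericalPolygon} (hP : P ∈ T.tiles) :
    P.angle 0 + 2 * m ≤ 2 * Real.pi := by
  classical
  have hv : P.vertex 0 ∈ T.vertices := mem_biUnion hP (mem_range_self _)
  obtain ⟨Q, hQ, hQn⟩ : ∃ Q ∈ T.tilesAt (P.vertex 0), Q ∉ ({P} : Finset SphericalPolygon) := by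
    apply Finset.exists_mem_notMem_of_card_lt_card
    rw [card_tilesAt, Finset.card_singleton]
    exact lt_of_lt_of_le (by norm_num) (hdeg _ hv)
  rw [Finset.mem_singleton] at hQn
  obtain ⟨hQT, hQv⟩ := T.mem_tilesAt.1 hQ
  have := angle_add_angle_add_le hreg hdeg hm hP hQT (Ne.symm hQn) (mem_range_self _) hQv
  linarith [hm Q hQT]

/-- All angles are at least `π/2`, so `3π/2` would leave no room for two more. -/
theorem octahedral_tiles (hreg : T.IsRegular) (hdeg : ∀ v ∈ T.vertices, 3 ≤ T.degree v)
    (hs : ∀ P ∈ T.tiles, P.HasShape 0 (P.angle 0)) : ∀ P ∈ T.tiles,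
      (P.n = 3 ∧ P.angle 0 = Real.pi / 2) ∨ (P.n = 4 ∧ P.angle 0 = Real.pi) := by
  have hpi := Real.pi_pos
  have hm : ∀ P ∈ T.tiles, Real.pi / 2 ≤ P.angle 0 := by
    intro P hP
    rcases (hs P hP).octahedral with ⟨-, h | h⟩ | ⟨-, h⟩ <;> rw [h] <;> linarith
  intro P hP
  rcases (hs P hP).octahedral with ⟨h1, h | h⟩ | h
  · exact Or.inl ⟨h1, h⟩
  · have := angle_add_le hreg hdeg hm hP
    rw [h] at this
    linarith
  · exact Or.inr h

/-- All angles are at least `2π/5`, which rules out the concave triangle and the concave square. The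
convex square has an angle `s` strictly between `3π/5` and `2π/3`, while all other angles are
multiples of `2π/5`; no such combination containing `s` adds up to `2π`. -/
theorem icosahedral_tiles (hreg : T.IsRegular) (hdeg : ∀ v ∈ T.vertices, 3 ≤ T.degree v)
    (hs : ∀ P ∈ T.tiles, P.HasShape (1 / √5) (P.angle 0)) : ∀ P ∈ T.tiles,
      (P.n = 3 ∧ P.angle 0 = 2 * Real.pi / 5) ∨
      (P.n = 5 ∧ (P.angle 0 = 4 * Real.pi / 5 ∨ P.angle 0 = 6 * Real.pi / 5)) := by
  classical
  have hpi := Real.pi_pos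
  obtain ⟨hl, hu⟩ := sqrt_five_bounds
  have hm : ∀ P ∈ T.tiles, 2 * Real.pi / 5 ≤ P.angle 0 := by
    intro P hP
    rcases (hs P hP).icosahedral with ⟨-, h | h⟩ | ⟨-, h | h⟩ | ⟨-, h⟩
    · rw [h]
    · rw [h]; linarith
    · rw [h]; linarith
    · rw [h]; linarith
    · apply le_of_cos_le (hs P hP).angle_mem (by linarith)
      rw [h, cos_two_pi_div_five]; linarith
  -- the angle of a square
  set s := Real.arccos ((√5 - 3) / 2) with hsdef
  have hcs : Real.cos s = (√5 - 3) / 2 := Real.cos_arccos (by linarith) (by linarith)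
  have hs0 : 0 ≤ s := Real.arccos_nonneg _
  have hsπ : s ≤ Real.pi := Real.arccos_le_pi _
  have hs1 : 3 * Real.pi / 5 < s := by
    by_contra! h
    have := Real.cos_le_cos_of_nonneg_of_le_pi hs0 (by linarith) h
    rw [hcs, show 3 * Real.pi / 5 = Real.pi - 2 * Real.pi / 5 by ring, Real.cos_pi_sub,
      cos_two_pi_div_five] at this
    linarith
  have hs2 : s < 2 * Real.pi / 3 := by
    by_contra! h
    have := Real.cos_le_cos_of_nonneg_of_le_pi (by linarith) hsπ h
    rw [hcs, cos_two_pi_div_three] at this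
    linarith
  have hvals : ∀ P ∈ T.tiles, (P.n = 3 ∧ P.angle 0 = 2 * Real.pi / 5) ∨
      (P.n = 5 ∧ (P.angle 0 = 4 * Real.pi / 5 ∨ P.angle 0 = 6 * Real.pi / 5)) ∨
      (P.n = 4 ∧ P.angle 0 = s) := by
    intro P hP
    have hle := angle_add_le hreg hdeg hm hP
    rcases (hs P hP).icosahedral with ⟨h1, h | h⟩ | h | ⟨h1, h⟩
    · exact Or.inl ⟨h1, h⟩
    · rw [h] at hle; linarith
    · exact Or.inr (Or.inl h)
    · rw [← hcs] at h
      rcases eq_or_eq_of_cos_eq (hs P hP).angle_mem hs0 hsπ h with h | h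
      · exact Or.inr (Or.inr ⟨h1, h⟩)
      · rw [h] at hle; linarith
  intro P hP
  rcases hvals P hP with h | h | h
  · exact Or.inl h
  · exact Or.inr h
  exfalso
  -- the sum of the angles at a vertex of a square
  set A := T.tilesAt (P.vertex 0) with hA
  have hsum := T.angle_sum_of_isRegular hreg A (fun _ => T.mem_tilesAt)
    (mem_biUnion hP (mem_range_self _))
  -- `w` is the angle in units of `2π/5`, with squares counted separately.
  have hw : ∀ Q : SphericalPolygon, ∃ w : ℕ, Q ∈ A →
      Q.angle 0 = w * (2 * Real.pi / 5) + if Q.n = 4 then s else 0 := by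
    intro Q
    by_cases hQ : Q ∈ A
    · rcases hvals Q (T.mem_tilesAt.1 hQ).1 with ⟨h1, h⟩ | ⟨h1, h | h⟩ | ⟨h1, h⟩
      · exact ⟨1, fun _ => by rw [h, h1]; norm_num⟩
      · exact ⟨2, fun _ => by rw [h, h1]; norm_num; ring⟩
      · exact ⟨3, fun _ => by rw [h, h1]; norm_num; ring⟩
      · exact ⟨0, fun _ => by rw [h, h1]; norm_num⟩
    · exact ⟨0, fun h => absurd h hQ⟩
  choose w hw using hw
  rw [Finset.sum_congr rfl hw, Finset.sum_add_distrib, ← Finset.sum_mul, ← Nat.cast_sum,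
    ← Finset.sum_filter, Finset.sum_const, nsmul_eq_mul] at hsum
  have hb : 0 < (A.filter fun Q => Q.n = 4).card :=
    Finset.card_pos.2 ⟨P, Finset.mem_filter.2 ⟨T.mem_tilesAt.2 ⟨hP, mem_range_self _⟩, h.1⟩⟩
  set b := (A.filter fun Q => Q.n = 4).card
  set a := ∑ Q ∈ A, w Q
  have hb4 : b < 4 := by
    by_contra! h4
    have h4' : (4 : ℝ) ≤ b := by exact_mod_cast h4
    have : 0 ≤ (a : ℝ) * (2 * Real.pi / 5) := by positivity
    have h5 : 4 * s ≤ b * s := by gcongr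
    linarith
  have ha : a ≤ 5 := by
    by_contra! h6
    have h6' : (6 : ℝ) ≤ a := by exact_mod_cast h6
    have : 0 ≤ (b : ℝ) * s := by positivity
    have h5 : 6 * (2 * Real.pi / 5) ≤ a * (2 * Real.pi / 5) := by gcongr
    linarith
  -- The closest cases are `b = 2, a = 2` and `b = 3, a = 0`, which would need `s = 3π/5` and `s =
  -- 2π/3`; the strict bounds exclude them.
  interval_cases b <;> interval_cases a <;> push_cast at hsum <;> linarith

end SphericalTiling

end SphTiling
end
noncomputable section
namespace SphTiling

/-! ### Central projections and faces -/

theorem mem_centralProjection_triple {a b d x : S2} : x ∈ centralProjection {a, b, d} ↔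
    ∃ α β γ : ℝ, 0 ≤ α ∧ 0 ≤ β ∧ 0 ≤ γ ∧ x.1 = α • a.1 + β • b.1 + γ • d.1 := by
  have himg : (Subtype.val '' ({a, b, d} : Set S2) : Set E3) = {a.1, b.1, d.1} := by
    simp [image_insert_eq]
  constructor
  · rintro ⟨t, ht, hx⟩
    have hconv : Convex ℝ {y : E3 | ∃ α β γ : ℝ, 0 ≤ α ∧ 0 ≤ β ∧ 0 ≤ γ ∧
        y = α • a.1 + β • b.1 + γ • d.1} := by
      rintro _ ⟨α, β, γ, h1, h2, h3, rfl⟩ _ ⟨α', β', γ', h1', h2', h3', rfl⟩ s u hs hu -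
      exact ⟨s * α + u * α', s * β + u * β', s * γ + u * γ', by positivity, by positivity,
        by positivity, by module⟩
    have hsub : (Subtype.val '' ({a, b, d} : Set S2) : Set E3) ⊆ {y : E3 | ∃ α β γ : ℝ, 0 ≤ α ∧
        0 ≤ β ∧ 0 ≤ γ ∧ y = α • a.1 + β • b.1 + γ • d.1} := by
      rw [himg]
      rintro y (rfl | rfl | rfl)
      · exact ⟨1, 0, 0, by norm_num, le_rfl, le_rfl, by simp⟩
      · exact ⟨0, 1, 0, le_rfl, by norm_num, le_rfl, by simp⟩
      · exact ⟨0, 0, 1, le_rfl, le_rfl, by norm_num, by simp⟩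
    obtain ⟨α, β, γ, h1, h2, h3, h⟩ := convexHull_min hsub hconv hx
    refine ⟨t⁻¹ * α, t⁻¹ * β, t⁻¹ * γ, by positivity, by positivity, by positivity, ?_⟩
    rw [mul_smul, mul_smul, mul_smul, ← smul_add, ← smul_add, ← h, smul_smul,
      inv_mul_cancel₀ ht.ne', one_smul]
  · rintro ⟨α, β, γ, h1, h2, h3, hx⟩
    have hpos : 0 < α + β + γ := by
      refine lt_of_le_of_ne (by positivity) fun h => S2.ne_zero x ?_
      have e1 : α = 0 := by linarith
      have e2 : β = 0 := by linarith
      have e3 : γ = 0 := by linarith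
      rw [hx, e1, e2, e3]; simp
    refine ⟨(α + β + γ)⁻¹, inv_pos.2 hpos, ?_⟩
    rw [himg, hx]
    have ha : a.1 ∈ convexHull ℝ ({a.1, b.1, d.1} : Set E3) := subset_convexHull _ _ (by simp)
    have hb : b.1 ∈ convexHull ℝ ({a.1, b.1, d.1} : Set E3) := subset_convexHull _ _ (by simp)
    have hd : d.1 ∈ convexHull ℝ ({a.1, b.1, d.1} : Set E3) := subset_convexHull _ _ (by simp)
    have := (convex_convexHull ℝ ({a.1, b.1, d.1} : Set E3)).sum_mem (t := Finset.univ)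
      (w := fun i : Fin 3 => (α + β + γ)⁻¹ * ![α, β, γ] i) (z := ![a.1, b.1, d.1])
      (by intro i _; have := inv_pos.2 hpos; fin_cases i <;> simp <;> positivity)
      (by
        rw [← Finset.mul_sum, Fin.sum_univ_three]
        simp only [Matrix.cons_val]
        exact inv_mul_cancel₀ hpos.ne')
      (by intro i _; fin_cases i <;> assumption)
    rw [Fin.sum_univ_three] at this
    simp only [Matrix.cons_val] at this
    rwa [smul_add, smul_add, smul_smul, smul_smul, smul_smul]

theorem inner_nonpos_of_mem_centralProjection {F : Set S2} {u : E3}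
    (hu : ∀ f ∈ F, inner ℝ u f.1 ≤ (0 : ℝ)) {x : S2} (hx : x ∈ centralProjection F) :
    inner ℝ u x.1 ≤ (0 : ℝ) := by
  obtain ⟨t, ht, hx⟩ := hx
  have hsub : (Subtype.val '' F : Set E3) ⊆ {y | inner ℝ u y ≤ (0 : ℝ)} := by
    rintro _ ⟨f, hf, rfl⟩
    exact hu f hf
  have hc : Convex ℝ {y : E3 | inner ℝ u y ≤ (0 : ℝ)} :=
    convex_halfSpace_le (innerₛₗ ℝ u).isLinear 0
  have h : inner ℝ u (t • x.1) ≤ (0 : ℝ) := convexHull_min hsub hc hx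
  rw [real_inner_smul_right] at h
  by_contra! h'
  exact absurd (mul_pos ht h') (not_lt.2 h)

theorem ne_of_inner_eq {c : ℝ} (hc : c < 1) {a b : S2} (h : inner ℝ a.1 b.1 = c) : a ≠ b := by
  rintro rfl
  rw [inner_self_S2] at h
  linarith

theorem mem_faces_triple {V : Set S2} {c : ℝ} (hc : c < 1) {a b d : S2} (ha : a ∈ V) (hb : b ∈ V)
    (hd : d ∈ V) (h1 : inner ℝ a.1 b.1 = c) (h2 : inner ℝ b.1 d.1 = c)
    (h3 : inner ℝ a.1 d.1 = c) : {a, b, d} ∈ faces V c := by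
  refine ⟨?_, Set.ncard_eq_three.2 ⟨a, b, d, ne_of_inner_eq hc h1, ne_of_inner_eq hc h3,
    ne_of_inner_eq hc h2, rfl⟩, ?_⟩
  · rintro x (rfl | rfl | rfl) <;> assumption
  · rintro x (rfl | rfl | rfl) y (rfl | rfl | rfl) hxy
    all_goals first
      | exact absurd rfl hxy
      | assumption
      | (rw [real_inner_comm]; assumption)

theorem exists_triple_of_mem_faces {V : Set S2} {c : ℝ} {F : Set S2} (hF : F ∈ faces V c) {a : S2}
    (ha : a ∈ F) : ∃ b d : S2, F = {a, b, d} ∧ a ∈ V ∧ b ∈ V ∧ d ∈ V ∧ inner ℝ a.1 b.1 = c ∧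
      inner ℝ b.1 d.1 = c ∧ inner ℝ a.1 d.1 = c := by
  obtain ⟨hV, hcard, hin⟩ := hF
  obtain ⟨x, y, z, hxy, hxz, hyz, rfl⟩ := Set.ncard_eq_three.1 hcard
  have mx : x ∈ ({x, y, z} : Set S2) := by simp
  have my : y ∈ ({x, y, z} : Set S2) := by simp
  have mz : z ∈ ({x, y, z} : Set S2) := by simp
  rcases ha with rfl | rfl | rfl
  · exact ⟨y, z, rfl, hV mx, hV my, hV mz, hin _ mx _ my hxy, hin _ my _ mz hyz, hin _ mx _ mz hxz⟩
  · exact ⟨x, z, Set.insert_comm _ _ _, hV my, hV mx, hV mz, hin _ my _ mx hxy.symm,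
      hin _ mx _ mz hxz, hin _ my _ mz hyz⟩
  · refine ⟨x, y, ?_, hV mz, hV mx, hV my, hin _ mz _ mx hxz.symm, hin _ mx _ my hxy,
      hin _ mz _ my hyz.symm⟩
    ext w; simp only [mem_insert_iff, mem_singleton_iff]; tauto

theorem faces_nonempty {V : Set S2} {c : ℝ} {F : Set S2} (hF : F ∈ faces V c) : F.Nonempty :=
  Set.nonempty_of_ncard_ne_zero (by rw [hF.2.1]; norm_num)

theorem triple_sq_equilateral {c : ℝ} {p q r : S2} (h1 : inner ℝ p.1 q.1 = c)
    (h2 : inner ℝ q.1 r.1 = c) (h3 : inner ℝ p.1 r.1 = c) :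
    triple p.1 q.1 r.1 ^ 2 = (1 - c) ^ 2 * (1 + 2 * c) := by
  rw [triple_sq_unit (norm_eq_of_mem_sphere p) (norm_eq_of_mem_sphere q) (norm_eq_of_mem_sphere r),
    h1, h2, h3]
  ring

/-- The Gram determinant fixes the triple product up to sign, and the sign is the side of the great
circle through `p` and `q`. -/
theorem apex_unique {c : ℝ} (hc : c ^ 2 < 1) {p q r r' : S2} (h1 : inner ℝ p.1 q.1 = c)
    (h2 : inner ℝ q.1 r.1 = c) (h3 : inner ℝ p.1 r.1 = c) (h2' : inner ℝ q.1 r'.1 = c)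
    (h3' : inner ℝ p.1 r'.1 = c) (h : 0 < triple p.1 q.1 r.1 * triple p.1 q.1 r'.1) : r = r' := by
  apply Subtype.ext
  refine eq_of_inner_of_triple (norm_eq_of_mem_sphere p) (norm_eq_of_mem_sphere q)
    (by rwa [h1]) (h3.trans h3'.symm) (h2.trans h2'.symm) ?_
  have e := triple_sq_equilateral h1 h2 h3
  rw [← triple_sq_equilateral h1 h2' h3'] at e
  rcases sq_eq_sq_iff_eq_or_eq_neg.1 e with e | e
  · exact e
  · rw [e] at h
    nlinarith [sq_nonneg (triple p.1 q.1 r'.1)]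

/-- The common features of the octahedron and the icosahedron: `V` is the vertex set, `c` the inner
product of adjacent vertices, and every vertex has at most `k` neighbours. -/
structure IsDeltahedron (V : Set S2) (c : ℝ) (k : ℕ) : Prop where
  finite : V.Finite
  c_lower : -(1 / 2) < c
  c_upper : c < 1
  third : ∀ p ∈ V, ∀ q ∈ V, inner ℝ p.1 q.1 = c →
    ∃ r ∈ V, inner ℝ q.1 r.1 = c ∧ inner ℝ p.1 r.1 = c ∧ 0 < triple p.1 q.1 r.1
  ncard_neighbours_le : ∀ a ∈ V, (neighbours V c a).ncard ≤ k
  separation : ∀ a ∈ V, ∀ F ∈ faces V c, a ∉ F → ∃ u : E3, 0 < (inner ℝ u a.1 : ℝ) ∧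
    (∀ w ∈ neighbours V c a, 0 ≤ (inner ℝ u w.1 : ℝ)) ∧ ∀ f ∈ F, inner ℝ u f.1 ≤ (0 : ℝ)
  cover : ∀ x : S2, ∃ F ∈ faces V c, x ∈ centralProjection F

/-- `m` is an inner point of the triangle `F`. -/
def IsInnerPoint (F : Set S2) (m : S2) : Prop :=
  m ∈ centralProjection F ∧ ∀ u : E3, (∀ f ∈ F, 0 ≤ (inner ℝ u f.1 : ℝ)) →
    (∃ f ∈ F, 0 < (inner ℝ u f.1 : ℝ)) → 0 < (inner ℝ u m.1 : ℝ)

namespace IsDeltahedron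

variable {V : Set S2} {c : ℝ} {k : ℕ}

theorem sq_lt_one (hV : IsDeltahedron V c k) : c ^ 2 < 1 := by
  have := hV.c_lower
  have := hV.c_upper
  nlinarith

theorem triple_ne_zero (hV : IsDeltahedron V c k) {p q r : S2} (h1 : inner ℝ p.1 q.1 = c)
    (h2 : inner ℝ q.1 r.1 = c) (h3 : inner ℝ p.1 r.1 = c) : triple p.1 q.1 r.1 ≠ 0 := by
  intro h
  have e := triple_sq_equilateral h1 h2 h3
  rw [h] at e
  have := hV.c_lower
  have := hV.c_upper
  have : 0 < (1 - c) ^ 2 * (1 + 2 * c) := mul_pos (pow_pos (by linarith) 2) (by linarith)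
  linarith

/-- The projected centroid; the sum of the vertices is nonzero since its product with `a` is `1 + 2
c > 0`. -/
theorem exists_innerPoint (hV : IsDeltahedron V c k) {F : Set S2} (hF : F ∈ faces V c) :
    ∃ m, IsInnerPoint F m := by
  obtain ⟨a, ha⟩ := faces_nonempty hF
  obtain ⟨b, d, rfl, -, -, -, h1, h2, h3⟩ := exists_triple_of_mem_faces hF ha
  have hne : a.1 + b.1 + d.1 ≠ 0 := by
    intro h0
    have := congrArg (fun y => (inner ℝ a.1 y : ℝ)) h0
    simp only [inner_add_right, inner_self_S2, h1, h3, inner_zero_right] at this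
    linarith [hV.c_lower]
  have hn := inv_pos.2 (norm_pos_iff.2 hne)
  refine ⟨normalize _ hne, mem_centralProjection_triple.2 ⟨_, _, _, hn.le, hn.le, hn.le, by
    rw [normalize_val, smul_add, smul_add]⟩, ?_⟩
  intro u hu hu'
  rw [normalize_val, real_inner_smul_right, inner_add_right, inner_add_right]
  apply mul_pos hn
  have u1 := hu a (by simp)
  have u2 := hu b (by simp)
  have u3 := hu d (by simp)
  obtain ⟨f, hf, hf0⟩ := hu'
  rcases hf with rfl | rfl | rfl <;> linarith

/-- If `a` is in `F` but not in `G`, the functional from `separation` is nonnegative on `F` and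
positive at `a`, hence positive at `m`, but it is nonpositive on `G`. So the faces do not overlap.
-/
theorem eq_of_innerPoint_mem (hV : IsDeltahedron V c k) {F G : Set S2} (hF : F ∈ faces V c)
    (hG : G ∈ faces V c) {m : S2} (hm : IsInnerPoint F m) (hmG : m ∈ centralProjection G) :
    F = G := by
  by_contra hne
  have : ¬ F ⊆ G := by
    intro hsub
    have hGf : G.Finite := Set.finite_of_ncard_ne_zero (by rw [hG.2.1]; norm_num)
    exact hne (Set.eq_of_subset_of_ncard_le hsub (by rw [hF.2.1, hG.2.1]) hGf)
  obtain ⟨a, haF, haG⟩ := Set.not_subset.1 this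
  obtain ⟨u, hu1, hu2, hu3⟩ := hV.separation a (hF.1 haF) G hG haG
  have h1 := hm.2 u (by
    intro f hf
    by_cases hfa : f = a
    · rw [hfa]; exact hu1.le
    · exact hu2 f ⟨hF.1 hf, hF.2.2 a haF f hf (Ne.symm hfa)⟩) ⟨a, haF, hu1⟩
  linarith [inner_nonpos_of_mem_centralProjection hu3 hmG]

/-- An inner point of a face is not on an edge. -/
theorem innerPoint_notMem_arc (hV : IsDeltahedron V c k) {F : Set S2} (hF : F ∈ faces V c) {m : S2}
    (hm : IsInnerPoint F m) {p q : S2} (hp : p ∈ V) (hq : q ∈ V) (hpq : inner ℝ p.1 q.1 = c) :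
    m ∉ arc p q := by
  rintro ⟨a, b, ha, hb, hx⟩
  have hqp : inner ℝ q.1 p.1 = c := by rw [real_inner_comm]; exact hpq
  obtain ⟨r, hr, r1, r2, r3⟩ := hV.third p hp q hq hpq
  obtain ⟨s, hs, s1, s2, s3⟩ := hV.third q hq p hp hqp
  -- A point of the edge lies in the faces on both sides of it, so both would equal `F`; their third
  -- vertices lie on opposite sides.
  have e1 := hV.eq_of_innerPoint_mem hF (mem_faces_triple hV.c_upper hp hq hr hpq r1 r2) hm
    (mem_centralProjection_triple.2 ⟨a, b, 0, ha, hb, le_rfl, by simp [hx]⟩)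
  have e2 := hV.eq_of_innerPoint_mem hF (mem_faces_triple hV.c_upper hp hq hs hpq s2 s1) hm
    (mem_centralProjection_triple.2 ⟨a, b, 0, ha, hb, le_rfl, by simp [hx]⟩)
  have hrm : r ∈ ({p, q, s} : Set S2) := by rw [← e2, e1]; simp
  rcases hrm with h | h | h
  · rw [h, inner_self_S2] at r2; linarith [hV.c_upper]
  · rw [h, inner_self_S2] at r1; linarith [hV.c_upper]
  · rw [mem_singleton_iff.1 h] at r3
    rw [triple_swap] at s3
    linarith

/-- The faces at a vertex whose neighbours are the vertices of a polygon, in order. -/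
theorem faces_at_center (hV : IsDeltahedron V c k) {P : SphericalPolygon}
    (hs : ∀ i, inner ℝ (P.vertex i).1 (P.vertex (i + 1)).1 = c)
    {d : S2} (hd : d ∈ V) (hnb : range P.vertex = neighbours V c d)
    (hside : (∀ i, 0 < triple d.1 (P.vertex i).1 (P.vertex (i + 1)).1) ∨
      ∀ i, triple d.1 (P.vertex i).1 (P.vertex (i + 1)).1 < 0) {F : Set S2} :
    (F ∈ faces V c ∧ d ∈ F) ↔ ∃ i, F = {d, P.vertex i, P.vertex (i + 1)} := by
  have hmem : ∀ i, P.vertex i ∈ neighbours V c d := fun i => hnb ▸ mem_range_self i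
  constructor
  · rintro ⟨hF, hdF⟩
    obtain ⟨x, y, rfl, -, hx, hy, h1, h2, h3⟩ := exists_triple_of_mem_faces hF hdF
    obtain ⟨i, rfl⟩ : x ∈ range P.vertex := by rw [hnb]; exact ⟨hx, h1⟩
    have hne := hV.triple_ne_zero h1 h2 h3
    have hi := hs (i - 1)
    rw [sub_add_cancel] at hi
    -- The third vertex of a face at `d` and `P.vertex i` is determined by its side, and the two
    -- sides are taken by the next and the previous vertex of `P`.
    have key : ∀ r : S2, inner ℝ (P.vertex i).1 r.1 = c → inner ℝ d.1 r.1 = c →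
        0 < triple d.1 (P.vertex i).1 y.1 * triple d.1 (P.vertex i).1 r.1 → y = r :=
      fun r e1 e2 e3 => apex_unique hV.sq_lt_one h1 h2 h3 e1 e2 e3
    have hplus := key (P.vertex (i + 1)) (hs i) (hmem _).2
    have hminus := key (P.vertex (i - 1)) (by rw [real_inner_comm]; exact hi) (hmem _).2
    have hprev : triple d.1 (P.vertex i).1 (P.vertex (i - 1)).1 =
        -triple d.1 (P.vertex (i - 1)).1 (P.vertex (i - 1 + 1)).1 := by
      rw [sub_add_cancel, triple_rotate, ← triple_swap, triple_rotate]
    have hback : y = P.vertex (i - 1) →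
        ∃ j, ({d, P.vertex i, y} : Set S2) = {d, P.vertex j, P.vertex (j + 1)} := by
      rintro rfl
      exact ⟨i - 1, by rw [sub_add_cancel, Set.pair_comm]⟩
    rcases lt_or_gt_of_ne hne with h | h <;> rcases hside with hside | hside
    · apply hback
      apply hminus
      rw [hprev]
      exact mul_pos_of_neg_of_neg h (neg_neg_of_pos (hside _))
    · exact ⟨i, by rw [hplus (mul_pos_of_neg_of_neg h (hside i))]⟩
    · exact ⟨i, by rw [hplus (mul_pos h (hside i))]⟩
    · apply hback
      apply hminus
      rw [hprev]
      exact mul_pos h (neg_pos.2 (hside _))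
  · rintro ⟨i, rfl⟩
    exact ⟨mem_faces_triple hV.c_upper hd (hmem _).1 (hmem _).1 (hmem _).2 (hs i) (hmem _).2,
      by simp⟩

/-- Counting: `P` has `k` distinct vertices among the at most `k` neighbours of `d`. -/
theorem range_eq_neighbours (hV : IsDeltahedron V c k) {P : SphericalPolygon} (hn : P.n = k)
    (hPV : range P.vertex ⊆ V) {d : S2} (hd : d ∈ V)
    (h : ∀ i, inner ℝ d.1 (P.vertex i).1 = c) : range P.vertex = neighbours V c d := by
  apply Set.eq_of_subset_of_ncard_le
  · rintro _ ⟨i, rfl⟩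
    exact ⟨hPV (mem_range_self i), h i⟩
  · have h1 : (range P.vertex).ncard = P.n := by
      rw [← Set.image_univ, Set.ncard_image_of_injective _ P.vertex_injective, Set.ncard_univ,
        Nat.card_zmod]
    rw [h1, hn]
    exact hV.ncard_neighbours_le d hd
  · exact hV.finite.subset fun x hx => hx.1

/-- A polygon whose vertices are the neighbours of its centre consists of the faces at the
centre. -/
theorem closure_eq_of_center_mem (hV : IsDeltahedron V c k) {P : SphericalPolygon} (hn : P.n = k)
    (hs : ∀ i, inner ℝ (P.vertex i).1 (P.vertex (i + 1)).1 = c) (hPV : range P.vertex ⊆ V)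
    {o : S2} {H : E3 → ℝ} (hH : P.StarShaped o H) (ho : ∀ i, inner ℝ o.1 (P.vertex i).1 = c) :
    o ∈ V ∧ range P.vertex = neighbours V c o ∧
      closure P.region = ⋃ F ∈ {F | F ∈ faces V c ∧ o ∈ F}, centralProjection F := by
  -- The centre is the apex of an equilateral triangle to the left of edge `0`; by uniqueness it is
  -- the vertex provided by `third`.
  have hoV : o ∈ V := by
    obtain ⟨r, hr, r1, r2, r3⟩ := hV.third _ (hPV (mem_range_self 0)) _
      (hPV (mem_range_self (0 + 1))) (hs 0)
    have e0 := ho 0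
    have e1 := ho (0 + 1)
    rw [real_inner_comm] at e0 e1
    rwa [apex_unique hV.sq_lt_one (hs 0) e1 e0 r1 r2 (mul_pos (hH.triple_pos 0) r3)]
  have hnb := hV.range_eq_neighbours hn hPV hoV ho
  refine ⟨hoV, hnb, ?_⟩
  have hside : ∀ i, 0 < triple o.1 (P.vertex i).1 (P.vertex (i + 1)).1 := by
    intro i
    rw [triple_rotate]
    exact hH.triple_pos i
  rw [hH.closure_eq]
  ext x
  simp only [mem_iUnion, exists_prop, mem_ofPred_eq]
  simp only [hV.faces_at_center hs hoV hnb (Or.inl hside)]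
  constructor
  · intro hx
    obtain ⟨i, b, e, hb, he, hxe⟩ := hH.decomp x.1
    exact ⟨_, ⟨i, rfl⟩, mem_centralProjection_triple.2 ⟨_, _, _, hx, hb, he, hxe⟩⟩
  · rintro ⟨_, ⟨i, rfl⟩, hx⟩
    obtain ⟨a, b, e, ha, hb, he, hxe⟩ := mem_centralProjection_triple.1 hx
    rw [hxe, hH.comp _ _ _ _ hb he]
    exact ha

/-- A polygon whose vertices are the neighbours of the antipode `d` of its centre consists of the
faces that do not contain `d`. -/
theorem closure_eq_of_neg_center_mem (hV : IsDeltahedron V c k) {P : SphericalPolygon}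
    (hn : P.n = k) (hs : ∀ i, inner ℝ (P.vertex i).1 (P.vertex (i + 1)).1 = c)
    (hPV : range P.vertex ⊆ V) {o d : S2} (hd : d.1 = -o.1) {H : E3 → ℝ} (hH : P.StarShaped o H)
    (ho : ∀ i, inner ℝ o.1 (P.vertex i).1 = -c) :
    d ∈ V ∧ range P.vertex = neighbours V c d ∧
      closure P.region = ⋃ F ∈ {F | F ∈ faces V c ∧ d ∉ F}, centralProjection F := by
  have hdin : ∀ i, inner ℝ d.1 (P.vertex i).1 = c := by
    intro i; rw [hd, inner_neg_left, ho, neg_neg]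
  have hdtr : ∀ i, triple (P.vertex (i + 1)).1 (P.vertex i).1 d.1 > 0 := by
    intro i
    have := hH.triple_pos i
    rw [triple_swap, hd, show -o.1 = (-1 : ℝ) • o.1 by simp, triple_smul_right]
    linarith
  have hs' : ∀ i, inner ℝ (P.vertex (i + 1)).1 (P.vertex i).1 = c := by
    intro i; rw [real_inner_comm]; exact hs i
  have hdV : d ∈ V := by
    obtain ⟨r, hr, r1, r2, r3⟩ := hV.third _ (hPV (mem_range_self (0 + 1))) _
      (hPV (mem_range_self 0)) (hs' 0)
    have e0 := hdin 0
    have e1 := hdin (0 + 1)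
    rw [real_inner_comm] at e0 e1
    rwa [apex_unique hV.sq_lt_one (hs' 0) e0 e1 r1 r2 (mul_pos (hdtr 0) r3)]
  have hnb := hV.range_eq_neighbours hn hPV hdV hdin
  refine ⟨hdV, hnb, ?_⟩
  have hside : ∀ i, triple d.1 (P.vertex i).1 (P.vertex (i + 1)).1 < 0 := by
    intro i
    have := hdtr i
    rw [triple_rotate, triple_swap]
    linarith
  rw [hH.closure_eq]
  ext x
  simp only [mem_iUnion, exists_prop, mem_ofPred_eq]
  constructor
  · intro hx
    obtain ⟨F, hF, hxF⟩ := hV.cover x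
    by_cases hdF : d ∈ F
    swap
    · exact ⟨F, ⟨hF, hdF⟩, hxF⟩
    obtain ⟨i, rfl⟩ := (hV.faces_at_center hs hdV hnb (Or.inr hside)).1 ⟨hF, hdF⟩
    obtain ⟨a, b, e, ha, hb, he, hxe⟩ := mem_centralProjection_triple.1 hxF
    -- In a face at `d = -o` the height is nonpositive, so `x` lies on an edge of `P` and also
    -- belongs to the face on the other side of that edge.
    have hHx : H x.1 = -a := by
      rw [hxe, hd, smul_neg, ← neg_smul, hH.comp _ _ _ _ hb he]
    have ha0 : a = 0 := by linarith
    obtain ⟨r, hr, r1, r2, r3⟩ := hV.third _ (hPV (mem_range_self i)) _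
      (hPV (mem_range_self (i + 1))) (hs i)
    refine ⟨{P.vertex i, P.vertex (i + 1), r}, ⟨mem_faces_triple hV.c_upper
      (hPV (mem_range_self _)) (hPV (mem_range_self _)) hr (hs i) r1 r2, ?_⟩,
      mem_centralProjection_triple.2 ⟨b, e, 0, hb, he, le_rfl, by rw [hxe, ha0]; simp⟩⟩
    rintro (h | h | h)
    · have := hdin i
      rw [h, inner_self_S2] at this; linarith [hV.c_upper]
    · have := hdin (i + 1)
      rw [h, inner_self_S2] at this; linarith [hV.c_upper]
    · rw [← mem_singleton_iff.1 h, triple_swap] at r3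
      linarith [hdtr i]
  · rintro ⟨F, ⟨hF, hdF⟩, hxF⟩
    by_contra! hneg
    -- A point of negative height is a combination of `d`, with positive coefficient, and two
    -- neighbours of `d`; so `u` is positive at it, but `u` is nonpositive on `F`.
    obtain ⟨u, hu1, hu2, hu3⟩ := hV.separation d hdV F hF hdF
    have h1 := inner_nonpos_of_mem_centralProjection hu3 hxF
    obtain ⟨i, b, e, hb, he, hxe⟩ := hH.decomp x.1
    have ho' : o.1 = -d.1 := by rw [hd, neg_neg]
    rw [hxe, ho', inner_add_right, inner_add_right, real_inner_smul_right, real_inner_smul_right,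
      real_inner_smul_right, inner_neg_right] at h1
    have m1 := mul_nonneg hb (hu2 _ (hnb ▸ mem_range_self i : P.vertex i ∈ neighbours V c d))
    have m2 := mul_nonneg he
      (hu2 _ (hnb ▸ mem_range_self (i + 1) : P.vertex (i + 1) ∈ neighbours V c d))
    nlinarith [mul_pos (neg_pos.2 hneg) hu1]

end IsDeltahedron

end SphTiling
end
noncomputable section
namespace SphTiling

/-! ### Coordinates in `ℤ[φ]` -/

/-- The integers `a + b φ`, as pairs. -/
abbrev ZPhi : Type := ℤ × ℤ

namespace ZPhi

/-- From `φ² = φ + 1`. -/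
def mul (x y : ZPhi) : ZPhi := (x.1 * y.1 + x.2 * y.2, x.1 * y.2 + x.2 * y.1 + x.2 * y.2)

/-- The scalar product of vectors over `ℤ[φ]`. -/
def dot (x y : ZPhi × ZPhi × ZPhi) : ZPhi :=
  mul x.1 y.1 + mul x.2.1 y.2.1 + mul x.2.2 y.2.2

/-- The vector product of vectors over `ℤ[φ]`. -/
def vprod (x y : ZPhi × ZPhi × ZPhi) : ZPhi × ZPhi × ZPhi :=
  (mul x.2.1 y.2.2 - mul x.2.2 y.2.1, mul x.2.2 y.1 - mul x.1 y.2.2, mul x.1 y.2.1 - mul x.2.1 y.1)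

def det (x y z : ZPhi × ZPhi × ZPhi) : ZPhi := dot (vprod x y) z

def smul (a : ZPhi) (x : ZPhi × ZPhi × ZPhi) : ZPhi × ZPhi × ZPhi :=
  (mul a x.1, mul a x.2.1, mul a x.2.2)

/-- The real number represented by a pair. -/
def val (x : ZPhi) : ℝ := x.1 + x.2 * Real.goldenRatio

theorem val_add (x y : ZPhi) : val (x + y) = val x + val y := by
  simp [val]; ring

theorem val_sub (x y : ZPhi) : val (x - y) = val x - val y := by
  simp [val]; ring

theorem val_mul (x y : ZPhi) : val (mul x y) = val x * val y := by
  simp only [val, mul]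
  push_cast
  linear_combination (-(x.2 * y.2 : ℝ)) * Real.goldenRatio_sq

/-- This is the irrationality of `φ`. It reduces equations between real coordinates to decidable
ones between integer pairs. -/
theorem val_injective : Function.Injective val := by
  intro x y h
  simp only [val] at h
  have h2 : x.2 = y.2 := by
    by_contra hne
    have hne' : (x.2 - y.2 : ℝ) ≠ 0 := sub_ne_zero.2 (by exact_mod_cast hne)
    have : Real.goldenRatio = ((y.1 - x.1 : ℚ) / (x.2 - y.2 : ℚ) : ℚ) := by
      push_cast
      rw [eq_div_iff hne']
      linarith
    exact Real.goldenRatio_irrational ⟨_, this.symm⟩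
  rw [h2] at h
  have h1 : (x.1 : ℝ) = y.1 := by linarith
  exact Prod.ext (by exact_mod_cast h1) h2

/-- The real vector represented by a vector over `ℤ[φ]`. -/
def vec (x : ZPhi × ZPhi × ZPhi) : E3 := !₂[val x.1, val x.2.1, val x.2.2]

theorem inner_vec (x y : ZPhi × ZPhi × ZPhi) : inner ℝ (vec x) (vec y) = val (dot x y) := by
  simp [inner_eq_coord, vec, dot, val_add, val_mul]

theorem triple_vec (x y z : ZPhi × ZPhi × ZPhi) :
    triple (vec x) (vec y) (vec z) = val (det x y z) := by
  simp [triple, vec, det, vprod, dot, val_add, val_sub, val_mul]; ring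

theorem vec_sub (x y : ZPhi × ZPhi × ZPhi) : vec (x - y) = vec x - vec y := by
  apply E3.ext' <;> simp [vec, val_sub]

theorem vec_smul (a : ZPhi) (x : ZPhi × ZPhi × ZPhi) : vec (smul a x) = val a • vec x := by
  apply E3.ext' <;> simp [vec, smul, val_mul]

end ZPhi

open ZPhi

/-- A finite set of unit vectors given by a table over `ℤ[φ]`: the vectors of the table have
length `N`, and `e` is the scalar product of adjacent ones. -/
structure IsTable {n : ℕ} (Z : Fin n → ZPhi × ZPhi × ZPhi) (N : ℝ) (V : Set S2) (c : ℝ) (e : ZPhi) :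
    Prop where
  N_pos : 0 < N
  mem_iff : ∀ x : S2, x ∈ V ↔ ∃ k, x.1 = N⁻¹ • vec (Z k)
  c_eq : c = val e / N ^ 2

namespace IsTable

variable {n : ℕ} {Z : Fin n → ZPhi × ZPhi × ZPhi} {N : ℝ} {V : Set S2} {c : ℝ} {e : ZPhi}

theorem inner_eq (h : IsTable Z N V c e) {x y : S2} {k l : Fin n} (hx : x.1 = N⁻¹ • vec (Z k))
    (hy : y.1 = N⁻¹ • vec (Z l)) : inner ℝ x.1 y.1 = val (dot (Z k) (Z l)) / N ^ 2 := by
  have := h.N_pos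
  rw [hx, hy, real_inner_smul_left, real_inner_smul_right, inner_vec]
  field_simp

theorem inner_eq_val_iff (h : IsTable Z N V c e) {x y : S2} {k l : Fin n}
    (hx : x.1 = N⁻¹ • vec (Z k)) (hy : y.1 = N⁻¹ • vec (Z l)) {f : ZPhi} :
    inner ℝ x.1 y.1 = val f / N ^ 2 ↔ dot (Z k) (Z l) = f := by
  have := h.N_pos
  rw [h.inner_eq hx hy]
  constructor
  · intro h1
    field_simp at h1
    exact val_injective h1
  · rintro rfl; rfl

theorem inner_eq_iff (h : IsTable Z N V c e) {x y : S2} {k l : Fin n}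
    (hx : x.1 = N⁻¹ • vec (Z k)) (hy : y.1 = N⁻¹ • vec (Z l)) :
    inner ℝ x.1 y.1 = c ↔ dot (Z k) (Z l) = e := by
  rw [h.c_eq, h.inner_eq_val_iff hx hy]

theorem triple_eq (h : IsTable Z N V c e) {x y z : S2} {k l m : Fin n}
    (hx : x.1 = N⁻¹ • vec (Z k)) (hy : y.1 = N⁻¹ • vec (Z l)) (hz : z.1 = N⁻¹ • vec (Z m)) :
    triple x.1 y.1 z.1 = val (det (Z k) (Z l) (Z m)) / N ^ 3 := by
  have := h.N_pos
  rw [hx, hy, hz, triple_smul_left, triple_smul_mid, triple_smul_right, triple_vec]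
  field_simp

/-- A vertex of the table. -/
theorem exists_vertex (h : IsTable Z N V c e) (hN : ∀ k, val (dot (Z k) (Z k)) = N ^ 2)
    (k : Fin n) : ∃ x ∈ V, x.1 = N⁻¹ • vec (Z k) := by
  have hpos := h.N_pos
  refine ⟨⟨N⁻¹ • vec (Z k), ?_⟩, (h.mem_iff _).2 ⟨k, rfl⟩, rfl⟩
  rw [mem_sphere_zero_iff_norm]
  apply norm_eq_one_of_inner
  rw [real_inner_smul_left, real_inner_smul_right, inner_vec, hN]
  field_simp

theorem finite (h : IsTable Z N V c e) : V.Finite := by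
  have : V ⊆ (fun x : S2 => x.1) ⁻¹' range fun k => N⁻¹ • vec (Z k) := by
    intro x hx
    obtain ⟨k, hk⟩ := (h.mem_iff x).1 hx
    exact ⟨k, hk.symm⟩
  exact ((finite_range _).preimage Subtype.val_injective.injOn).subset this

theorem ncard_neighbours_le (h : IsTable Z N V c e) {K : ℕ}
    (hZ : ∀ k, (Finset.univ.filter fun l => dot (Z k) (Z l) = e).card ≤ K) {a : S2} (ha : a ∈ V) :
    (neighbours V c a).ncard ≤ K := by
  obtain ⟨k, hk⟩ := (h.mem_iff a).1 ha
  have hex : ∀ w ∈ neighbours V c a, ∃ l, w.1 = N⁻¹ • vec (Z l) := fun w hw =>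
    (h.mem_iff w).1 hw.1
  rcases isEmpty_or_nonempty (Fin n) with hn | hn
  · exact (hn.false k).elim
  choose! f hf using hex
  refine le_trans ?_ (hZ k)
  rw [← Set.ncard_coe_finset]
  refine Set.ncard_le_ncard_of_injOn f ?_ ?_ (Finset.finite_toSet _)
  · intro w hw
    simp only [Finset.coe_filter, Finset.mem_univ, true_and, mem_ofPred_eq]
    exact (h.inner_eq_iff hk (hf w hw)).1 hw.2
  · intro w hw w' hw' hww
    apply Subtype.ext
    rw [hf w hw, hf w' hw', hww]

/-- The combinatorial conditions on the table that make it a deltahedron. The determinants that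
occur are `0`, `±D` and `±D'`. -/
theorem isDeltahedron (h : IsTable Z N V c e) (hN : ∀ k, val (dot (Z k) (Z k)) = N ^ 2)
    {K : ℕ} {D D' : ZPhi} (hc0 : -(1 / 2) < c) (hc1 : c < 1) (hD : 0 < val D) (hD' : 0 < val D')
    (h3 : ∀ k l, dot (Z k) (Z l) = e → ∃ m, dot (Z l) (Z m) = e ∧ dot (Z k) (Z m) = e ∧
      det (Z k) (Z l) (Z m) = D)
    (hK : ∀ k, (Finset.univ.filter fun l => dot (Z k) (Z l) = e).card ≤ K)
    (hsep : ∀ i j l, dot (Z i) (Z j) = e → dot (Z j) (Z l) = e → dot (Z i) (Z l) = e →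
      ∀ a, a ≠ i → a ≠ j → a ≠ l → ∃ p, dot (Z a) (Z p) = e ∧ ∃ q, det (Z p) (Z q) (Z a) = D ∧
        (∀ w, dot (Z a) (Z w) = e → det (Z p) (Z q) (Z w) = 0 ∨ det (Z p) (Z q) (Z w) = D ∨
          det (Z p) (Z q) (Z w) = D') ∧
        ∀ f, (f = i ∨ f = j ∨ f = l) → det (Z p) (Z q) (Z f) = 0 ∨
          det (Z p) (Z q) (Z f) = -D ∨ det (Z p) (Z q) (Z f) = -D')
    (hcov : ∀ x : S2, ∃ F ∈ faces V c, x ∈ centralProjection F) : IsDeltahedron V c K where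
  finite := h.finite
  c_lower := hc0
  c_upper := hc1
  third := by
    intro p hp q hq hpq
    obtain ⟨k, hk⟩ := (h.mem_iff p).1 hp
    obtain ⟨l, hl⟩ := (h.mem_iff q).1 hq
    obtain ⟨m, h1, h2, hd⟩ := h3 k l ((h.inner_eq_iff hk hl).1 hpq)
    obtain ⟨r, hr, hm⟩ := h.exists_vertex hN m
    refine ⟨r, hr, (h.inner_eq_iff hl hm).2 h1, (h.inner_eq_iff hk hm).2 h2, ?_⟩
    rw [h.triple_eq hk hl hm, hd]
    have := h.N_pos
    positivity
  ncard_neighbours_le a ha := h.ncard_neighbours_le hK ha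
  separation := by
    intro a ha F hF haF
    obtain ⟨x, hx⟩ := faces_nonempty hF
    obtain ⟨y, z, rfl, hxV, hyV, hzV, h1, h2, h3⟩ := exists_triple_of_mem_faces hF hx
    obtain ⟨k, hk⟩ := (h.mem_iff a).1 ha
    obtain ⟨i, hi⟩ := (h.mem_iff x).1 hxV
    obtain ⟨j, hj⟩ := (h.mem_iff y).1 hyV
    obtain ⟨l, hl⟩ := (h.mem_iff z).1 hzV
    have hne : ∀ {w : S2} {b : Fin n}, w ∈ ({x, y, z} : Set S2) → w.1 = N⁻¹ • vec (Z b) → k ≠ b := by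
      rintro w b hw hb rfl
      have : a = w := Subtype.ext (hk.trans hb.symm)
      exact haF (this ▸ hw)
    obtain ⟨p, -, q, hpos, hnn, hnp⟩ := hsep i j l ((h.inner_eq_iff hi hj).1 h1)
      ((h.inner_eq_iff hj hl).1 h2) ((h.inner_eq_iff hi hl).1 h3) k (hne (by simp) hi)
      (hne (by simp) hj) (hne (by simp) hl)
    have hNp := inv_pos.2 h.N_pos
    have hval : ∀ {w : S2} {b : Fin n}, w.1 = N⁻¹ • vec (Z b) →
        inner ℝ (cross (vec (Z p)) (vec (Z q))) w.1 = N⁻¹ * val (det (Z p) (Z q) (Z b)) := by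
      intro w b hb
      rw [inner_cross, hb, triple_smul_right, triple_vec]
    have hneg : ∀ x : ZPhi, val (-x) = -val x := by intro x; simp [val]; ring
    -- The separating plane passes through the origin and two vertices, so its functional takes
    -- values that are determinants in `ℤ[φ]`.
    refine ⟨cross (vec (Z p)) (vec (Z q)), ?_, ?_, ?_⟩
    · rw [hval hk, hpos]; positivity
    · rintro w ⟨hwV, hw⟩
      obtain ⟨b, hb⟩ := (h.mem_iff w).1 hwV
      rw [hval hb]
      rcases hnn b ((h.inner_eq_iff hk hb).1 hw) with h0 | h0 | h0 <;> rw [h0]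
      · simp [val]
      · positivity
      · positivity
    · have key : ∀ {w : S2} {b : Fin n}, w.1 = N⁻¹ • vec (Z b) → (b = i ∨ b = j ∨ b = l) →
          inner ℝ (cross (vec (Z p)) (vec (Z q))) w.1 ≤ (0 : ℝ) := by
        intro w b hb hbi
        rw [hval hb]
        rcases hnp b hbi with h0 | h0 | h0 <;> rw [h0]
        · simp [val]
        · rw [hneg]; have := mul_pos hNp hD; linarith
        · rw [hneg]; have := mul_pos hNp hD'; linarith
      rintro f (rfl | rfl | rfl)
      · exact key hi (Or.inl rfl)
      · exact key hj (Or.inr (Or.inl rfl))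
      · exact key hl (Or.inr (Or.inr rfl))
  cover := hcov

end IsTable

/-! ### The icosahedron -/

/-- The vertices of the icosahedron over `ℤ[φ]`. -/
def icoTable : Fin 12 → ZPhi × ZPhi × ZPhi := ![
  ((0, 0), (1, 0), (0, 1)), ((0, 0), (1, 0), (0, -1)),
  ((0, 0), (-1, 0), (0, 1)), ((0, 0), (-1, 0), (0, -1)),
  ((0, 1), (0, 0), (1, 0)), ((0, -1), (0, 0), (1, 0)),
  ((0, 1), (0, 0), (-1, 0)), ((0, -1), (0, 0), (-1, 0)),
  ((1, 0), (0, 1), (0, 0)), ((1, 0), (0, -1), (0, 0)),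
  ((-1, 0), (0, 1), (0, 0)), ((-1, 0), (0, -1), (0, 0))]

/-- Checked over all indices. `(0, 1)` is `φ`, the product of adjacent vectors, and `(2, 2)` is the
determinant of a positively oriented face. -/
theorem icoTable_third : ∀ k l, dot (icoTable k) (icoTable l) = (0, 1) →
    ∃ m, dot (icoTable l) (icoTable m) = (0, 1) ∧ dot (icoTable k) (icoTable m) = (0, 1) ∧
      det (icoTable k) (icoTable l) (icoTable m) = (2, 2) := by
  decide +kernel

theorem icoTable_neighbours : ∀ k,
    (Finset.univ.filter fun l => dot (icoTable k) (icoTable l) = (0, 1)).card ≤ 5 := by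
  decide +kernel

set_option synthInstance.maxHeartbeats 400000 in
set_option synthInstance.maxSize 1000 in
theorem icoTable_separation : ∀ i j l, dot (icoTable i) (icoTable j) = (0, 1) →
    dot (icoTable j) (icoTable l) = (0, 1) → dot (icoTable i) (icoTable l) = (0, 1) →
      ∀ a, a ≠ i → a ≠ j → a ≠ l → ∃ p, dot (icoTable a) (icoTable p) = (0, 1) ∧
        ∃ q, det (icoTable p) (icoTable q) (icoTable a) = (2, 2) ∧
        (∀ w, dot (icoTable a) (icoTable w) = (0, 1) →
          det (icoTable p) (icoTable q) (icoTable w) = 0 ∨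
          det (icoTable p) (icoTable q) (icoTable w) = (2, 2) ∨
          det (icoTable p) (icoTable q) (icoTable w) = (0, 2)) ∧
        ∀ f, (f = i ∨ f = j ∨ f = l) → det (icoTable p) (icoTable q) (icoTable f) = 0 ∨
          det (icoTable p) (icoTable q) (icoTable f) = -(2, 2) ∨
          det (icoTable p) (icoTable q) (icoTable f) = -(0, 2) := by
  decide +kernel

end SphTiling
end
noncomputable section
namespace SphTiling

open ZPhi

/-! ### Isometric copies -/

theorem sphereMap_symm_apply (L : E3 ≃ₗᵢ[ℝ] E3) (x : S2) :
    sphereMap L (sphereMap L.symm x) = x := by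
  apply Subtype.ext; simp

theorem inner_sphereMap (L : E3 ≃ₗᵢ[ℝ] E3) (x y : S2) :
    inner ℝ (sphereMap L x).1 (sphereMap L y).1 = (inner ℝ x.1 y.1 : ℝ) := inner_rot L _ _

theorem neighbours_image (L : E3 ≃ₗᵢ[ℝ] E3) (V : Set S2) (c : ℝ) (a : S2) :
    neighbours (sphereMap L '' V) c (sphereMap L a) = sphereMap L '' neighbours V c a := by
  ext x
  constructor
  · rintro ⟨⟨y, hy, rfl⟩, h⟩
    exact ⟨y, ⟨hy, by rwa [inner_sphereMap] at h⟩, rfl⟩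
  · rintro ⟨y, ⟨hy, h⟩, rfl⟩
    exact ⟨mem_image_of_mem _ hy, by rwa [inner_sphereMap]⟩

theorem image_mem_faces (L : E3 ≃ₗᵢ[ℝ] E3) {V : Set S2} {c : ℝ} {F : Set S2} (hF : F ∈ faces V c) :
    sphereMap L '' F ∈ faces (sphereMap L '' V) c := by
  refine ⟨image_mono hF.1, ?_, ?_⟩
  · rw [Set.ncard_image_of_injective _ (sphereMap L).injective, hF.2.1]
  · rintro _ ⟨x, hx, rfl⟩ _ ⟨y, hy, rfl⟩ hxy
    rw [inner_sphereMap]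
    exact hF.2.2 x hx y hy fun h => hxy (by rw [h])

theorem mem_faces_image (L : E3 ≃ₗᵢ[ℝ] E3) {V : Set S2} {c : ℝ} {F : Set S2} :
    F ∈ faces (sphereMap L '' V) c ↔ ∃ G ∈ faces V c, F = sphereMap L '' G := by
  constructor
  · intro hF
    have h := image_mem_faces L.symm hF
    have hV : sphereMap L.symm '' (sphereMap L '' V) = V := by
      have hid : (fun y => sphereMap L.symm (sphereMap L y)) = id := by
        ext y : 1; apply Subtype.ext; simp
      rw [image_image, hid, image_id]
    rw [hV] at h
    refine ⟨_, h, ?_⟩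
    rw [image_image]
    simp only [sphereMap_symm_apply, image_id']
  · rintro ⟨G, hG, rfl⟩
    exact image_mem_faces L hG

theorem centralProjection_image (L : E3 ≃ₗᵢ[ℝ] E3) (F : Set S2) :
    centralProjection (sphereMap L '' F) = sphereMap L '' centralProjection F := by
  have hsub : ∀ (M : E3 ≃ₗᵢ[ℝ] E3) (G : Set S2) (x : S2), x ∈ centralProjection G →
      sphereMap M x ∈ centralProjection (sphereMap M '' G) := by
    rintro M G x ⟨t, ht, hx⟩
    refine ⟨t, ht, ?_⟩
    have h1 : (Subtype.val '' (sphereMap M '' G) : Set E3) =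
        M.toLinearEquiv.toLinearMap '' (Subtype.val '' G) := by
      rw [image_image, image_image]; rfl
    rw [h1, ← LinearMap.image_convexHull]
    exact ⟨_, hx, by simp⟩
  apply Subset.antisymm
  · intro x hx
    have := hsub L.symm _ x hx
    rw [image_image] at this
    have hid : (fun y => sphereMap L.symm (sphereMap L y)) = id := by
      ext y : 1; apply Subtype.ext; simp
    rw [hid, image_id] at this
    exact ⟨_, this, sphereMap_symm_apply L x⟩
  · rintro _ ⟨x, hx, rfl⟩
    exact hsub L F x hx

/-- `L` has to preserve orientation because `third` prescribes a side. -/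
theorem IsDeltahedron.image {V : Set S2} {c : ℝ} {K : ℕ} (h : IsDeltahedron V c K)
    {L : E3 ≃ₗᵢ[ℝ] E3} (hL : IsRot L) : IsDeltahedron (sphereMap L '' V) c K where
  finite := h.finite.image _
  c_lower := h.c_lower
  c_upper := h.c_upper
  third := by
    rintro _ ⟨p, hp, rfl⟩ _ ⟨q, hq, rfl⟩ hpq
    rw [inner_sphereMap] at hpq
    obtain ⟨r, hr, h1, h2, h3⟩ := h.third p hp q hq hpq
    refine ⟨sphereMap L r, mem_image_of_mem _ hr, ?_, ?_, ?_⟩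
    · rwa [inner_sphereMap]
    · rwa [inner_sphereMap]
    · rw [sphereMap_val, sphereMap_val, sphereMap_val, hL]; exact h3
  ncard_neighbours_le := by
    rintro _ ⟨a, ha, rfl⟩
    rw [neighbours_image, Set.ncard_image_of_injective _ (sphereMap L).injective]
    exact h.ncard_neighbours_le a ha
  separation := by
    rintro _ ⟨a, ha, rfl⟩ F hF haF
    obtain ⟨G, hG, rfl⟩ := (mem_faces_image L).1 hF
    obtain ⟨u, h1, h2, h3⟩ := h.separation a ha G hG fun h' => haF (mem_image_of_mem _ h')
    refine ⟨L u, ?_, ?_, ?_⟩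
    · rwa [sphereMap_val, inner_rot]
    · rw [neighbours_image]
      rintro _ ⟨w, hw, rfl⟩
      rw [sphereMap_val, inner_rot]
      exact h2 w hw
    · rintro _ ⟨f, hf, rfl⟩
      rw [sphereMap_val, inner_rot]
      exact h3 f hf
  cover := by
    intro x
    obtain ⟨F, hF, hx⟩ := h.cover (sphereMap L.symm x)
    refine ⟨_, image_mem_faces L hF, ?_⟩
    rw [centralProjection_image]
    exact ⟨_, hx, sphereMap_symm_apply L x⟩

/-! ### The icosahedron -/

/-- The length of the vectors `icoVector`. -/
def icoNorm : ℝ := √(Real.goldenRatio + 2)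

theorem icoNorm_pos : 0 < icoNorm := Real.sqrt_pos.2 (by linarith [Real.goldenRatio_pos])

theorem icoNorm_sq : icoNorm ^ 2 = Real.goldenRatio + 2 :=
  Real.sq_sqrt (by linarith [Real.goldenRatio_pos])

theorem units_cast_sq (s : ℤˣ) : ((s : ℤ) : ℝ) * ((s : ℤ) : ℝ) = 1 := by
  rcases Int.units_eq_one_or s with rfl | rfl <;> simp

theorem inner_icoVector_self (i : Fin 3) (s t : ℤˣ) :
    inner ℝ (icoVector i s t) (icoVector i s t) = Real.goldenRatio + 2 := by
  have hs := units_cast_sq s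
  have ht := units_cast_sq t
  rw [inner_eq_coord]
  fin_cases i <;> simp [icoVector] <;>
    linear_combination hs + Real.goldenRatio ^ 2 * ht + Real.goldenRatio_sq

theorem norm_icoVector (i : Fin 3) (s t : ℤˣ) : ‖icoVector i s t‖ = icoNorm := by
  have h := inner_icoVector_self i s t
  rw [real_inner_self_eq_norm_sq, ← icoNorm_sq] at h
  exact (sq_eq_sq₀ (norm_nonneg _) icoNorm_pos.le).1 h

theorem icoVertex_val (i : Fin 3) (s t : ℤˣ) :
    (icoVertex i s t).1 = icoNorm⁻¹ • icoVector i s t := by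
  rw [← norm_icoVector i s t]; rfl

theorem icoVector_eq_vec (i : Fin 3) (s t : ℤˣ) : ∃ k, icoVector i s t = vec (icoTable k) := by
  rcases Int.units_eq_one_or s with rfl | rfl <;> rcases Int.units_eq_one_or t with rfl | rfl <;>
    fin_cases i
  · exact ⟨0, by apply E3.ext' <;> simp [icoVector, vec, icoTable, val]⟩
  · exact ⟨4, by apply E3.ext' <;> simp [icoVector, vec, icoTable, val]⟩
  · exact ⟨8, by apply E3.ext' <;> simp [icoVector, vec, icoTable, val]⟩
  · exact ⟨1, by apply E3.ext' <;> simp [icoVector, vec, icoTable, val]⟩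
  · exact ⟨5, by apply E3.ext' <;> simp [icoVector, vec, icoTable, val]⟩
  · exact ⟨9, by apply E3.ext' <;> simp [icoVector, vec, icoTable, val]⟩
  · exact ⟨2, by apply E3.ext' <;> simp [icoVector, vec, icoTable, val]⟩
  · exact ⟨6, by apply E3.ext' <;> simp [icoVector, vec, icoTable, val]⟩
  · exact ⟨10, by apply E3.ext' <;> simp [icoVector, vec, icoTable, val]⟩
  · exact ⟨3, by apply E3.ext' <;> simp [icoVector, vec, icoTable, val]⟩
  · exact ⟨7, by apply E3.ext' <;> simp [icoVector, vec, icoTable, val]⟩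
  · exact ⟨11, by apply E3.ext' <;> simp [icoVector, vec, icoTable, val]⟩

theorem vec_icoTable (k : Fin 12) : ∃ i s t, vec (icoTable k) = icoVector i s t := by
  fin_cases k
  · exact ⟨0, 1, 1, by apply E3.ext' <;> simp [icoVector, vec, icoTable, val]⟩
  · exact ⟨0, 1, -1, by apply E3.ext' <;> simp [icoVector, vec, icoTable, val]⟩
  · exact ⟨0, -1, 1, by apply E3.ext' <;> simp [icoVector, vec, icoTable, val]⟩
  · exact ⟨0, -1, -1, by apply E3.ext' <;> simp [icoVector, vec, icoTable, val]⟩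
  · exact ⟨1, 1, 1, by apply E3.ext' <;> simp [icoVector, vec, icoTable, val]⟩
  · exact ⟨1, 1, -1, by apply E3.ext' <;> simp [icoVector, vec, icoTable, val]⟩
  · exact ⟨1, -1, 1, by apply E3.ext' <;> simp [icoVector, vec, icoTable, val]⟩
  · exact ⟨1, -1, -1, by apply E3.ext' <;> simp [icoVector, vec, icoTable, val]⟩
  · exact ⟨2, 1, 1, by apply E3.ext' <;> simp [icoVector, vec, icoTable, val]⟩
  · exact ⟨2, 1, -1, by apply E3.ext' <;> simp [icoVector, vec, icoTable, val]⟩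
  · exact ⟨2, -1, 1, by apply E3.ext' <;> simp [icoVector, vec, icoTable, val]⟩
  · exact ⟨2, -1, -1, by apply E3.ext' <;> simp [icoVector, vec, icoTable, val]⟩

theorem goldenRatio_div_icoNorm_sq : Real.goldenRatio / icoNorm ^ 2 = 1 / √5 := by
  have h5 : √5 * √5 = 5 := Real.mul_self_sqrt (by norm_num)
  have := Real.goldenRatio_pos
  rw [icoNorm_sq, div_eq_div_iff (by positivity) (by positivity)]
  unfold Real.goldenRatio
  linear_combination h5 / 2

theorem isTable_ico : IsTable icoTable icoNorm icoVertices (1 / √5) (0, 1) where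
  N_pos := icoNorm_pos
  mem_iff x := by
    constructor
    · rintro ⟨i, s, t, rfl⟩
      obtain ⟨k, hk⟩ := icoVector_eq_vec i s t
      exact ⟨k, by rw [icoVertex_val, hk]⟩
    · rintro ⟨k, hk⟩
      obtain ⟨i, s, t, h⟩ := vec_icoTable k
      exact ⟨i, s, t, Subtype.ext (by rw [hk, h, icoVertex_val])⟩
  c_eq := by rw [← goldenRatio_div_icoNorm_sq]; simp [val]

theorem icoTable_norm (k : Fin 12) :
    val (dot (icoTable k) (icoTable k)) = icoNorm ^ 2 := by
  obtain ⟨i, s, t, h⟩ := vec_icoTable k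
  rw [← inner_vec, h, inner_icoVector_self, icoNorm_sq]

theorem inner_icoVertex_of_inner {i j : Fin 3} {s t s' t' : ℤˣ}
    (h : inner ℝ (icoVector i s t) (icoVector j s' t') = Real.goldenRatio) :
    inner ℝ (icoVertex i s t).1 (icoVertex j s' t').1 = 1 / √5 := by
  have := icoNorm_pos
  rw [icoVertex_val, icoVertex_val, real_inner_smul_left, real_inner_smul_right, h,
    ← goldenRatio_div_icoNorm_sq]
  field_simp

theorem inner_icoVertex_neg (i : Fin 3) (s t : ℤˣ) :
    inner ℝ (icoVertex i s t).1 (icoVertex i (-s) t).1 = 1 / √5 := by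
  apply inner_icoVertex_of_inner
  have hs := units_cast_sq s
  have ht := units_cast_sq t
  rw [inner_eq_coord]
  fin_cases i <;> simp [icoVector] <;>
    linear_combination -hs + Real.goldenRatio ^ 2 * ht + Real.goldenRatio_sq

theorem inner_icoVertex_succ (i : Fin 3) (s t u : ℤˣ) :
    inner ℝ (icoVertex i s t).1 (icoVertex (i + 1) t u).1 = 1 / √5 := by
  apply inner_icoVertex_of_inner
  have ht := units_cast_sq t
  rw [inner_eq_coord]
  fin_cases i <;> simp [icoVector] <;> linear_combination Real.goldenRatio * ht

theorem exists_unit_mul_abs (x : ℝ) : ∃ s : ℤˣ, x = ((s : ℤ) : ℝ) * |x| := by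
  rcases le_total 0 x with h | h
  · exact ⟨1, by rw [abs_of_nonneg h]; simp⟩
  · exact ⟨-1, by rw [abs_of_nonpos h]; simp⟩

theorem icoVertex_mem (i : Fin 3) (s t : ℤˣ) : icoVertex i s t ∈ icoVertices := ⟨i, s, t, rfl⟩

theorem one_div_sqrt_five_bounds : -(1 / 2) < 1 / √5 ∧ 1 / √5 < 1 := by
  have := sqrt_five_bounds
  rw [SphericalPolygon.inv_sqrt_five]
  constructor <;> linarith

/-- By the signs `σ` one may think of the positive octant. It is divided among the central face,
with one vertex from each golden rectangle, and three faces bisected by the coordinate planes. The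
inequality in the case distinction is the failure of one barycentric coordinate with respect to the
central face to be positive. -/
theorem icoVertices_cover (x : S2) :
    ∃ F ∈ faces icoVertices (1 / √5), x ∈ centralProjection F := by
  have hc := one_div_sqrt_five_bounds.2
  have hN := icoNorm_pos
  have hφ := Real.goldenRatio_pos
  have hφ1 := Real.one_lt_goldenRatio
  have hφ2 := Real.goldenRatio_sq
  have hNN : icoNorm * icoNorm⁻¹ = 1 := mul_inv_cancel₀ hN.ne'
  choose σ hσ using fun i : Fin 3 => exists_unit_mul_abs (x.1 i)
  have hy : ∀ i, 0 ≤ |x.1 i| := fun i => abs_nonneg _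
  set y : Fin 3 → ℝ := fun i => |x.1 i| with hydef
  have hσ : ∀ i, x.1 i = ((σ i : ℤ) : ℝ) * y i := hσ
  have hy : ∀ i, 0 ≤ y i := hy
  clear_value y
  by_cases hpart : ∃ i : Fin 3, y i + Real.goldenRatio ^ 2 * y (i + 1) ≤
      Real.goldenRatio * y (i + 2)
  · obtain ⟨i, hi⟩ := hpart
    refine ⟨{icoVertex i (σ (i + 1)) (σ (i + 2)), icoVertex i (-σ (i + 1)) (σ (i + 2)),
      icoVertex (i + 1) (σ (i + 2)) (σ i)}, mem_faces_triple hc (icoVertex_mem _ _ _)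
      (icoVertex_mem _ _ _) (icoVertex_mem _ _ _) (inner_icoVertex_neg _ _ _)
      (inner_icoVertex_succ _ _ _ _) (inner_icoVertex_succ _ _ _ _), ?_⟩
    rw [mem_centralProjection_triple]
    have h0 := hy i
    have h1 := hy (i + 1)
    refine ⟨icoNorm * (((y (i + 2) - y i / Real.goldenRatio) / Real.goldenRatio + y (i + 1)) / 2),
      icoNorm * (((y (i + 2) - y i / Real.goldenRatio) / Real.goldenRatio - y (i + 1)) / 2),
      icoNorm * (y i / Real.goldenRatio), ?_, ?_, by positivity, ?_⟩
    · have e : (y (i + 2) - y i / Real.goldenRatio) / Real.goldenRatio =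
        (Real.goldenRatio * y (i + 2) - y i) / Real.goldenRatio ^ 2 := by field_simp
      have : 0 ≤ (Real.goldenRatio * y (i + 2) - y i) / Real.goldenRatio ^ 2 := by
        apply div_nonneg _ (by positivity)
        nlinarith [mul_nonneg (sq_nonneg Real.goldenRatio) h1]
      rw [e]; positivity
    · have e : (y (i + 2) - y i / Real.goldenRatio) / Real.goldenRatio - y (i + 1) =
        (Real.goldenRatio * y (i + 2) - (y i + Real.goldenRatio ^ 2 * y (i + 1))) /
          Real.goldenRatio ^ 2 := by field_simp; ring
      rw [e]
      have : 0 ≤ (Real.goldenRatio * y (i + 2) - (y i + Real.goldenRatio ^ 2 * y (i + 1))) /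
          Real.goldenRatio ^ 2 := div_nonneg (by linarith) (by positivity)
      positivity
    · simp only [icoVertex_val, smul_smul]
      fin_cases i
      · apply E3.ext' <;> rw [hσ] <;> simp [icoVector] <;> field_simp <;> ring
      · apply E3.ext' <;> rw [hσ] <;> simp [icoVector] <;> field_simp <;> ring
      · apply E3.ext' <;> rw [hσ] <;> simp [icoVector] <;> field_simp <;> ring
  · push Not at hpart
    refine ⟨{icoVertex 0 (σ 1) (σ 2), icoVertex 1 (σ 2) (σ 0), icoVertex 2 (σ 0) (σ 1)},
      mem_faces_triple hc (icoVertex_mem _ _ _)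
      (icoVertex_mem _ _ _) (icoVertex_mem _ _ _) (inner_icoVertex_succ 0 _ _ _)
      (inner_icoVertex_succ 1 _ _ _) (by
        rw [real_inner_comm]; exact inner_icoVertex_succ 2 _ _ _), ?_⟩
    rw [mem_centralProjection_triple]
    have p0 := hpart 0
    have p1 := hpart 1
    have p2 := hpart 2
    simp only [zero_add, show (1 : Fin 3) + 1 = 2 from rfl, show (1 : Fin 3) + 2 = 0 from rfl,
      show (2 : Fin 3) + 1 = 0 from rfl, show (2 : Fin 3) + 2 = 1 from rfl] at p0 p1 p2
    have hD : (0 : ℝ) < 2 * Real.goldenRatio ^ 2 := by positivity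
    refine ⟨icoNorm * ((y 1 + Real.goldenRatio ^ 2 * y 2 - Real.goldenRatio * y 0) /
        (2 * Real.goldenRatio ^ 2)),
      icoNorm * ((y 2 + Real.goldenRatio ^ 2 * y 0 - Real.goldenRatio * y 1) /
        (2 * Real.goldenRatio ^ 2)),
      icoNorm * ((y 0 + Real.goldenRatio ^ 2 * y 1 - Real.goldenRatio * y 2) /
        (2 * Real.goldenRatio ^ 2)),
      mul_nonneg hN.le (div_nonneg (by linarith) hD.le),
      mul_nonneg hN.le (div_nonneg (by linarith) hD.le),
      mul_nonneg hN.le (div_nonneg (by linarith) hD.le), ?_⟩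
    have h5 : √5 ^ 2 = 5 := Real.sq_sqrt (by norm_num)
    simp only [icoVertex_val, smul_smul]
    apply E3.ext'
    · rw [hσ]; simp [icoVector]; field_simp
      linear_combination (y 1 - y 0) * h5
    · rw [hσ]; simp [icoVector]; field_simp
      linear_combination (y 2 - y 1) * h5
    · rw [hσ]; simp [icoVector]; field_simp
      linear_combination (y 0 - y 2) * h5

theorem isDeltahedron_ico : IsDeltahedron icoVertices (1 / √5) 5 :=
  isTable_ico.isDeltahedron icoTable_norm one_div_sqrt_five_bounds.1 one_div_sqrt_five_bounds.2
    (D := (2, 2)) (D' := (0, 2)) (by have := Real.goldenRatio_pos; simp only [val]; push_cast; positivity)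
    (by have := Real.goldenRatio_pos; simp only [val]; push_cast; positivity)
    icoTable_third icoTable_neighbours icoTable_separation icoVertices_cover

/-! ### The octahedron -/

/-- The vertices of the octahedron. -/
def octTable : Fin 6 → ZPhi × ZPhi × ZPhi := ![
  ((1, 0), (0, 0), (0, 0)), ((-1, 0), (0, 0), (0, 0)),
  ((0, 0), (1, 0), (0, 0)), ((0, 0), (-1, 0), (0, 0)),
  ((0, 0), (0, 0), (1, 0)), ((0, 0), (0, 0), (-1, 0))]

theorem octTable_third : ∀ k l, dot (octTable k) (octTable l) = (0, 0) →
    ∃ m, dot (octTable l) (octTable m) = (0, 0) ∧ dot (octTable k) (octTable m) = (0, 0) ∧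
      det (octTable k) (octTable l) (octTable m) = (1, 0) := by
  decide +kernel

theorem octTable_neighbours : ∀ k,
    (Finset.univ.filter fun l => dot (octTable k) (octTable l) = (0, 0)).card ≤ 4 := by
  decide +kernel

set_option synthInstance.maxHeartbeats 400000 in
set_option synthInstance.maxSize 1000 in
theorem octTable_separation : ∀ i j l, dot (octTable i) (octTable j) = (0, 0) →
    dot (octTable j) (octTable l) = (0, 0) → dot (octTable i) (octTable l) = (0, 0) →
      ∀ a, a ≠ i → a ≠ j → a ≠ l → ∃ p, dot (octTable a) (octTable p) = (0, 0) ∧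
        ∃ q, det (octTable p) (octTable q) (octTable a) = (1, 0) ∧
        (∀ w, dot (octTable a) (octTable w) = (0, 0) →
          det (octTable p) (octTable q) (octTable w) = 0 ∨
          det (octTable p) (octTable q) (octTable w) = (1, 0) ∨
          det (octTable p) (octTable q) (octTable w) = (1, 0)) ∧
        ∀ f, (f = i ∨ f = j ∨ f = l) → det (octTable p) (octTable q) (octTable f) = 0 ∨
          det (octTable p) (octTable q) (octTable f) = -(1, 0) ∨
          det (octTable p) (octTable q) (octTable f) = -(1, 0) := by
  decide +kernel

theorem octVertex_eq_vec (i : Fin 3) (s : ℤˣ) : ∃ k, (octVertex i s).1 = vec (octTable k) := by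
  rcases Int.units_eq_one_or s with rfl | rfl <;> fin_cases i
  · exact ⟨0, by apply E3.ext' <;> simp [octVertex, vec, octTable, val]⟩
  · exact ⟨2, by apply E3.ext' <;> simp [octVertex, vec, octTable, val]⟩
  · exact ⟨4, by apply E3.ext' <;> simp [octVertex, vec, octTable, val]⟩
  · exact ⟨1, by apply E3.ext' <;> simp [octVertex, vec, octTable, val]⟩
  · exact ⟨3, by apply E3.ext' <;> simp [octVertex, vec, octTable, val]⟩
  · exact ⟨5, by apply E3.ext' <;> simp [octVertex, vec, octTable, val]⟩

theorem vec_octTable (k : Fin 6) : ∃ i s, vec (octTable k) = (octVertex i s).1 := by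
  fin_cases k
  · exact ⟨0, 1, by apply E3.ext' <;> simp [octVertex, vec, octTable, val]⟩
  · exact ⟨0, -1, by apply E3.ext' <;> simp [octVertex, vec, octTable, val]⟩
  · exact ⟨1, 1, by apply E3.ext' <;> simp [octVertex, vec, octTable, val]⟩
  · exact ⟨1, -1, by apply E3.ext' <;> simp [octVertex, vec, octTable, val]⟩
  · exact ⟨2, 1, by apply E3.ext' <;> simp [octVertex, vec, octTable, val]⟩
  · exact ⟨2, -1, by apply E3.ext' <;> simp [octVertex, vec, octTable, val]⟩

theorem isTable_oct : IsTable octTable 1 octVertices 0 (0, 0) where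
  N_pos := one_pos
  mem_iff x := by
    constructor
    · rintro ⟨i, s, rfl⟩
      obtain ⟨k, hk⟩ := octVertex_eq_vec i s
      exact ⟨k, by rw [hk]; simp⟩
    · rintro ⟨k, hk⟩
      obtain ⟨i, s, h⟩ := vec_octTable k
      exact ⟨i, s, Subtype.ext (by rw [hk, h]; simp)⟩
  c_eq := by simp [val]

theorem octTable_norm (k : Fin 6) : val (dot (octTable k) (octTable k)) = 1 ^ 2 := by
  obtain ⟨i, s, h⟩ := vec_octTable k
  rw [← inner_vec, h, inner_self_S2]; norm_num

theorem octVertex_mem (i : Fin 3) (s : ℤˣ) : octVertex i s ∈ octVertices := ⟨i, s, rfl⟩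

theorem inner_octVertex {i j : Fin 3} (hij : i ≠ j) (s t : ℤˣ) :
    inner ℝ (octVertex i s).1 (octVertex j t).1 = (0 : ℝ) := by
  rw [inner_eq_coord]
  fin_cases i <;> fin_cases j <;> simp [octVertex] at hij ⊢

/-- The face is the octant of `x`, and the absolute values of the coordinates are the coefficients.
-/
theorem octVertices_cover (x : S2) : ∃ F ∈ faces octVertices 0, x ∈ centralProjection F := by
  choose σ hσ using fun i : Fin 3 => exists_unit_mul_abs (x.1 i)
  refine ⟨{octVertex 0 (σ 0), octVertex 1 (σ 1), octVertex 2 (σ 2)},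
    mem_faces_triple one_pos (octVertex_mem _ _) (octVertex_mem _ _) (octVertex_mem _ _)
    (inner_octVertex (by decide) _ _) (inner_octVertex (by decide) _ _)
    (inner_octVertex (by decide) _ _), ?_⟩
  rw [mem_centralProjection_triple]
  refine ⟨|x.1 0|, |x.1 1|, |x.1 2|, abs_nonneg _, abs_nonneg _, abs_nonneg _, ?_⟩
  apply E3.ext'
  · conv_lhs => rw [hσ]
    simp [octVertex]; ring
  · conv_lhs => rw [hσ]
    simp [octVertex]; ring
  · conv_lhs => rw [hσ]
    simp [octVertex]; ring

theorem isDeltahedron_oct : IsDeltahedron octVertices 0 4 :=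
  isTable_oct.isDeltahedron octTable_norm (by norm_num) one_pos (D := (1, 0)) (D' := (1, 0))
    (by simp [val]) (by simp [val]) octTable_third octTable_neighbours octTable_separation
    octVertices_cover

end SphTiling
end
noncomputable section
namespace SphTiling

/-! ### Tiles made of faces -/

theorem ZMod.eq_of_three {n : ℕ} (hn : n = 3) (i : ZMod n) : i = 0 ∨ i = 1 ∨ i = 2 := by
  subst hn
  revert i
  decide

/-- `V` contains with the end points of an edge `p q` of length given by `c` also the end point of
the edge of the same length that continues it with interior angle `α` on the left. -/
def ContainsTurns (V : Set S2) (c α : ℝ) : Prop :=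
  ∀ p ∈ V, ∀ q ∈ V, inner ℝ p.1 q.1 = c → ∀ x : S2, inner ℝ q.1 x.1 = c →
    inner ℝ p.1 x.1 = c ^ 2 + (1 - c ^ 2) * Real.cos α →
    triple p.1 q.1 x.1 = (1 - c ^ 2) * Real.sin α → x ∈ V

namespace SphericalPolygon

variable {P : SphericalPolygon} {c α r h : ℝ} {L : E3 ≃ₗᵢ[ℝ] E3}

theorem Model.inner_center (hM : P.Model c α r h L) (i : ZMod P.n) :
    inner ℝ (modelCenter L).1 (P.vertex i).1 = h := by
  rw [hM.vertex_val, modelCenter_val, inner_rot, inner_eq_coord]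
  simp [modelVertex]

theorem range_vertex_of_three (hn : P.n = 3) :
    range P.vertex = {P.vertex 0, P.vertex (0 + 1), P.vertex (0 + 1 + 1)} := by
  have h2 : (0 + 1 + 1 : ZMod P.n) = 2 := by ring
  rw [h2, zero_add]
  ext x
  constructor
  · rintro ⟨i, rfl⟩
    rcases ZMod.eq_of_three hn i with rfl | rfl | rfl <;> simp
  · rintro (rfl | rfl | rfl) <;> exact mem_range_self _

theorem succ_three (hn : P.n = 3) : (0 + 1 + 1 + 1 : ZMod P.n) = 0 := by
  have h3 : ((3 : ℕ) : ZMod P.n) = 0 := (ZMod.natCast_eq_zero_iff 3 P.n).2 (by rw [hn])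
  push_cast at h3
  calc (0 + 1 + 1 + 1 : ZMod P.n) = 3 := by ring
    _ = 0 := h3

theorem Model.sq_of_three (hM : P.Model c α r h L) (hn : P.n = 3) : 3 * h ^ 2 = 1 + 2 * c := by
  have h1 := hM.r_eq
  rw [hn] at h1
  push_cast at h1
  rw [mul_pow, Real.sin_pi_div_three, div_pow, Real.sq_sqrt (by norm_num)] at h1
  linarith [hM.sq_add_sq]

/-- The difference of the two sides has square norm `3 + 6 c - 9 h²`, which is zero. -/
theorem Model.sum_of_three (hM : P.Model c α r h L) (hn : P.n = 3)
    (hs : ∀ i, inner ℝ (P.vertex i).1 (P.vertex (i + 1)).1 = c) :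
    (P.vertex 0).1 + (P.vertex (0 + 1)).1 + (P.vertex (0 + 1 + 1)).1 =
      (3 * h) • (modelCenter L).1 := by
  have h0 := hs 0
  have h1 := hs (0 + 1)
  have h2 := hs (0 + 1 + 1)
  rw [succ_three hn] at h2
  have o0 := hM.inner_center 0
  have o1 := hM.inner_center (0 + 1)
  have o2 := hM.inner_center (0 + 1 + 1)
  have hsq := hM.sq_of_three hn
  rw [← sub_eq_zero, ← @inner_self_eq_zero ℝ]
  generalize P.vertex 0 = x at *
  generalize P.vertex (0 + 1) = y at *
  generalize P.vertex (0 + 1 + 1) = z at *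
  have g0 := h0
  have g1 := h1
  have g2 := h2
  have q0 := o0
  have q1 := o1
  have q2 := o2
  rw [real_inner_comm] at g0 g1 g2 q0 q1 q2
  simp only [inner_sub_left, inner_sub_right, inner_add_left, inner_add_right,
    real_inner_smul_left, real_inner_smul_right, inner_self_S2, h0, h1, h2, o0, o1, o2, g0, g1, g2,
    q0, q1, q2]
  linear_combination (-3 : ℝ) * hsq

/-- A regular triangle with small angles is a face. -/
theorem Model.triangle (hM : P.Model c α r h L) (hn : P.n = 3) (hh : 0 < h)
    (hs : ∀ i, inner ℝ (P.vertex i).1 (P.vertex (i + 1)).1 = c) (hc : c < 1) {V : Set S2}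
    (hPV : range P.vertex ⊆ V) :
    range P.vertex ∈ faces V c ∧ closure P.region = centralProjection (range P.vertex) := by
  have h2 := hs (0 + 1 + 1)
  rw [succ_three hn] at h2
  rw [range_vertex_of_three hn]
  refine ⟨mem_faces_triple hc (hPV (mem_range_self _)) (hPV (mem_range_self _))
    (hPV (mem_range_self _)) (hs 0) (hs _) (by rw [real_inner_comm]; exact h2), ?_⟩
  obtain ⟨H, hH⟩ := hM.exists_starShaped
  have hsum := hM.sum_of_three hn hs
  -- The height in terms of the sum of the three vertices, a positive multiple of the centre.
  have key : ∀ (i : ZMod P.n) (a b e : ℝ), 0 ≤ b → 0 ≤ e →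
      H (a • ((P.vertex 0).1 + (P.vertex (0 + 1)).1 + (P.vertex (0 + 1 + 1)).1) +
        b • (P.vertex i).1 + e • (P.vertex (i + 1)).1) = a * (3 * h) := by
    intro i a b e hb he
    rw [hsum, smul_smul, hH.comp _ _ _ _ hb he]
  rw [hH.closure_eq]
  ext x
  rw [mem_centralProjection_triple, mem_ofPred_eq]
  constructor
  · intro hx
    obtain ⟨i, b, e, hb, he, hxe⟩ := hH.decomp x.1
    have ho : (modelCenter L).1 = (3 * h)⁻¹ •
        ((P.vertex 0).1 + (P.vertex (0 + 1)).1 + (P.vertex (0 + 1 + 1)).1) := by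
      rw [hsum, smul_smul, inv_mul_cancel₀ (by positivity), one_smul]
    rw [ho, smul_smul] at hxe
    set a := H x.1 * (3 * h)⁻¹
    have ha : 0 ≤ a := mul_nonneg hx (by positivity)
    have h012 : (i = 0) ∨ (i = 0 + 1) ∨ i = 0 + 1 + 1 := by
      have h2 : (0 + 1 + 1 : ZMod P.n) = 2 := by ring
      rw [h2, zero_add]
      exact ZMod.eq_of_three hn i
    rcases h012 with rfl | rfl | rfl
    · exact ⟨a + b, a + e, a, by positivity, by positivity, ha, by rw [hxe]; module⟩
    · exact ⟨a, a + b, a + e, ha, by positivity, by positivity, by rw [hxe]; module⟩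
    · rw [succ_three hn] at hxe
      exact ⟨a + e, a, a + b, by positivity, ha, by positivity, by rw [hxe]; module⟩
  · rintro ⟨a, b, e, ha, hb, he, hx⟩
    have fin : ∀ {m : ℝ}, 0 ≤ m → H x.1 = m * (3 * h) → 0 ≤ H x.1 := fun hm h' => by
      rw [h']; positivity
    -- Splitting off the smallest coefficient times the sum of the vertices leaves a combination of
    -- two consecutive vertices, so that coefficient gives the height.
    rcases le_total a b with hab | hab
    · rcases le_total a e with hae | hae
      · refine fin ha ?_
        rw [hx, ← key (0 + 1) a (b - a) (e - a) (by linarith) (by linarith)]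
        congr 1; module
      · refine fin he ?_
        rw [hx, ← key 0 e (a - e) (b - e) (by linarith) (by linarith)]
        congr 1; module
    · rcases le_total b e with hae | hae
      · refine fin hb ?_
        rw [hx, ← key (0 + 1 + 1) b (e - b) (a - b) (by linarith) (by linarith), succ_three hn]
        congr 1; module
      · refine fin he ?_
        rw [hx, ← key 0 e (a - e) (b - e) (by linarith) (by linarith)]
        congr 1; module

/-- If two consecutive vertices of a polygon lie in `V`, so do all vertices, provided that `V` is
closed under continuing an edge with the angle of the polygon. -/
theorem HasShape.range_subset (hs : P.HasShape c α) {V : Set S2} (hV : ContainsTurns V c α)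
    {j : ZMod P.n} (h0 : P.vertex j ∈ V) (h1 : P.vertex (j + 1) ∈ V) : range P.vertex ⊆ V := by
  have key : ∀ k : ℕ, P.vertex (j + k) ∈ V ∧ P.vertex (j + k + 1) ∈ V := by
    intro k
    induction k with
    | zero => simpa using ⟨h0, h1⟩
    | succ k ih =>
      have h2 := hs.inner_two (j + k)
      have e : (j + k + 2 : ZMod P.n) = j + k + 1 + 1 := by ring
      rw [e] at h2
      push_cast
      rw [← add_assoc]
      exact ⟨ih.2, hV _ ih.1 _ ih.2 (hs.1 _) _ (hs.1 _) h2.1 h2.2⟩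
  rintro _ ⟨i, rfl⟩
  have : NeZero P.n := ⟨by have := P.three_le; omega⟩
  have h := (key (i - j).val).1
  rwa [ZMod.natCast_zmod_val, add_sub_cancel] at h

end SphericalPolygon

theorem ContainsTurns.image {V : Set S2} {c α : ℝ} (h : ContainsTurns V c α) {L : E3 ≃ₗᵢ[ℝ] E3}
    (hL : IsRot L) : ContainsTurns (sphereMap L '' V) c α := by
  rintro _ ⟨p, hp, rfl⟩ _ ⟨q, hq, rfl⟩ hpq x h1 h2 h3
  obtain ⟨y, rfl⟩ : ∃ y, x = sphereMap L y := ⟨_, (sphereMap_symm_apply L x).symm⟩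
  rw [inner_sphereMap] at hpq h1 h2
  rw [sphereMap_val, sphereMap_val, sphereMap_val, hL] at h3
  exact mem_image_of_mem _ (h p hp q hq hpq y h1 h2 h3)

/-- The equation says that `α` is the angle of the equilateral triangle with edge cosine `c`, so the
next point is the apex on the left. -/
theorem IsDeltahedron.containsTurns {V : Set S2} {c : ℝ} {k : ℕ} (hV : IsDeltahedron V c k)
    {α : ℝ} (hα : (1 + c) * Real.cos α = c) (hsin : 0 < Real.sin α) : ContainsTurns V c α := by
  intro p hp q hq hpq x h1 h2 h3
  obtain ⟨r, hr, r1, r2, r3⟩ := hV.third p hp q hq hpq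
  have hx : inner ℝ p.1 x.1 = c := by rw [h2]; linear_combination (1 - c) * hα
  rw [apex_unique hV.sq_lt_one hpq h1 hx r1 r2]
  · exact hr
  · rw [h3]
    have : 0 < 1 - c ^ 2 := by linarith [hV.sq_lt_one]
    positivity

end SphTiling
end
noncomputable section
namespace SphTiling

open ZPhi

/-! ### The possible tiles -/

/-- The inner products determine the point up to reflection in the plane of `p` and `q`. The sign of
`s` encodes the side, so that left and right turns are handled together. -/
theorem IsDeltahedron.containsTurns_of_exists {V : Set S2} {c : ℝ} {k : ℕ}
    (hV : IsDeltahedron V c k) {α s : ℝ} (hs : 0 < s * Real.sin α)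
    (h : ∀ p ∈ V, ∀ q ∈ V, inner ℝ p.1 q.1 = c → ∃ r ∈ V, inner ℝ q.1 r.1 = c ∧
      inner ℝ p.1 r.1 = c ^ 2 + (1 - c ^ 2) * Real.cos α ∧ 0 < s * triple p.1 q.1 r.1) :
    ContainsTurns V c α := by
  intro p hp q hq hpq x h1 h2 h3
  obtain ⟨r, hr, r1, r2, r3⟩ := h p hp q hq hpq
  have hc : 0 < 1 - c ^ 2 := by linarith [hV.sq_lt_one]
  suffices x = r by rwa [this]
  apply Subtype.ext
  refine eq_of_inner_of_triple (norm_eq_of_mem_sphere p) (norm_eq_of_mem_sphere q)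
    (by rw [hpq]; exact hV.sq_lt_one) (h2.trans r2.symm) (h1.trans r1.symm) ?_
  have e := triple_sq_unit (norm_eq_of_mem_sphere p) (norm_eq_of_mem_sphere q)
    (norm_eq_of_mem_sphere x)
  rw [hpq, h1, h2, ← r2] at e
  have e' := triple_sq_unit (norm_eq_of_mem_sphere p) (norm_eq_of_mem_sphere q)
    (norm_eq_of_mem_sphere r)
  rw [hpq, r1] at e'
  rw [← e'] at e
  rcases sq_eq_sq_iff_eq_or_eq_neg.1 e with e | e
  · exact e
  · have h4 : s * triple p.1 q.1 r.1 = -((1 - c ^ 2) * (s * Real.sin α)) := by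
      rw [← neg_eq_iff_eq_neg.2 e, h3]; ring
    nlinarith [mul_pos hc hs]

/-- From a directed edge one can continue along a pentagon of the icosahedron on the left or on the
right; `(0, -1)` is the product of vertices at distance two. -/
theorem icoTable_next : ∀ k l, dot (icoTable k) (icoTable l) = (0, 1) →
    (∃ m, dot (icoTable l) (icoTable m) = (0, 1) ∧ dot (icoTable k) (icoTable m) = (0, -1) ∧
      det (icoTable k) (icoTable l) (icoTable m) = (0, 2)) ∧
    ∃ m, dot (icoTable l) (icoTable m) = (0, 1) ∧ dot (icoTable k) (icoTable m) = (0, -1) ∧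
      det (icoTable k) (icoTable l) (icoTable m) = (0, -2) := by
  decide +kernel

theorem val_neg (x : ZPhi) : val (-x) = -val x := by simp [val]; ring

theorem inv_sqrt_five_sq : (1 / √5 : ℝ) ^ 2 = 1 / 5 := by
  rw [div_pow, Real.sq_sqrt (by norm_num)]; norm_num

theorem ico_next {p q : S2} (hp : p ∈ icoVertices) (hq : q ∈ icoVertices)
    (hpq : inner ℝ p.1 q.1 = 1 / √5) {s : ℝ} (hs : s = 1 ∨ s = -1) :
    ∃ r ∈ icoVertices, inner ℝ q.1 r.1 = 1 / √5 ∧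
      inner ℝ p.1 r.1 = -(1 / √5) ∧ 0 < s * triple p.1 q.1 r.1 := by
  have h := isTable_ico
  have hN := icoNorm_pos
  have hφ := Real.goldenRatio_pos
  obtain ⟨k, hk⟩ := (h.mem_iff p).1 hp
  obtain ⟨l, hl⟩ := (h.mem_iff q).1 hq
  have hneg : -(1 / √5) = val (0, -1) / icoNorm ^ 2 := by
    rw [h.c_eq, show ((0, -1) : ZPhi) = -(0, 1) from rfl, val_neg, neg_div]
  obtain ⟨⟨m, m1, m2, m3⟩, m', m1', m2', m3'⟩ := icoTable_next k l ((h.inner_eq_iff hk hl).1 hpq)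
  rw [hneg]
  rcases hs with rfl | rfl
  · obtain ⟨r, hr, hm⟩ := h.exists_vertex icoTable_norm m
    refine ⟨r, hr, (h.inner_eq_iff hl hm).2 m1, (h.inner_eq_val_iff hk hm).2 m2, ?_⟩
    rw [h.triple_eq hk hl hm, m3]
    have : 0 < val (0, 2) := by simp only [val]; push_cast; positivity
    positivity
  · obtain ⟨r, hr, hm⟩ := h.exists_vertex icoTable_norm m'
    refine ⟨r, hr, (h.inner_eq_iff hl hm).2 m1', (h.inner_eq_val_iff hk hm).2 m2', ?_⟩
    rw [h.triple_eq hk hl hm, m3', show ((0, -2) : ZPhi) = -(0, 2) from rfl, val_neg]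
    have : 0 < val (0, 2) := by simp only [val]; push_cast; positivity
    rw [neg_div, mul_neg, neg_one_mul, neg_neg]
    positivity

theorem cos_six_pi_div_five : Real.cos (6 * Real.pi / 5) = -(1 + √5) / 4 := by
  rw [show 6 * Real.pi / 5 = 2 * Real.pi - 4 * Real.pi / 5 by ring, Real.cos_two_pi_sub,
    cos_four_pi_div_five]

/-- `4π/5` and `6π/5` have the same cosine, which leads to the inner product `-1/√5`; they differ in
the side to which they turn. -/
theorem icoVertices_containsTurns {α : ℝ}
    (hα : α = 2 * Real.pi / 5 ∨ α = 4 * Real.pi / 5 ∨ α = 6 * Real.pi / 5) :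
    ContainsTurns icoVertices (1 / √5) α := by
  have hpi := Real.pi_pos
  have h5 : √5 ^ 2 = 5 := Real.sq_sqrt (by norm_num)
  have e : (1 / √5 : ℝ) ^ 2 + (1 - (1 / √5) ^ 2) * (-(1 + √5) / 4) = -(1 / √5) := by
    rw [inv_sqrt_five_sq, SphericalPolygon.inv_sqrt_five]; ring
  rcases hα with rfl | rfl | rfl
  · refine isDeltahedron_ico.containsTurns ?_ (Real.sin_pos_of_pos_of_lt_pi (by linarith)
      (by linarith))
    rw [cos_two_pi_div_five, SphericalPolygon.inv_sqrt_five]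
    linear_combination h5 / 20
  · refine isDeltahedron_ico.containsTurns_of_exists (s := 1) ?_ ?_
    · rw [one_mul]
      exact Real.sin_pos_of_pos_of_lt_pi (by linarith) (by linarith)
    · intro p hp q hq hpq
      rw [cos_four_pi_div_five, e]
      exact ico_next hp hq hpq (Or.inl rfl)
  · refine isDeltahedron_ico.containsTurns_of_exists (s := -1) ?_ ?_
    · rw [show 6 * Real.pi / 5 = 2 * Real.pi - 4 * Real.pi / 5 by ring, Real.sin_two_pi_sub,
        neg_one_mul, neg_neg]
      exact Real.sin_pos_of_pos_of_lt_pi (by linarith) (by linarith)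
    · intro p hp q hq hpq
      rw [cos_six_pi_div_five, e]
      exact ico_next hp hq hpq (Or.inr rfl)

theorem eq_neg_of_inner_eq_neg_one {p x : S2} (h : inner ℝ p.1 x.1 = (-1 : ℝ)) : x.1 = -p.1 := by
  rw [← sub_eq_zero, ← @inner_self_eq_zero ℝ, sub_neg_eq_add]
  have h' := h
  rw [real_inner_comm] at h'
  simp only [inner_add_left, inner_add_right, inner_self_S2, h, h']
  norm_num

theorem neg_mem_octVertices {p x : S2} (hp : p ∈ octVertices) (h : x.1 = -p.1) :
    x ∈ octVertices := by
  obtain ⟨i, s, rfl⟩ := hp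
  refine ⟨i, -s, Subtype.ext ?_⟩
  rw [h]
  simp [octVertex]

/-- Going straight on by two quarter circles leads to the antipode. -/
theorem octVertices_containsTurns {α : ℝ} (hα : α = Real.pi / 2 ∨ α = Real.pi) :
    ContainsTurns octVertices 0 α := by
  rcases hα with rfl | rfl
  · exact isDeltahedron_oct.containsTurns (by simp) (by simp)
  · intro p hp q hq hpq x h1 h2 h3
    rw [Real.cos_pi] at h2
    exact neg_mem_octVertices hp (eq_neg_of_inner_eq_neg_one (by rw [h2]; norm_num))

/-- The tiles that can be made of faces: a single face, the cap of all faces at a vertex, and the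
complement of a cap, where the angle of the last is `β`. If `β = π` there are no tiles of the
second kind. -/
inductive IsBlock (V : Set S2) (c β : ℝ) (P : SphericalPolygon) : Prop
  | face : range P.vertex ∈ faces V c → closure P.region = centralProjection (range P.vertex) →
      IsBlock V c β P
  | cap (d : S2) : d ∈ V → range P.vertex = neighbours V c d → closure P.region =
      ⋃ F ∈ {F | F ∈ faces V c ∧ d ∈ F}, centralProjection F → P.angle 0 = 2 * Real.pi - β →
      Real.pi < β → IsBlock V c β P
  | cocap (d : S2) : d ∈ V → range P.vertex = neighbours V c d → closure P.region =
      ⋃ F ∈ {F | F ∈ faces V c ∧ d ∉ F}, centralProjection F → P.angle 0 = β →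
      IsBlock V c β P

theorem neg_center (o : S2) : ∃ d : S2, d.1 = -o.1 :=
  ⟨⟨-o.1, by rw [mem_sphere_zero_iff_norm, norm_neg]; exact norm_eq_of_mem_sphere o⟩, rfl⟩

/-- For a pentagon `r² = 4/5`, so `h = ±1/√5`: the centre or its antipode has inner product `1/√5`
with all corners and is therefore a vertex of `V`. The sign comes from `α`. -/
theorem IsDeltahedron.isBlock_ico {V : Set S2} (hV : IsDeltahedron V (1 / √5) 5)
    {P : SphericalPolygon} (hs : P.HasShape (1 / √5) (P.angle 0)) (hPV : range P.vertex ⊆ V)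
    (hP : (P.n = 3 ∧ P.angle 0 = 2 * Real.pi / 5) ∨
      (P.n = 5 ∧ (P.angle 0 = 4 * Real.pi / 5 ∨ P.angle 0 = 6 * Real.pi / 5))) :
    IsBlock V (1 / √5) (6 * Real.pi / 5) P := by
  have hpi := Real.pi_pos
  obtain ⟨r, h, L, hM⟩ := hs.model
  rcases hP with ⟨hn, hα⟩ | ⟨hn, hα⟩
  · have hh : 0 < h := by
      rw [hM.h_pos, hα]
      exact Real.cos_pos_of_mem_Ioo ⟨by linarith, by linarith⟩
    obtain ⟨h1, h2⟩ := hM.triangle hn hh hs.1 hV.c_upper hPV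
    exact .face h1 h2
  · obtain ⟨H, hH⟩ := hM.exists_starShaped
    have hsin : Real.sin (Real.pi / 5) ^ 2 = (5 - √5) / 8 := by
      rw [Real.sin_sq, Real.cos_pi_div_five]
      have h5 : √5 ^ 2 = 5 := Real.sq_sqrt (by norm_num)
      linear_combination -h5 / 16
    have hsq : h ^ 2 = (1 / √5) ^ 2 := by
      have h1 := hM.r_eq
      rw [hn] at h1
      push_cast at h1
      rw [mul_pow, hsin, SphericalPolygon.inv_sqrt_five] at h1
      have h2 : (r ^ 2 - 4 / 5) * (5 - √5) = 0 := by linear_combination 4 * h1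
      have h3 : (5 - √5) ≠ 0 := by have := sqrt_five_bounds.2; intro h; linarith
      have h4 := (mul_eq_zero.1 h2).resolve_right h3
      rw [inv_sqrt_five_sq]
      linarith [hM.sq_add_sq]
    have hpos : (0 : ℝ) < 1 / √5 := by positivity
    rcases hα with hα | hα
    · have hh : 0 < h := by
        rw [hM.h_pos, hα]
        exact Real.cos_pos_of_mem_Ioo ⟨by linarith, by linarith⟩
      have hc : h = 1 / √5 := by
        rcases sq_eq_sq_iff_eq_or_eq_neg.1 hsq with e | e
        · exact e
        · linarith
      obtain ⟨h1, h2, h3⟩ := hV.closure_eq_of_center_mem hn hs.1 hPV hH fun i => by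
        rw [hM.inner_center, hc]
      exact .cap _ h1 h2 h3 (by rw [hα]; ring) (by linarith)
    · have hh : h < 0 := by
        rw [hM.h_neg, hα]
        exact Real.cos_neg_of_pi_div_two_lt_of_lt (by linarith) (by linarith)
      have hc : h = -(1 / √5) := by
        rcases sq_eq_sq_iff_eq_or_eq_neg.1 hsq with e | e
        · linarith
        · exact e
      obtain ⟨d, hd⟩ := neg_center (modelCenter L)
      obtain ⟨h1, h2, h3⟩ := hV.closure_eq_of_neg_center_mem hn hs.1 hPV hd hH fun i => by
        rw [hM.inner_center, hc]
      exact .cocap _ h1 h2 h3 hα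

/-- A square has `h = 0` and is a hemisphere. It is counted as the complement of the opposite
hemisphere, so that caps do not occur. -/
theorem IsDeltahedron.isBlock_oct {V : Set S2} (hV : IsDeltahedron V 0 4)
    {P : SphericalPolygon} (hs : P.HasShape 0 (P.angle 0)) (hPV : range P.vertex ⊆ V)
    (hP : (P.n = 3 ∧ P.angle 0 = Real.pi / 2) ∨ (P.n = 4 ∧ P.angle 0 = Real.pi)) :
    IsBlock V 0 Real.pi P := by
  have hpi := Real.pi_pos
  obtain ⟨r, h, L, hM⟩ := hs.model
  rcases hP with ⟨hn, hα⟩ | ⟨hn, hα⟩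
  · have hh : 0 < h := by
      rw [hM.h_pos, hα]
      exact Real.cos_pos_of_mem_Ioo ⟨by linarith, by linarith⟩
    obtain ⟨h1, h2⟩ := hM.triangle hn hh hs.1 hV.c_upper hPV
    exact .face h1 h2
  · obtain ⟨H, hH⟩ := hM.exists_starShaped
    have hc : h = -0 := by
      have h1 := hM.h_eq
      rw [hα, hn] at h1
      push_cast at h1
      rw [mul_pow, Real.sin_pi_div_four, Real.cos_pi, div_pow, Real.sq_sqrt (by norm_num)] at h1
      have : h ^ 2 = 0 := by linarith
      simpa using this
    obtain ⟨d, hd⟩ := neg_center (modelCenter L)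
    obtain ⟨h1, h2, h3⟩ := hV.closure_eq_of_neg_center_mem hn hs.1 hPV hd hH fun i => by
      rw [hM.inner_center, hc]
    exact .cocap _ h1 h2 h3 hα

end SphTiling
end
noncomputable section
namespace SphTiling

/-! ### Tilings by blocks -/

/-- Start from the face to the left of `p q` with apex `r` and cross its edge `p r`; the new apex
lies on the other side of that edge from `q`. -/
theorem IsDeltahedron.exists_face_avoiding {V : Set S2} {c : ℝ} {k : ℕ} (hV : IsDeltahedron V c k)
    {p q : S2} (hp : p ∈ V) (hq : q ∈ V) (hpq : inner ℝ p.1 q.1 = c) :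
    ∃ F ∈ faces V c, p ∈ F ∧ q ∉ F := by
  obtain ⟨r, hr, r1, r2, r3⟩ := hV.third p hp q hq hpq
  obtain ⟨s, hs, s1, s2, s3⟩ := hV.third p hp r hr r2
  refine ⟨{p, r, s}, mem_faces_triple hV.c_upper hp hr hs r2 s1 s2, by simp, ?_⟩
  rintro (h | h | h)
  · exact ne_of_inner_eq hV.c_upper hpq h.symm
  · exact ne_of_inner_eq hV.c_upper r1 h
  · rw [← mem_singleton_iff.1 h, triple_rotate, triple_swap, triple_rotate, triple_rotate] at s3
    rw [triple_rotate, triple_rotate] at r3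
    rw [triple_rotate] at r3
    linarith

/-- Some face at `w` avoids `d'`; by hypothesis it contains `d`, so `w` and `d` are adjacent. -/
theorem eq_of_mem_neighbours_of_notMem {V : Set S2} {c : ℝ} {k : ℕ} (hV : IsDeltahedron V c k)
    {d d' w : S2} (hd' : d' ∈ V) (h : ∀ F ∈ faces V c, d' ∉ F → d ∈ F)
    (hw : w ∈ neighbours V c d') (hwd : w ≠ d) : w ∈ neighbours V c d := by
  obtain ⟨F, hF, hwF, hdF⟩ := hV.exists_face_avoiding hw.1 hd'
    (by rw [real_inner_comm]; exact hw.2)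
  exact ⟨hw.1, hF.2.2 d (h F hF hdF) w hwF hwd.symm⟩

/-- Otherwise `d` would be adjacent to `d'`, and some face at `d'` avoids any given neighbour. -/
theorem IsDeltahedron.eq_of_faces_subset {V : Set S2} {c : ℝ} {k : ℕ} (hV : IsDeltahedron V c k)
    {d d' : S2} (hd' : d' ∈ V) (hne : (neighbours V c d').Nonempty)
    (h : ∀ F ∈ faces V c, d' ∈ F → d ∈ F) : d' = d := by
  by_contra hdd
  obtain ⟨x, hx⟩ := hne
  obtain ⟨r, hr, r1, r2, r3⟩ := hV.third d' hd' x hx.1 hx.2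
  have hF := mem_faces_triple hV.c_upper hd' hx.1 hr hx.2 r1 r2
  have hdF := h _ hF (by simp)
  obtain ⟨G, hG, h1, h2⟩ := hV.exists_face_avoiding hd' (hF.1 hdF)
    (hF.2.2 _ (by simp) _ hdF hdd)
  exact h2 (h G hG h1)

namespace SphericalTiling

variable {T : SphericalTiling} {V : Set S2} {c β m : ℝ} {k : ℕ}

/-- The tile `P` is the union of the faces in `C`. -/
def IsUnionOf (V : Set S2) (c : ℝ) (P : SphericalPolygon) (C : Set (Set S2)) : Prop :=
  C ⊆ faces V c ∧ closure P.region = ⋃ F ∈ C, centralProjection F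

theorem isUnionOf_singleton {P : SphericalPolygon} (h1 : range P.vertex ∈ faces V c)
    (h2 : closure P.region = centralProjection (range P.vertex)) :
    IsUnionOf V c P {range P.vertex} :=
  ⟨by simpa using h1, by simpa using h2⟩

theorem isUnionOf_sep {P : SphericalPolygon} {p : Set S2 → Prop}
    (h : closure P.region = ⋃ F ∈ {F | F ∈ faces V c ∧ p F}, centralProjection F) :
    IsUnionOf V c P {F | F ∈ faces V c ∧ p F} :=
  ⟨fun _ hF => hF.1, h⟩

/-- Take the tile through an inner point of `F`. That point lies in no other face, so `F` occurs
however the tile is written as a union of faces. -/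
theorem exists_tile_of_face (hV : IsDeltahedron V c k) {F : Set S2} (hF : F ∈ faces V c) :
    ∃ P ∈ T.tiles, ∀ C, IsUnionOf V c P C → F ∈ C := by
  obtain ⟨x, hx⟩ := hV.exists_innerPoint hF
  have : x ∈ ⋃ P ∈ T.tiles, closure P.region := by rw [T.cover]; trivial
  simp only [mem_iUnion, exists_prop] at this
  obtain ⟨P, hP, hxP⟩ := this
  refine ⟨P, hP, fun C hC => ?_⟩
  rw [hC.2] at hxP
  simp only [mem_iUnion, exists_prop] at hxP
  obtain ⟨G, hG, hxG⟩ := hxP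
  rwa [hV.eq_of_innerPoint_mem hF (hC.1 hG) hx hxG]

/-- Otherwise an inner point of the common face would lie on an edge of `P`. -/
theorem tile_unique (hV : IsDeltahedron V c k)
    (hs : ∀ P ∈ T.tiles, range P.vertex ⊆ V ∧
      ∀ i, inner ℝ (P.vertex i).1 (P.vertex (i + 1)).1 = c)
    {P Q : SphericalPolygon} (hP : P ∈ T.tiles) (hQ : Q ∈ T.tiles) {C D : Set (Set S2)}
    (hC : IsUnionOf V c P C) (hD : IsUnionOf V c Q D) {F : Set S2} (hFC : F ∈ C) (hFD : F ∈ D) :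
    P = Q := by
  by_contra hPQ
  obtain ⟨x, hx⟩ := hV.exists_innerPoint (hC.1 hFC)
  have h := T.mem_boundary_of_mem_closure hP hQ hPQ
    (by rw [hC.2]; exact mem_biUnion hFC hx.1) (by rw [hD.2]; exact mem_biUnion hFD hx.1)
  obtain ⟨i, hi⟩ := mem_iUnion.1 h
  exact hV.innerPoint_notMem_arc (hC.1 hFC) hx ((hs P hP).1 (mem_range_self _))
    ((hs P hP).1 (mem_range_self _)) ((hs P hP).2 i) hi

theorem nonempty_neighbours {P : SphericalPolygon} {d : S2}
    (h : range P.vertex = neighbours V c d) : (neighbours V c d).Nonempty :=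
  h ▸ range_nonempty _

/-- Next to the complement of a cap there is only room for the faces of the cap. -/
theorem face_of_cocap (hV : IsDeltahedron V c k) (hreg : T.IsRegular)
    (hdeg : ∀ v ∈ T.vertices, 3 ≤ T.degree v) (hm0 : 0 < m) (hm : ∀ P ∈ T.tiles, m ≤ P.angle 0)
    (hβ : Real.pi ≤ β)
    (hs : ∀ P ∈ T.tiles, range P.vertex ⊆ V ∧
      ∀ i, inner ℝ (P.vertex i).1 (P.vertex (i + 1)).1 = c)
    (hb : ∀ P ∈ T.tiles, IsBlock V c β P) {P Q : SphericalPolygon} (hP : P ∈ T.tiles) {d : S2}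
    (hr : range P.vertex = neighbours V c d)
    (hcl : closure P.region = ⋃ F ∈ {F | F ∈ faces V c ∧ d ∉ F}, centralProjection F)
    (hα : P.angle 0 = β) (hQ : Q ∈ T.tiles) (hPQ : P ≠ Q) :
    range Q.vertex ∈ faces V c ∧ closure Q.region = centralProjection (range Q.vertex) ∧
      d ∈ range Q.vertex := by
  have hcells : ∀ D, IsUnionOf V c Q D → ∀ F ∈ D, d ∈ F := by
    intro D hD F hF
    by_contra hdF
    exact hPQ (tile_unique hV hs hP hQ (isUnionOf_sep hcl) hD ⟨hD.1 hF, hdF⟩ hF)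
  rcases hb Q hQ with ⟨h1, h2⟩ | ⟨d', hd', h1, h2, h3, -⟩ | ⟨d', hd', h1, h2, h3⟩
  · exact ⟨h1, h2, hcells _ (isUnionOf_singleton h1 h2) _ rfl⟩
  -- The cap of `Q` would be the one at `d`, with the same corners as `P`. The angles `β` and `2π -
  -- β` then fill a vertex and leave no third tile.
  · have hdd := hV.eq_of_faces_subset hd' (nonempty_neighbours h1) fun F hF hdF =>
      hcells _ (isUnionOf_sep h2) F ⟨hF, hdF⟩
    rw [hdd, ← hr] at h1
    have := angle_add_angle_add_le hreg hdeg hm hP hQ hPQ (mem_range_self 0)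
      (h1 ▸ mem_range_self 0)
    linarith
  -- For a second complement of a cap, a corner of `Q` other than `d` is also a corner of `P`, and
  -- two angles `β ≥ π` leave no room for a third.
  · exfalso
    have hne : Q.vertex 0 ≠ Q.vertex (0 + 1) :=
      ne_of_inner_eq hV.c_upper ((hs Q hQ).2 0)
    obtain ⟨i, hi⟩ : ∃ i, Q.vertex i ≠ d := by
      by_contra! hall
      exact hne ((hall _).trans (hall _).symm)
    have hw := eq_of_mem_neighbours_of_notMem hV hd' (fun F hF hdF =>
      hcells _ (isUnionOf_sep h2) F ⟨hF, hdF⟩) (h1 ▸ mem_range_self i) hi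
    rw [← hr] at hw
    have := angle_add_angle_add_le hreg hdeg hm hP hQ hPQ hw (mem_range_self i)
    linarith

/-- A tiling by blocks with the complement of a cap is a pyramid. -/
theorem pieces_eq_pyramid (hV : IsDeltahedron V c k) (hreg : T.IsRegular)
    (hdeg : ∀ v ∈ T.vertices, 3 ≤ T.degree v) (hm0 : 0 < m) (hm : ∀ P ∈ T.tiles, m ≤ P.angle 0)
    (hβ : Real.pi ≤ β)
    (hs : ∀ P ∈ T.tiles, range P.vertex ⊆ V ∧
      ∀ i, inner ℝ (P.vertex i).1 (P.vertex (i + 1)).1 = c)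
    (hb : ∀ P ∈ T.tiles, IsBlock V c β P) {P : SphericalPolygon} (hP : P ∈ T.tiles) {d : S2}
    (hr : range P.vertex = neighbours V c d)
    (hcl : closure P.region = ⋃ F ∈ {F | F ∈ faces V c ∧ d ∉ F}, centralProjection F)
    (hα : P.angle 0 = β) : SphericalPolygon.piece '' T.tiles = pyramid V c d := by
  have hface : ∀ {Q}, Q ∈ T.tiles → P ≠ Q → _ := fun hQ hPQ =>
    face_of_cocap hV hreg hdeg hm0 hm hβ hs hb hP hr hcl hα hQ hPQ
  have hpiece : P.piece = (neighbours V c d,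
      ⋃ F ∈ {F | F ∈ faces V c ∧ d ∉ F}, centralProjection F) := by
    rw [SphericalPolygon.piece, hr, hcl]
  apply Subset.antisymm
  · rintro _ ⟨Q, hQ, rfl⟩
    by_cases hPQ : P = Q
    · rw [← hPQ, hpiece]
      exact Or.inr rfl
    · obtain ⟨h1, h2, h3⟩ := hface hQ hPQ
      exact Or.inl ⟨_, h1, h3, by rw [SphericalPolygon.piece, h2]⟩
  · rintro _ (⟨F, hF, hdF, rfl⟩ | h)
    · obtain ⟨Q, hQ, hFQ⟩ := exists_tile_of_face (T := T) hV hF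
      have hPQ : P ≠ Q := by
        rintro rfl
        exact (hFQ _ (isUnionOf_sep hcl)).2 hdF
      obtain ⟨h1, h2, h3⟩ := hface hQ hPQ
      have hFr : F = range Q.vertex := hFQ _ (isUnionOf_singleton h1 h2)
      exact ⟨Q, hQ, by rw [SphericalPolygon.piece, h2, hFr]⟩
    · rw [mem_singleton_iff.1 h, ← hpiece]
      exact mem_image_of_mem _ hP

/-- A tiling by faces and caps is obtained by deleting an independent set of vertices. -/
theorem pieces_eq_deleteVertices {p : Prop} (hV : IsDeltahedron V c k)
    (hs : ∀ P ∈ T.tiles, range P.vertex ⊆ V ∧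
      ∀ i, inner ℝ (P.vertex i).1 (P.vertex (i + 1)).1 = c)
    {D : Set S2} (hD : D = {d | d ∈ V ∧ ∃ P ∈ T.tiles, range P.vertex = neighbours V c d ∧
      closure P.region = ⋃ F ∈ {F | F ∈ faces V c ∧ d ∈ F}, centralProjection F ∧ p})
    (hb : ∀ P ∈ T.tiles, (range P.vertex ∈ faces V c ∧
        closure P.region = centralProjection (range P.vertex)) ∨
      ∃ d ∈ V, range P.vertex = neighbours V c d ∧
        closure P.region = ⋃ F ∈ {F | F ∈ faces V c ∧ d ∈ F}, centralProjection F ∧ p) :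
    SphericalPolygon.piece '' T.tiles = deleteVertices V c D ∧
      ∀ a ∈ D, ∀ b ∈ D, inner ℝ a.1 b.1 ≠ c := by
  have hself : ∀ d, d ∉ neighbours V c d := by
    intro d hd
    have := hd.2
    rw [inner_self_S2] at this
    linarith [hV.c_upper]
  refine ⟨Subset.antisymm ?_ ?_, ?_⟩
  · rintro _ ⟨P, hP, rfl⟩
    rcases hb P hP with ⟨h1, h2⟩ | ⟨d, hd, h1, h2, hp⟩
    · refine Or.inl ⟨_, h1, ?_, by rw [SphericalPolygon.piece, h2]⟩
      rw [Set.disjoint_left]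
      intro d hdP hdD
      rw [hD] at hdD
      obtain ⟨-, Q, hQ, q1, q2, -⟩ := hdD
      have hPQ := tile_unique hV hs hP hQ (isUnionOf_singleton h1 h2) (isUnionOf_sep q2) rfl
        ⟨h1, hdP⟩
      rw [hPQ, q1] at hdP
      exact hself d hdP
    · refine Or.inr ⟨d, ?_, by rw [SphericalPolygon.piece, h1, h2]⟩
      rw [hD]
      exact ⟨hd, P, hP, h1, h2, hp⟩
  · rintro _ (⟨F, hF, hdF, rfl⟩ | ⟨d, hd, rfl⟩)
    · obtain ⟨Q, hQ, hFQ⟩ := exists_tile_of_face (T := T) hV hF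
      rcases hb Q hQ with ⟨h1, h2⟩ | ⟨d, hd, h1, h2, hp⟩
      · have hFr : F = range Q.vertex := hFQ _ (isUnionOf_singleton h1 h2)
        exact ⟨Q, hQ, by rw [SphericalPolygon.piece, h2, hFr]⟩
      · refine absurd (hFQ _ (isUnionOf_sep h2)).2 fun hmem => ?_
        refine Set.disjoint_left.1 hdF hmem ?_
        rw [hD]
        exact ⟨hd, Q, hQ, h1, h2, hp⟩
    · rw [hD] at hd
      obtain ⟨-, Q, hQ, q1, q2, -⟩ := hd
      exact ⟨Q, hQ, by rw [SphericalPolygon.piece, q1, q2]⟩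
  · intro a ha b hb' hab
    rw [hD] at ha hb'
    obtain ⟨haV, P, hP, p1, p2, -⟩ := ha
    obtain ⟨hbV, Q, hQ, q1, q2, -⟩ := hb'
    obtain ⟨r, hr, r1, r2, r3⟩ := hV.third a haV b hbV hab
    have hF := mem_faces_triple hV.c_upper haV hbV hr hab r1 r2
    -- A face on two adjacent deleted vertices would belong to both caps. The caps then coincide and
    -- `b` would be its own neighbour.
    have hPQ := tile_unique hV hs hP hQ (isUnionOf_sep p2) (isUnionOf_sep q2) (F := {a, b, r})
      ⟨hF, by simp⟩ ⟨hF, by simp⟩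
    have hba : b ∈ neighbours V c a := ⟨hbV, hab⟩
    rw [← p1, hPQ, q1] at hba
    exact hself b hba

/-- The vertices of a copy of `V` placed at one tile contain the vertices of all tiles. -/
theorem exists_copy (hV : IsDeltahedron V c k) (hVne : V.Nonempty)
    (hs : ∀ P ∈ T.tiles, P.HasShape c (P.angle 0))
    (hturn : ∀ P ∈ T.tiles, ContainsTurns V c (P.angle 0)) (hT : T.tiles.Nonempty)
    (hadj : ∀ a ∈ V, (neighbours V c a).Nonempty) :
    ∃ L, IsRot L ∧ ∀ P ∈ T.tiles, range P.vertex ⊆ sphereMap L '' V := by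
  obtain ⟨P₀, hP₀⟩ := hT
  obtain ⟨p, hp⟩ := hVne
  obtain ⟨q, hq, hpq⟩ := hadj p hp
  -- Place an edge of `V` on an edge of `P₀`; turning along the boundary and crossing shared edges
  -- then never leaves the copy of `V`.
  obtain ⟨L, hL, h1, h2⟩ := exists_rot (norm_eq_of_mem_sphere p) (norm_eq_of_mem_sphere q)
    (norm_eq_of_mem_sphere (P₀.vertex 0)) (norm_eq_of_mem_sphere (P₀.vertex (0 + 1)))
    (hpq.trans ((hs P₀ hP₀).1 0).symm) (by rw [hpq]; exact hV.sq_lt_one)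
  refine ⟨L, hL, T.tile_induction ?_ hP₀ ?_⟩
  · rintro P hP Q hQ hPV ⟨i, j, e1, e2⟩
    exact (hs Q hQ).range_subset ((hturn Q hQ).image hL) (e2 ▸ hPV (mem_range_self _))
      (e1 ▸ hPV (mem_range_self _))
  · exact (hs P₀ hP₀).range_subset ((hturn P₀ hP₀).image hL) (j := 0)
      ⟨p, hp, Subtype.ext h1⟩ ⟨q, hq, Subtype.ext h2⟩

end SphericalTiling

/-! ### Equivariance of the listed tilings -/

theorem deleteVertices_image (L : E3 ≃ₗᵢ[ℝ] E3) (V : Set S2) (c : ℝ) (D : Set S2) :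
    deleteVertices (sphereMap L '' V) c (sphereMap L '' D) =
      (fun p => (sphereMap L '' p.1, sphereMap L '' p.2)) '' deleteVertices V c D := by
  have hinj := (sphereMap L).injective
  have hU : ∀ d, (⋃ F ∈ {F | F ∈ faces (sphereMap L '' V) c ∧ sphereMap L d ∈ F},
      centralProjection F) = sphereMap L '' ⋃ F ∈ {F | F ∈ faces V c ∧ d ∈ F},
        centralProjection F := by
    intro d
    rw [image_iUnion₂]
    simp only [← centralProjection_image]
    ext x
    simp only [mem_iUnion, exists_prop, mem_ofPred_eq, mem_faces_image]
    constructor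
    · rintro ⟨_, ⟨⟨G, hG, rfl⟩, hd⟩, hx⟩
      exact ⟨G, ⟨hG, (hinj.mem_set_image).1 hd⟩, hx⟩
    · rintro ⟨G, ⟨hG, hd⟩, hx⟩
      exact ⟨_, ⟨⟨G, hG, rfl⟩, mem_image_of_mem _ hd⟩, hx⟩
  apply Subset.antisymm
  · rintro _ (⟨F, hF, hdF, rfl⟩ | ⟨_, ⟨d, hd, rfl⟩, rfl⟩)
    · obtain ⟨G, hG, rfl⟩ := (mem_faces_image L).1 hF
      exact ⟨_, Or.inl ⟨G, hG, (disjoint_image_iff hinj).1 hdF, rfl⟩, by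
        rw [centralProjection_image]⟩
    · exact ⟨_, Or.inr ⟨d, hd, rfl⟩, by rw [hU, neighbours_image]⟩
  · rintro _ ⟨_, ⟨G, hG, hdG, rfl⟩ | ⟨d, hd, rfl⟩, rfl⟩
    · exact Or.inl ⟨_, image_mem_faces L hG, (disjoint_image_iff hinj).2 hdG, by
        rw [centralProjection_image]⟩
    · exact Or.inr ⟨_, mem_image_of_mem _ hd, by rw [hU, neighbours_image]⟩

theorem pyramid_image (L : E3 ≃ₗᵢ[ℝ] E3) (V : Set S2) (c : ℝ) (d : S2) :
    pyramid (sphereMap L '' V) c (sphereMap L d) =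
      (fun p => (sphereMap L '' p.1, sphereMap L '' p.2)) '' pyramid V c d := by
  have hinj := (sphereMap L).injective
  have hU : (⋃ F ∈ {F | F ∈ faces (sphereMap L '' V) c ∧ sphereMap L d ∉ F},
      centralProjection F) = sphereMap L '' ⋃ F ∈ {F | F ∈ faces V c ∧ d ∉ F},
        centralProjection F := by
    rw [image_iUnion₂]
    simp only [← centralProjection_image]
    ext x
    simp only [mem_iUnion, exists_prop, mem_ofPred_eq, mem_faces_image]
    constructor
    · rintro ⟨_, ⟨⟨G, hG, rfl⟩, hd⟩, hx⟩
      exact ⟨G, ⟨hG, fun h => hd (mem_image_of_mem _ h)⟩, hx⟩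
    · rintro ⟨G, ⟨hG, hd⟩, hx⟩
      exact ⟨_, ⟨⟨G, hG, rfl⟩, fun h => hd ((hinj.mem_set_image).1 h)⟩, hx⟩
  apply Subset.antisymm
  · rintro _ (⟨F, hF, hdF, rfl⟩ | h)
    · obtain ⟨G, hG, rfl⟩ := (mem_faces_image L).1 hF
      exact ⟨_, Or.inl ⟨G, hG, (hinj.mem_set_image).1 hdF, rfl⟩, by
        rw [centralProjection_image]⟩
    · rw [mem_singleton_iff.1 h]
      exact ⟨_, Or.inr rfl, by rw [hU, neighbours_image]⟩
  · rintro _ ⟨_, ⟨G, hG, hdG, rfl⟩ | h, rfl⟩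
    · exact Or.inl ⟨_, image_mem_faces L hG, mem_image_of_mem _ hdG, by
        rw [centralProjection_image]⟩
    · rw [mem_singleton_iff.1 h]
      exact Or.inr (by rw [hU, neighbours_image]; rfl)

end SphTiling
end
noncomputable section
namespace SphTiling

open ZPhi

/-! ### Symmetries -/

theorem reflection_orthogonal_singleton_apply (u x : E3) :
    (Submodule.span ℝ {u})ᗮ.reflection x = x - (2 * (inner ℝ u x / inner ℝ u u : ℝ)) • u := by
  rw [Submodule.reflection_orthogonal_apply, Submodule.reflection_singleton_apply,
    real_inner_self_eq_norm_sq]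
  simp only [RCLike.ofReal_real_eq_id, id_eq]
  module

/-- The reflection in the plane bisecting `p` and `q`. In `hrefl` its formula is multiplied by the
square norm of `Z k - Z l`, which avoids division in `ℤ[φ]`. -/
theorem IsTable.exists_reflection {n : ℕ} {Z : Fin n → ZPhi × ZPhi × ZPhi} {N : ℝ} {V : Set S2}
    {c : ℝ} {e : ZPhi} (h : IsTable Z N V c e) {p q : S2} (hpq : p ≠ q) {k l : Fin n}
    (hk : p.1 = N⁻¹ • vec (Z k)) (hl : q.1 = N⁻¹ • vec (Z l))
    (hrefl : ∀ m, ∃ m', smul (dot (Z k - Z l) (Z k - Z l)) (Z m') =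
      smul (dot (Z k - Z l) (Z k - Z l)) (Z m) -
        smul (mul (2, 0) (dot (Z k - Z l) (Z m))) (Z k - Z l)) :
    ∃ L, sphereMap L '' V = V ∧ sphereMap L p = q ∧
      ∀ x : S2, inner ℝ x.1 p.1 = (inner ℝ x.1 q.1 : ℝ) → sphereMap L x = x := by
  have hN := h.N_pos
  set L := (Submodule.span ℝ {p.1 - q.1})ᗮ.reflection with hL
  have happ : ∀ x, L x = _ := reflection_orthogonal_singleton_apply (p.1 - q.1)
  have hmaps : sphereMap L '' V ⊆ V := by
    rintro _ ⟨x, hx, rfl⟩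
    obtain ⟨m, hm⟩ := (h.mem_iff x).1 hx
    obtain ⟨m', hm'⟩ := hrefl m
    refine (h.mem_iff _).2 ⟨m', ?_⟩
    have hu : p.1 - q.1 = N⁻¹ • vec (Z k - Z l) := by rw [hk, hl, vec_sub, smul_sub]
    have hne : val (dot (Z k - Z l) (Z k - Z l)) ≠ 0 := by
      intro h0
      rw [← inner_vec, inner_self_eq_zero] at h0
      rw [h0, smul_zero, sub_eq_zero] at hu
      exact hpq (Subtype.ext hu)
    have hv := congrArg vec hm'
    rw [vec_sub, vec_smul, vec_smul, vec_smul, val_mul] at hv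
    have h2 : val (2, 0) = 2 := by simp [val]
    rw [h2] at hv
    rw [sphereMap_val, happ, hu, hm, real_inner_smul_left, real_inner_smul_right,
      real_inner_smul_left, real_inner_smul_right, inner_vec, inner_vec]
    generalize Z k - Z l = d at *
    have hZ : vec (Z m') = vec (Z m) -
        (2 * val (dot d (Z m)) / val (dot d d)) • vec d := by
      apply smul_right_injective E3 hne
      simp only
      rw [hv, smul_sub, smul_smul, mul_div_cancel₀ _ hne]
    rw [hZ, smul_sub, smul_smul, smul_smul]
    congr 2
    field_simp
  refine ⟨L, Subset.antisymm hmaps ?_, ?_, ?_⟩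
  · intro x hx
    exact ⟨sphereMap L x, hmaps (mem_image_of_mem _ hx), Subtype.ext (by
      rw [sphereMap_val, sphereMap_val, hL, Submodule.reflection_reflection])⟩
  · apply Subtype.ext
    rw [sphereMap_val, hL]
    exact Submodule.reflection_sub (by rw [norm_eq_of_mem_sphere, norm_eq_of_mem_sphere])
  · intro x hx
    apply Subtype.ext
    have h0 : inner ℝ (p.1 - q.1) x.1 = (0 : ℝ) := by
      rw [real_inner_comm, inner_sub_right, hx, sub_self]
    rw [sphereMap_val, happ, h0]
    simp

theorem sphereMap_trans_image (K L : E3 ≃ₗᵢ[ℝ] E3) (D : Set S2) :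
    sphereMap (K.trans L) '' D = sphereMap L '' (sphereMap K '' D) := by
  rw [image_image]; rfl

/-- `L` is a symmetry of `V`. -/
def IsSymm (V : Set S2) (L : E3 ≃ₗᵢ[ℝ] E3) : Prop := sphereMap L '' V = V

theorem IsSymm.trans {V : Set S2} {K L : E3 ≃ₗᵢ[ℝ] E3} (hK : IsSymm V K) (hL : IsSymm V L) :
    IsSymm V (K.trans L) := by
  rw [IsSymm, sphereMap_trans_image, hK, hL]

theorem isSymm_refl (V : Set S2) : IsSymm V (LinearIsometryEquiv.refl ℝ E3) := by
  have : ⇑(sphereMap (LinearIsometryEquiv.refl ℝ E3)) = id := rfl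
  rw [IsSymm, this, image_id]

theorem IsSymm.mem {V : Set S2} {L : E3 ≃ₗᵢ[ℝ] E3} (hL : IsSymm V L) {x : S2} (hx : x ∈ V) :
    sphereMap L x ∈ V := by
  rw [← hL]; exact mem_image_of_mem _ hx

/-- Antipodal pairs, with product `(-2, -1)`, are excluded: the plane perpendicular to a fivefold
axis is not a mirror of the icosahedron. -/
theorem icoTable_reflection : ∀ k l, dot (icoTable k) (icoTable l) ≠ (-2, -1) → ∀ m, ∃ m',
    smul (dot (icoTable k - icoTable l) (icoTable k - icoTable l)) (icoTable m') =
      smul (dot (icoTable k - icoTable l) (icoTable k - icoTable l)) (icoTable m) -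
        smul (mul (2, 0) (dot (icoTable k - icoTable l) (icoTable m)))
          (icoTable k - icoTable l) := by
  decide +kernel

theorem octTable_reflection : ∀ k l m, ∃ m',
    smul (dot (octTable k - octTable l) (octTable k - octTable l)) (octTable m') =
      smul (dot (octTable k - octTable l) (octTable k - octTable l)) (octTable m) -
        smul (mul (2, 0) (dot (octTable k - octTable l) (octTable m)))
          (octTable k - octTable l) := by
  decide +kernel

theorem icoTable_dot : ∀ k l, k = l ∨ dot (icoTable k) (icoTable l) = (0, 1) ∨
    dot (icoTable k) (icoTable l) = (0, -1) ∨ dot (icoTable k) (icoTable l) = (-2, -1) := by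
  decide +kernel

theorem icoTable_no_four : ∀ i j, dot (icoTable i) (icoTable j) = (0, -1) →
    ∀ k, dot (icoTable i) (icoTable k) = (0, -1) → dot (icoTable j) (icoTable k) = (0, -1) →
    ∀ l, dot (icoTable i) (icoTable l) = (0, -1) → dot (icoTable j) (icoTable l) = (0, -1) →
      dot (icoTable k) (icoTable l) ≠ (0, -1) := by
  decide +kernel

theorem neg_inv_sqrt_five_eq : -(1 / √5) = val (0, -1) / icoNorm ^ 2 := by
  rw [isTable_ico.c_eq, show ((0, -1) : ZPhi) = -(0, 1) from rfl, val_neg, neg_div]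

theorem neg_one_eq_val : (-1 : ℝ) = val (-2, -1) / icoNorm ^ 2 := by
  have := icoNorm_pos
  rw [eq_div_iff (by positivity), icoNorm_sq]
  simp only [val]
  push_cast
  ring

theorem ico_inner_cases {p q : S2} (hp : p ∈ icoVertices) (hq : q ∈ icoVertices) : p = q ∨
    inner ℝ p.1 q.1 = 1 / √5 ∨ inner ℝ p.1 q.1 = -(1 / √5) ∨ inner ℝ p.1 q.1 = (-1 : ℝ) := by
  have h := isTable_ico
  obtain ⟨k, hk⟩ := (h.mem_iff p).1 hp
  obtain ⟨l, hl⟩ := (h.mem_iff q).1 hq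
  rw [h.inner_eq_iff hk hl, neg_inv_sqrt_five_eq, neg_one_eq_val, h.inner_eq_val_iff hk hl,
    h.inner_eq_val_iff hk hl]
  rcases icoTable_dot k l with rfl | h'
  · exact Or.inl (Subtype.ext (hk.trans hl.symm))
  · exact Or.inr h'

theorem ico_no_four {p q r s : S2} (hp : p ∈ icoVertices) (hq : q ∈ icoVertices)
    (hr : r ∈ icoVertices) (hs : s ∈ icoVertices) (h1 : inner ℝ p.1 q.1 = -(1 / √5))
    (h2 : inner ℝ p.1 r.1 = -(1 / √5)) (h3 : inner ℝ q.1 r.1 = -(1 / √5))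
    (h4 : inner ℝ p.1 s.1 = -(1 / √5)) (h5 : inner ℝ q.1 s.1 = -(1 / √5)) :
    inner ℝ r.1 s.1 ≠ -(1 / √5) := by
  have h := isTable_ico
  obtain ⟨k, hk⟩ := (h.mem_iff p).1 hp
  obtain ⟨l, hl⟩ := (h.mem_iff q).1 hq
  obtain ⟨m, hm⟩ := (h.mem_iff r).1 hr
  obtain ⟨j, hj⟩ := (h.mem_iff s).1 hs
  rw [neg_inv_sqrt_five_eq] at h1 h2 h3 h4 h5 ⊢
  rw [h.inner_eq_val_iff hk hl] at h1
  rw [h.inner_eq_val_iff hk hm] at h2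
  rw [h.inner_eq_val_iff hl hm] at h3
  rw [h.inner_eq_val_iff hk hj] at h4
  rw [h.inner_eq_val_iff hl hj] at h5
  rw [Ne, h.inner_eq_val_iff hm hj]
  exact icoTable_no_four k l h1 m h2 h3 j h4 h5

theorem ico_exists_reflection {p q : S2} (hp : p ∈ icoVertices) (hq : q ∈ icoVertices)
    (hpq : inner ℝ p.1 q.1 ≠ (-1 : ℝ)) : ∃ L, IsSymm icoVertices L ∧ sphereMap L p = q ∧
      ∀ x : S2, inner ℝ x.1 p.1 = (inner ℝ x.1 q.1 : ℝ) → sphereMap L x = x := by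
  by_cases hne : p = q
  · exact ⟨_, isSymm_refl _, hne, fun x _ => rfl⟩
  have h := isTable_ico
  obtain ⟨k, hk⟩ := (h.mem_iff p).1 hp
  obtain ⟨l, hl⟩ := (h.mem_iff q).1 hq
  rw [neg_one_eq_val, Ne, h.inner_eq_val_iff hk hl] at hpq
  exact h.exists_reflection hne hk hl (icoTable_reflection k l hpq)

/-- One reflection suffices unless the points are antipodal; then two do, by way of a neighbour of
`p`. -/
theorem ico_exists_symm {p q : S2} (hp : p ∈ icoVertices) (hq : q ∈ icoVertices) :
    ∃ L, IsSymm icoVertices L ∧ sphereMap L p = q := by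
  have hc := one_div_sqrt_five_bounds
  by_cases hpq : inner ℝ p.1 q.1 = (-1 : ℝ)
  · obtain ⟨i, s, t, rfl⟩ := hp
    have h1 := inner_icoVertex_neg i s t
    have h2 := eq_neg_of_inner_eq_neg_one hpq
    obtain ⟨K, hK, hK1, -⟩ := ico_exists_reflection (icoVertex_mem i s t) (icoVertex_mem i (-s) t)
      (by rw [h1]; linarith)
    obtain ⟨L, hL, hL1, -⟩ := ico_exists_reflection (icoVertex_mem i (-s) t) hq
      (by rw [h2, inner_neg_right, real_inner_comm, h1]; linarith)
    refine ⟨_, hK.trans hL, ?_⟩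
    rw [← hL1, ← hK1]; rfl
  · obtain ⟨L, hL, hL1, -⟩ := ico_exists_reflection hp hq hpq
    exact ⟨L, hL, hL1⟩

theorem oct_exists_symm {p q : S2} (hp : p ∈ octVertices) (hq : q ∈ octVertices) :
    ∃ L, IsSymm octVertices L ∧ sphereMap L p = q := by
  by_cases hne : p = q
  · exact ⟨_, isSymm_refl _, hne⟩
  have h := isTable_oct
  obtain ⟨k, hk⟩ := (h.mem_iff p).1 hp
  obtain ⟨l, hl⟩ := (h.mem_iff q).1 hq
  obtain ⟨L, hL, hL1, -⟩ := h.exists_reflection hne hk hl (octTable_reflection k l)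
  exact ⟨L, hL, hL1⟩

theorem ico_inner_ne_neg_one {p q r : S2} (h1 : inner ℝ p.1 q.1 = -(1 / √5))
    (h2 : inner ℝ p.1 r.1 = -(1 / √5)) : inner ℝ q.1 r.1 ≠ (-1 : ℝ) := by
  intro h
  rw [eq_neg_of_inner_eq_neg_one h, inner_neg_right, h1] at h2
  have : (0 : ℝ) < 1 / √5 := by positivity
  linarith

/-- After moving `p` to `p'`, reflect the image of `q` to `q'`. The two are not antipodal, and `p'`
is equidistant from them, so it stays fixed. Triples are treated in the same way. -/
theorem ico_exists_symm_pair {p q p' q' : S2} (hp : p ∈ icoVertices) (hq : q ∈ icoVertices)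
    (hp' : p' ∈ icoVertices) (hq' : q' ∈ icoVertices) (h : inner ℝ p.1 q.1 = -(1 / √5))
    (h' : inner ℝ p'.1 q'.1 = -(1 / √5)) :
    ∃ L, IsSymm icoVertices L ∧ sphereMap L p = p' ∧ sphereMap L q = q' := by
  obtain ⟨K, hK, rfl⟩ := ico_exists_symm hp hp'
  have h1 : inner ℝ (sphereMap K p).1 (sphereMap K q).1 = -(1 / √5) := by
    rw [inner_sphereMap, h]
  obtain ⟨L, hL, hL1, hL2⟩ := ico_exists_reflection (hK.mem hq) hq' (ico_inner_ne_neg_one h1 h')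
  exact ⟨_, hK.trans hL, hL2 _ (h1.trans h'.symm), hL1⟩

theorem ico_exists_symm_triple {p q r p' q' r' : S2} (hp : p ∈ icoVertices) (hq : q ∈ icoVertices)
    (hr : r ∈ icoVertices) (hp' : p' ∈ icoVertices) (hq' : q' ∈ icoVertices)
    (hr' : r' ∈ icoVertices) (h1 : inner ℝ p.1 q.1 = -(1 / √5))
    (h2 : inner ℝ p.1 r.1 = -(1 / √5)) (h3 : inner ℝ q.1 r.1 = -(1 / √5))
    (h1' : inner ℝ p'.1 q'.1 = -(1 / √5)) (h2' : inner ℝ p'.1 r'.1 = -(1 / √5))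
    (h3' : inner ℝ q'.1 r'.1 = -(1 / √5)) : ∃ L, IsSymm icoVertices L ∧ sphereMap L p = p' ∧
      sphereMap L q = q' ∧ sphereMap L r = r' := by
  obtain ⟨K, hK, rfl, rfl⟩ := ico_exists_symm_pair hp hq hp' hq' h1 h1'
  have e2 : inner ℝ (sphereMap K p).1 (sphereMap K r).1 = -(1 / √5) := by rw [inner_sphereMap, h2]
  have e3 : inner ℝ (sphereMap K q).1 (sphereMap K r).1 = -(1 / √5) := by rw [inner_sphereMap, h3]
  obtain ⟨L, hL, hL1, hL2⟩ := ico_exists_reflection (hK.mem hr) hr' (ico_inner_ne_neg_one e2 h2')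
  exact ⟨_, hK.trans hL, hL2 _ (e2.trans h2'.symm), hL2 _ (e3.trans h3'.symm), hL1⟩

theorem inner_icoVertex_eq_neg_of_inner {i j : Fin 3} {s t s' t' : ℤˣ}
    (h : inner ℝ (icoVector i s t) (icoVector j s' t') = -Real.goldenRatio) :
    inner ℝ (icoVertex i s t).1 (icoVertex j s' t').1 = -(1 / √5) := by
  have := icoNorm_pos
  rw [icoVertex_val, icoVertex_val, real_inner_smul_left, real_inner_smul_right, h,
    ← goldenRatio_div_icoNorm_sq]
  field_simp

/-- The independent sets of vertices of the icosahedron, up to symmetry. -/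
theorem ico_independent {D : Set S2} (hD : D ⊆ icoVertices)
    (hind : ∀ a ∈ D, ∀ b ∈ D, inner ℝ a.1 b.1 ≠ 1 / √5) : ∃ L, IsSymm icoVertices L ∧
      (D = sphereMap L '' ∅ ∨ D = sphereMap L '' {icoVertex 0 1 1, icoVertex 0 (-1) (-1)} ∨
      D = sphereMap L '' {icoVertex 0 1 1} ∨
      D = sphereMap L '' {icoVertex 0 1 1, icoVertex 0 1 (-1)} ∨
      D = sphereMap L '' {icoVertex 0 1 1, icoVertex 0 1 (-1), icoVertex 2 1 (-1)}) := by
  have hpos : (0 : ℝ) < 1 / √5 := by positivity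
  have hcases : ∀ a ∈ D, ∀ b ∈ D, a ≠ b → inner ℝ a.1 b.1 = -(1 / √5) ∨
      inner ℝ a.1 b.1 = (-1 : ℝ) := by
    intro a ha b hb hab
    rcases ico_inner_cases (hD ha) (hD hb) with h | h | h
    · exact absurd h hab
    · exact absurd h (hind a ha b hb)
    · exact h
  have hm := icoVertex_mem
  have h01 : inner ℝ (icoVertex 0 1 1).1 (icoVertex 0 1 (-1)).1 = -(1 / √5) := by
    apply inner_icoVertex_eq_neg_of_inner
    rw [inner_eq_coord]
    simp [icoVector]
    linear_combination -Real.goldenRatio_sq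
  have h02 : inner ℝ (icoVertex 0 1 1).1 (icoVertex 2 1 (-1)).1 = -(1 / √5) := by
    apply inner_icoVertex_eq_neg_of_inner
    rw [inner_eq_coord]
    simp [icoVector]
  have h12 : inner ℝ (icoVertex 0 1 (-1)).1 (icoVertex 2 1 (-1)).1 = -(1 / √5) := by
    apply inner_icoVertex_eq_neg_of_inner
    rw [inner_eq_coord]
    simp [icoVector]
  have hneg : (icoVertex 0 (-1) (-1)).1 = -(icoVertex 0 1 1).1 := by
    rw [icoVertex_val, icoVertex_val, ← smul_neg]
    congr 1
    apply E3.ext' <;> simp [icoVector]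
  rcases D.eq_empty_or_nonempty with rfl | ⟨a, ha⟩
  · exact ⟨_, isSymm_refl _, Or.inl (by rw [image_empty])⟩
  by_cases h1 : D = {a}
  · obtain ⟨L, hL, hLa⟩ := ico_exists_symm (hm 0 1 1) (hD ha)
    exact ⟨L, hL, Or.inr (Or.inr (Or.inl (by rw [h1, image_singleton, hLa])))⟩
  obtain ⟨b, hb, hba⟩ : ∃ b ∈ D, b ≠ a := by
    by_contra! hall
    exact h1 (Subset.antisymm hall (by simpa using ha))
  rcases hcases a ha b hb hba.symm with hab | hab
  swap
  · have hb' := eq_neg_of_inner_eq_neg_one hab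
    obtain ⟨L, hL, hLa⟩ := ico_exists_symm (hm 0 1 1) (hD ha)
    have hLb : sphereMap L (icoVertex 0 (-1) (-1)) = b := by
      apply Subtype.ext
      rw [hb', ← hLa, sphereMap_val, sphereMap_val, hneg, map_neg]
    refine ⟨L, hL, Or.inr (Or.inl ?_)⟩
    rw [image_pair, hLa, hLb]
    -- A third vertex at distance two from `a` would be adjacent to its antipode `b`, so the
    -- antipodal pair is maximal.
    refine Subset.antisymm (fun x hx => ?_) (pair_subset ha hb)
    by_contra hx'
    simp only [mem_insert_iff, mem_singleton_iff, not_or] at hx'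
    rcases hcases x hx a ha hx'.1 with h | h
    · apply hind x hx b hb
      rw [hb', inner_neg_right, h, neg_neg]
    · apply hx'.2
      apply Subtype.ext
      rw [hb', eq_neg_of_inner_eq_neg_one h, neg_neg]
  · have hthird : ∀ x ∈ D, x ≠ a → x ≠ b → inner ℝ a.1 x.1 = -(1 / √5) ∧
        inner ℝ b.1 x.1 = -(1 / √5) := by
      have aux : ∀ a ∈ D, ∀ b ∈ D, inner ℝ a.1 b.1 = -(1 / √5) → ∀ x ∈ D, x ≠ a →
          inner ℝ a.1 x.1 = -(1 / √5) := by
        intro a ha b hb hab x hx hxa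
        rcases hcases a ha x hx hxa.symm with h | h
        · exact h
        · refine absurd ?_ (hind x hx b hb)
          rw [eq_neg_of_inner_eq_neg_one h, inner_neg_left, hab, neg_neg]
      intro x hx hxa hxb
      exact ⟨aux a ha b hb hab x hx hxa, aux b hb a ha (by rw [real_inner_comm]; exact hab) x hx hxb⟩
    by_cases h2 : D = {a, b}
    · obtain ⟨L, hL, hLa, hLb⟩ := ico_exists_symm_pair (hm 0 1 1) (hm 0 1 (-1)) (hD ha) (hD hb)
        h01 hab
      exact ⟨L, hL, Or.inr (Or.inr (Or.inr (Or.inl (by rw [h2, image_pair, hLa, hLb]))))⟩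
    obtain ⟨x, hx, hxab⟩ : ∃ x ∈ D, x ∉ ({a, b} : Set S2) := by
      by_contra! hall
      exact h2 (Subset.antisymm hall (pair_subset ha hb))
    simp only [mem_insert_iff, mem_singleton_iff, not_or] at hxab
    obtain ⟨hax, hbx⟩ := hthird x hx hxab.1 hxab.2
    obtain ⟨L, hL, hLa, hLb, hLx⟩ := ico_exists_symm_triple (hm 0 1 1) (hm 0 1 (-1)) (hm 2 1 (-1))
      (hD ha) (hD hb) (hD hx) h01 h02 h12 hab hax hbx
    refine ⟨L, hL, Or.inr (Or.inr (Or.inr (Or.inr ?_)))⟩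
    rw [image_insert_eq, image_pair, hLa, hLb, hLx]
    refine Subset.antisymm (fun y hy => ?_) (insert_subset ha (pair_subset hb hx))
    by_contra hy'
    simp only [mem_insert_iff, mem_singleton_iff, not_or] at hy'
    obtain ⟨hay, hby⟩ := hthird y hy hy'.1 hy'.2.1
    rcases hcases x hx y hy (Ne.symm hy'.2.2) with h | h
    · exact ico_no_four (hD ha) (hD hb) (hD hx) (hD hy) hab hax hbx hay hby h
    · exact ico_inner_ne_neg_one hax hay h

/-! ### The classification -/

namespace SphericalTiling

variable {T : SphericalTiling} {V : Set S2} {c : ℝ}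

theorem isCopyOf_deleteVertices {L K : E3 ≃ₗᵢ[ℝ] E3} (hK : IsSymm V K) {D : Set S2}
    (h : SphericalPolygon.piece '' T.tiles =
      deleteVertices (sphereMap L '' V) c (sphereMap L '' (sphereMap K '' D))) :
    T.IsCopyOf (deleteVertices V c D) := by
  refine ⟨sphereMap (K.trans L), ?_⟩
  rw [h, ← deleteVertices_image, sphereMap_trans_image, sphereMap_trans_image, hK]

theorem isCopyOf_pyramid {L K : E3 ≃ₗᵢ[ℝ] E3} (hK : IsSymm V K) {a : S2}
    (h : SphericalPolygon.piece '' T.tiles =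
      pyramid (sphereMap L '' V) c (sphereMap L (sphereMap K a))) :
    T.IsCopyOf (pyramid V c a) := by
  refine ⟨sphereMap (K.trans L), ?_⟩
  rw [h, ← pyramid_image, sphereMap_trans_image, hK]
  rfl

/-- A tiling by blocks is a pyramid, or it is obtained by deleting vertices. -/
theorem classification {k : ℕ} {β m : ℝ} {L : E3 ≃ₗᵢ[ℝ] E3}
    (hV : IsDeltahedron (sphereMap L '' V) c k) (hreg : T.IsRegular)
    (hdeg : ∀ v ∈ T.vertices, 3 ≤ T.degree v) (hm0 : 0 < m) (hm : ∀ P ∈ T.tiles, m ≤ P.angle 0)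
    (hβ : Real.pi ≤ β)
    (hs : ∀ P ∈ T.tiles, range P.vertex ⊆ sphereMap L '' V ∧
      ∀ i, inner ℝ (P.vertex i).1 (P.vertex (i + 1)).1 = c)
    (hb : ∀ P ∈ T.tiles, IsBlock (sphereMap L '' V) c β P) :
    (∃ a ∈ V, SphericalPolygon.piece '' T.tiles = pyramid (sphereMap L '' V) c (sphereMap L a)) ∨
    ∃ D ⊆ V, (∀ a ∈ D, ∀ b ∈ D, inner ℝ a.1 b.1 ≠ c) ∧
      (D.Nonempty → Real.pi < β) ∧
      SphericalPolygon.piece '' T.tiles = deleteVertices (sphereMap L '' V) c (sphereMap L '' D) := by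
  by_cases hco : ∃ P ∈ T.tiles, ∃ d ∈ sphereMap L '' V,
      range P.vertex = neighbours (sphereMap L '' V) c d ∧ closure P.region =
      ⋃ F ∈ {F | F ∈ faces (sphereMap L '' V) c ∧ d ∉ F}, centralProjection F ∧ P.angle 0 = β
  · obtain ⟨P, hP, _, ⟨a, ha, rfl⟩, h1, h2, h3⟩ := hco
    exact Or.inl ⟨a, ha, pieces_eq_pyramid hV hreg hdeg hm0 hm hβ hs hb hP h1 h2 h3⟩
  right
  -- The proposition `p` records that caps occur only for `β > π`; for the octahedron it forces `D`
  -- to be empty.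
  obtain ⟨h1, h2⟩ := pieces_eq_deleteVertices (p := Real.pi < β) hV hs rfl fun P hP => by
    rcases hb P hP with ⟨h1, h2⟩ | ⟨d, hd, h1, h2, h3, h4⟩ | ⟨d, hd, h1, h2, h3⟩
    · exact Or.inl ⟨h1, h2⟩
    · exact Or.inr ⟨d, hd, h1, h2, h4⟩
    · exact absurd ⟨P, hP, d, hd, h1, h2, h3⟩ hco
  set D' := {d | d ∈ sphereMap L '' V ∧ ∃ P ∈ T.tiles,
    range P.vertex = neighbours (sphereMap L '' V) c d ∧ closure P.region =
      ⋃ F ∈ {F | F ∈ faces (sphereMap L '' V) c ∧ d ∈ F}, centralProjection F ∧ Real.pi < β} with hD'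
  obtain ⟨D, hD, hDD⟩ := subset_image_iff.1 (show D' ⊆ sphereMap L '' V from fun d hd => hd.1)
  rw [← hDD] at h1 h2
  refine ⟨D, hD, ?_, ?_, h1⟩
  · intro a ha b hb hab
    exact h2 _ (mem_image_of_mem _ ha) _ (mem_image_of_mem _ hb) (by rwa [inner_sphereMap])
  · rintro ⟨d, hd⟩
    have : sphereMap L d ∈ D' := hDD ▸ mem_image_of_mem _ hd
    obtain ⟨-, -, -, -, -, h⟩ := this
    exact h

theorem octahedral (hreg : T.IsRegular) (hdeg : ∀ v ∈ T.vertices, 3 ≤ T.degree v)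
    (h : T.HasTriangleWithAngle (Real.pi / 2)) : T.IsCopyOf octahedron ∨ T.IsCopyOf J1 := by
  have hpi := Real.pi_pos
  obtain ⟨P₀, hP₀, hn, hα⟩ := h
  obtain ⟨c, hs₀⟩ : ∃ c, P₀.HasShape c (P₀.angle 0) := ⟨_, (hreg P₀ hP₀).hasShape⟩
  have hc := hs₀.angle_eq
  rw [hα 0, hn] at hc
  push_cast at hc
  rw [cos_two_pi_div_three, Real.cos_pi_div_two] at hc
  obtain rfl : c = 0 := by linarith
  have hs := hreg.hasShape hP₀ hs₀
  have htiles := octahedral_tiles hreg hdeg hs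
  obtain ⟨L, hL, hLV⟩ := exists_copy isDeltahedron_oct ⟨_, octVertex_mem 0 1⟩ hs (fun P hP =>
    octVertices_containsTurns ((htiles P hP).imp And.right And.right)) ⟨P₀, hP₀⟩ (by
      rintro _ ⟨i, s, rfl⟩
      exact ⟨octVertex (i + 1) 1, octVertex_mem _ _, inner_octVertex (by revert i; decide) _ _⟩)
  have hV := isDeltahedron_oct.image hL
  rcases classification hV hreg hdeg (m := Real.pi / 2) (by positivity) (fun P hP => by
      rcases htiles P hP with ⟨-, h⟩ | ⟨-, h⟩ <;> linarith) le_rfl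
      (fun P hP => ⟨hLV P hP, (hs P hP).1⟩)
      (fun P hP => hV.isBlock_oct (hs P hP) (hLV P hP) (htiles P hP)) with
    ⟨a, ha, h⟩ | ⟨D, hD, -, hne, h⟩
  · obtain ⟨K, hK, rfl⟩ := oct_exists_symm (octVertex_mem 0 1) ha
    exact Or.inr (isCopyOf_pyramid hK h)
  · rcases D.eq_empty_or_nonempty with rfl | hne'
    · refine Or.inl (isCopyOf_deleteVertices (isSymm_refl _) (L := L) ?_)
      rw [h, image_empty, image_empty, image_empty]
    · exact absurd (hne hne') (lt_irrefl _)

theorem icosahedral (hreg : T.IsRegular) (hdeg : ∀ v ∈ T.vertices, 3 ≤ T.degree v)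
    (h : T.HasTriangleWithAngle (2 * Real.pi / 5)) :
    T.IsCopyOf icosahedron ∨ T.IsCopyOf pentagonalAntiprism ∨ T.IsCopyOf J2 ∨ T.IsCopyOf J11 ∨
      T.IsCopyOf J62 ∨ T.IsCopyOf J63 := by
  have hpi := Real.pi_pos
  obtain ⟨P₀, hP₀, hn, hα⟩ := h
  obtain ⟨c, hs₀⟩ : ∃ c, P₀.HasShape c (P₀.angle 0) := ⟨_, (hreg P₀ hP₀).hasShape⟩
  have hc := hs₀.angle_eq
  rw [hα 0, hn] at hc
  push_cast at hc
  rw [cos_two_pi_div_three, cos_two_pi_div_five] at hc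
  have h5 : √5 ^ 2 = 5 := Real.sq_sqrt (by norm_num)
  obtain rfl : c = 1 / √5 := by
    rw [SphericalPolygon.inv_sqrt_five]
    -- The angle relation reads `1/2 = (1 + c) (5 - √5) / 8`; the factor `5 + √5` rationalizes it.
    linear_combination (-(2 / 5) * (5 + √5)) * hc + (1 + c) / 20 * h5
  have hs := hreg.hasShape hP₀ hs₀
  have htiles := icosahedral_tiles hreg hdeg hs
  obtain ⟨L, hL, hLV⟩ := exists_copy isDeltahedron_ico ⟨_, icoVertex_mem 0 1 1⟩ hs (fun P hP =>
    icoVertices_containsTurns ((htiles P hP).imp And.right And.right)) ⟨P₀, hP₀⟩ (by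
      rintro _ ⟨i, s, t, rfl⟩
      exact ⟨_, icoVertex_mem _ _ _, inner_icoVertex_neg _ _ _⟩)
  have hV := isDeltahedron_ico.image hL
  rcases classification hV hreg hdeg (m := 2 * Real.pi / 5) (by positivity) (fun P hP => by
      rcases htiles P hP with ⟨-, h⟩ | ⟨-, h | h⟩ <;> rw [h] <;> linarith)
      (show Real.pi ≤ 6 * Real.pi / 5 by linarith) (fun P hP => ⟨hLV P hP, (hs P hP).1⟩)
      (fun P hP => hV.isBlock_ico (hs P hP) (hLV P hP) (htiles P hP)) with
    ⟨a, ha, h⟩ | ⟨D, hD, hind, -, h⟩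
  · obtain ⟨K, hK, rfl⟩ := ico_exists_symm (icoVertex_mem 0 1 1) ha
    exact Or.inr (Or.inr (Or.inl (isCopyOf_pyramid hK h)))
  · obtain ⟨K, hK, rfl | rfl | rfl | rfl | rfl⟩ := ico_independent hD hind
    · exact Or.inl (isCopyOf_deleteVertices hK h)
    · exact Or.inr (Or.inl (isCopyOf_deleteVertices hK h))
    · exact Or.inr (Or.inr (Or.inr (Or.inl (isCopyOf_deleteVertices hK h))))
    · exact Or.inr (Or.inr (Or.inr (Or.inr (Or.inl (isCopyOf_deleteVertices hK h)))))
    · exact Or.inr (Or.inr (Or.inr (Or.inr (Or.inr (isCopyOf_deleteVertices hK h)))))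

end SphericalTiling

end SphTiling
end
theorem mainTheorem7 (T : SphTiling.SphericalTiling) (hreg : T.IsRegular)
    (hdeg : ∀ v ∈ T.vertices, 3 ≤ T.degree v) :
    (T.HasTriangleWithAngle (Real.pi / 2) →
      T.IsCopyOf SphTiling.octahedron ∨ T.IsCopyOf SphTiling.J1) ∧
    (T.HasTriangleWithAngle (2 * Real.pi / 5) →
      T.IsCopyOf SphTiling.icosahedron ∨ T.IsCopyOf SphTiling.pentagonalAntiprism ∨
      T.IsCopyOf SphTiling.J2 ∨ T.IsCopyOf SphTiling.J11 ∨
      T.IsCopyOf SphTiling.J62 ∨ T.IsCopyOf SphTiling.J63) := by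
  exact ⟨SphTiling.SphericalTiling.octahedral hreg hdeg,
    SphTiling.SphericalTiling.icosahedral hreg hdeg⟩
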